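/- **Setting.** Let $M_1(\mathbb Z)$ be the set of probability distributions on $\mathbb Z$ with the topology of weak convergence, and let $\Omega=M_1(\mathbb Z)^{\mathbb Z\times\mathbb N}$, $\mathbb N=\{1,2,\dots\}$, be the space of cookie environments $\omega=(\omega_{x,j})_{x\in\mathbb Z,\,j\ge1}$, with the product topology and its Borel $\sigma$-algebra; write $\omega_x=(\omega_{x,j})_{j\ge1}$. For $\omega\in\Omega$ and $x\in\mathbb Z$ let $P_\omega^x$ be the law of the excited random walk $(X_n)_{n\ge0}$ with $X_0=x$ and $$P_\omega^x(X_{n+1}=X_n+z\mid X_0,\dots,X_n)=\omega_{X_n,L_n(X_n)}(z),\qquad L_n(y)=\#\{0\le k\le n: X_k=y\}.$$ For $\nu\in M_1(\mathbb Z)$ with finite mean write $d(\nu)=\sum_z z\,\nu(z)$. For $M\ge 1$ and $\mu\in M_1(\mathbb Z)$ let $\Omega^+_{M,\mu}$ be the set of $\omega\in\Omega$ such that, for all $x$, $\omega_{x,j}$ has a finite mean $d(\omega_{x,j})\ge0$ for $j\le M$, and $\omega_{x,j}=\mu$ for $j>M$. For such $\omega$ put $\bar d(\omega_x)=\sum_{j=1}^M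 d(\omega_{x,j})$. **Cookie environment process.** Let $\tau_n=\inf\{k\ge0:X_k\ge n\}$. Let $\bar\omega(n)$ be the environment remaining before the step from time $n$, that is, $\bar\omega(n)_{x,j}=\omega_{x,\,\ell_n(x)+j}$ with $\ell_n(x)=\#\{0\le k<n:X_k=x\}$, and let $(\theta\omega)_{x,j}=\omega_{x+1,j}$. Put $$\zeta_n=\bigl(\theta^n\bar\omega(\tau_n),\,X_{\tau_n}-n\bigr),\quad n\ge0,\qquad \Psi=\Bigl\{(\omega,x)\in\Omega\times\mathbb Z_{\ge0}:\ P_\omega^x\bigl(\limsup_{n\to\infty}X_n=\infty\bigr)=1\Bigr\}.$$ **Assumptions.** Let $\eta$ be a probability measure on $\Omega$ such that the sequence $(\omega_x)_{x\in\mathbb Z}$ is i.i.d. under $\eta$, and such that $\eta(\Omega^+_{M,\mu})=1$ for some $M\ge1$ and some $\mu\ne\delta_0$ with mean $0$ such that $\mu([-B,B])=1$ for some $B<\infty$ and the support of $\mu$ generates the group $\mathbb Z$. Assume also that $E_\eta\bigl[\sum_{j=1}^M\sum_z|z|\,\omega_{0,j}(z)\bigr]<\infty$, and put $\delta=E_\eta\bigl[\sum_{j\ge1}d(\omega_{0,j})\bigr]$.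 **Claim.** There is a probability measure $\pi$ on $\Omega\times\mathbb Z_{\ge0}$ with $\pi(\Psi)=1$ that is stationary for the cookie environment process: if $(\omega,X_0)$ has law $\pi$ and, given $(\omega,X_0)$, the walk has law $P_\omega^{X_0}$, then $\zeta_1$ has law $\pi$, and the processes $(\zeta_{n+1})_{n\ge0}$ and $(\zeta_n)_{n\ge0}$ have the same law. Moreover: 1. $(\omega_x)_{x\ge0}$ has the same law under $\pi$ as under $\eta$, and under $\pi$ it is independent of the pair $\bigl(X_0,(\omega_x)_{x<0}\bigr)$. 2. $\omega\in\Omega^+_{M,\mu}$ for $\pi$-almost every $(\omega,X_0)$, and for every $y\in\mathbb Z$ the variable $\bar d(\omega_y)$ is $\pi$-integrable with $E_\pi[\bar d(\omega_y)]\le\delta$. -/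

import Mathlib

open MeasureTheory ProbabilityTheory Filter
open scoped ENNReal

namespace ExcitedWalk

noncomputable section

/-- Cookie environments.  `ω x j` is the step distribution used at the visit number `j + 1` to the
site `x`, so the cookies at a site are numbered from `0`.  The σ-algebra is the product of the
σ-algebras on `ProbabilityMeasure ℤ` generated by the evaluations `ν ↦ ν A`; since `ℤ` is countable
and discrete it is the Borel σ-algebra of the product of the weak topologies. -/
abbrev Env : Type := ℤ → ℕ → ProbabilityMeasure ℤ

/-- The state space `Ω × ℤ₊` of the cookie environment process. -/
abbrev State : Type := Env × ℕ

/-- The mean `d(ν) = ∑ z, z ν(z)`; meaningful when the identity is `ν`-integrable. -/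
def mean (ν : ProbabilityMeasure ℤ) : ℝ := ∫ z : ℤ, (z : ℝ) ∂(ν : Measure ℤ)

/-- `ν` has a finite mean. -/
def HasFiniteMean (ν : ProbabilityMeasure ℤ) : Prop :=
  Integrable (fun z : ℤ => (z : ℝ)) (ν : Measure ℤ)

/-- Environments with `M` cookies per site: the first `M` step distributions at each site have a
finite non-negative mean, and all the later ones are equal to `μ`. -/
def OmegaPlus (M : ℕ) (μ : ProbabilityMeasure ℤ) : Set Env :=
  {ω | ∀ x : ℤ, (∀ j < M, HasFiniteMean (ω x j) ∧ 0 ≤ mean (ω x j)) ∧ ∀ j, M ≤ j → ω x j = μ}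

/-- The law of the position at time `n + 1`, given the positions `h` at the times `0, …, n`:
the step from `h n` is drawn from the cookie at `h n` whose number is the number of visits to
`h n` strictly before time `n`. -/
def stepLaw (ω : Env) (n : ℕ) (h : (i : Finset.Iic n) → ℤ) : Measure ℤ :=
  let y : ℤ := h ⟨n, Finset.mem_Iic.2 le_rfl⟩
  let k : ℕ := (Finset.univ.filter fun i : Finset.Iic n => (i : ℕ) < n ∧ h i = y).card
  (ω y k : Measure ℤ).map fun z => y + z

/-- `stepLaw` as a transition kernel from histories to positions. -/
def stepKernel (ω : Env) (n : ℕ) : Kernel ((i : Finset.Iic n) → ℤ) ℤ where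
  toFun := stepLaw ω n
  measurable' := Measurable.of_discrete

instance (ω : Env) (n : ℕ) : IsMarkovKernel (stepKernel ω n) :=
  ⟨fun h => by
    change IsProbabilityMeasure (stepLaw ω n h)
    unfold stepLaw
    exact Measure.isProbabilityMeasure_map Measurable.of_discrete.aemeasurable⟩

/-- The quenched law `P_ω^x` of the excited random walk on the path space `ℕ → ℤ`. -/
def quenched (ω : Env) (x : ℤ) : Measure (ℕ → ℤ) :=
  Kernel.traj (X := fun _ => ℤ) (stepKernel ω) 0 fun _ => x

/-- The number of visits of the path `X` to `y` strictly before time `n`. -/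
def visits (X : ℕ → ℤ) (n : ℕ) (y : ℤ) : ℕ :=
  ((Finset.range n).filter fun k => X k = y).card

/-- Remove the first `l x` cookies from each site `x`. -/
def removeCookies (ω : Env) (l : ℤ → ℕ) : Env := fun x j => ω x (l x + j)

/-- The environment that remains just before the walk makes its step from time `n`. -/
def remaining (ω : Env) (X : ℕ → ℤ) (n : ℕ) : Env := removeCookies ω (visits X n)

/-- The left shift of environments. -/
def shift (ω : Env) : Env := fun x => ω (x + 1)

/-- The first time the path is in `[n, ∞)`; it is `0` by convention on paths that never get there,
which do not matter below. -/
def tau (X : ℕ → ℤ) (n : ℕ) : ℕ := sInf {k : ℕ | (n : ℤ) ≤ X k}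

/-- The cookie environment process: the remaining environment at the first entrance to `[n, ∞)`,
shifted by `n`, and the overshoot over `n` at that time. -/
def zeta (ω : Env) (X : ℕ → ℤ) (n : ℕ) : State :=
  (shift^[n] (remaining ω X (tau X n)), (X (tau X n) - n).toNat)

/-- `limsup X = ∞`. -/
def LimsupTop (X : ℕ → ℤ) : Prop := ∀ m : ℤ, ∃ᶠ n in atTop, m ≤ X n

/-- The set of pairs `(ω, x)` for which `limsup X = ∞` holds `P_ω^x`-almost surely. -/
def Psi : Set State := {p | ∀ᵐ X ∂(quenched p.1 (p.2 : ℤ)), LimsupTop X}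

/-- `π` is a stationary law of the cookie environment process: it is preserved by the one-step
transition probabilities `P_ω^x (ζ₁ ∈ ·)`, and the process started from `(ω, X₀)` with law `π` has
the same law as the process shifted by one unit of time. -/
structure IsStationaryLaw (π : Measure State) : Prop where
  invariant : ∀ A : Set State, MeasurableSet A →
    ∫⁻ p, quenched p.1 (p.2 : ℤ) {X | zeta p.1 X 1 ∈ A} ∂π = π A
  shift_invariant : ∀ A : Set (ℕ → State), MeasurableSet A →
    ∫⁻ p, quenched p.1 (p.2 : ℤ) {X | (fun n => zeta p.1 X (n + 1)) ∈ A} ∂π =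
      ∫⁻ p, quenched p.1 (p.2 : ℤ) {X | (fun n => zeta p.1 X n) ∈ A} ∂π

/-- The environment at the sites `x ≥ 0`. -/
def rightEnv (ω : Env) : Set.Ici (0 : ℤ) → ℕ → ProbabilityMeasure ℤ := fun x => ω x

/-- The environment at the sites `x < 0`. -/
def leftEnv (ω : Env) : Set.Iio (0 : ℤ) → ℕ → ProbabilityMeasure ℤ := fun x => ω x

/-- The total drift of the first `M` cookies at the site `x`. -/
def dbar (M : ℕ) (ω : Env) (x : ℤ) : ℝ := ∑ j ∈ Finset.range M, mean (ω x j)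

/-- The expected total drift `δ(η)` of the cookies at a site. -/
def delta (η : Measure Env) : ℝ := ∫ ω, ∑' j : ℕ, mean (ω 0 j) ∂η

end

end ExcitedWalk

/-! The stationary law is a Krylov–Bogoliubov limit: start from `η` with overshoot `0`, average the
laws of the chain over the first levels and pass to a weak limit. The chain is augmented so that
almost sure properties of `η` survive the limit. A state is `(ω, l, x)`, with an environment from
which nothing is removed, the numbers `l y` of used cookies capped at `M`, and the overshoot;
`crossKernel` runs the walk to its first entrance to `[1, ∞)` and shifts by one. The environment
coordinate is only shifted, so it keeps the law `η` at every time and in the limit. Hence every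
property that holds for `η`-almost every `ω`, uniformly in `l` and `x`, holds along the whole
construction.

Recurrence to the right (`walk_stay_eq_zero`). Below `m`, the distance `(m + B - x)⁺` plus the
expected overshoots of the unused cookies at sites above `-N` is a supermartingale until the walk
leaves `(-N, m)`: means are nonnegative and a `μ`-step does not jump over `m + B`. It has size at
least `m + B + N` at `-N` and below, so staying below `m` forever has probability at most its
initial value divided by `m + B + N`. The first moment makes the total overshoot of the sites in
`(-N, m)` sublinear in `N` along a subsequence (`ae_good`), and `N → ∞` gives probability `0`.

Tightness (`chain_overshoot_le`). For large `K`, an overshoot of at least `K` over a level must come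
from a cookie. A union bound over all cookies to the left, integrated over `η`, gives the tail of a
convergent series, uniformly in the level.

Invariance of the limit (`bind_limit_eq`). Environments are encoded as arrays of weights in `[0,
1]`, which form a compact set; no mass is lost because the environment marginal of the limit is
still the image of `η`. A crossing that takes at most `k` steps of bounded size reads finitely many
entries of the array, so its truncated integrals are continuous and increase to the full integral.
This gives one inequality for every bounded continuous `F ≥ 0`; applied to `C - F` as well it gives
equality.

The independence of `(ω_x)_{x ≥ 0}` from the past is preserved by a crossing, because a crossing
reads only sites below `1` (`Inherited.bind`), and by weak limits (`indepFun_limit`). Finally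
`toState` removes the used cookies: the invariant law of the chain becomes a stationary law of the
cookie environment process by the strong Markov property (`walk_zeta_succ`), and the drift bound
holds because removal only deletes nonnegative drifts. -/

namespace ExcitedWalk

noncomputable section

open scoped NNReal Topology BoundedContinuousFunction

/-! ### The quenched law: cylinder probabilities, first step, translation -/

section

/-- The paths that agree with `Y` up to time `n`. -/
def cyl (n : ℕ) (Y : ℕ → ℤ) : Set (ℕ → ℤ) := {X | ∀ i ≤ n, X i = Y i}

lemma measurableSet_cyl (n : ℕ) (Y : ℕ → ℤ) : MeasurableSet (cyl n Y) := by
  have : cyl n Y = ⋂ i ∈ Finset.range (n + 1), (fun X : ℕ → ℤ => X i) ⁻¹' {Y i} := by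
    ext X; simp [cyl]
  rw [this]
  exact Finset.measurableSet_biInter _ fun i _ => measurable_pi_apply i (measurableSet_singleton _)

lemma isPiSystem_cyl : IsPiSystem (Set.range fun p : ℕ × (ℕ → ℤ) => cyl p.1 p.2) := by
  rintro _ ⟨⟨n, Y⟩, rfl⟩ _ ⟨⟨m, Z⟩, rfl⟩ ⟨W, hW₁, hW₂⟩
  refine ⟨(max n m, W), ?_⟩
  ext X
  simp only [cyl, Set.mem_inter_iff] at *
  constructor
  · intro h
    exact ⟨fun i hi => (h i (hi.trans (le_max_left _ _))).trans (hW₁ i hi),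
      fun i hi => (h i (hi.trans (le_max_right _ _))).trans (hW₂ i hi)⟩
  · rintro ⟨h₁, h₂⟩ i hi
    rcases le_max_iff.1 hi with h | h
    · exact (h₁ i h).trans (hW₁ i h).symm
    · exact (h₂ i h).trans (hW₂ i h).symm

lemma generateFrom_cyl :
    (inferInstance : MeasurableSpace (ℕ → ℤ)) =
      MeasurableSpace.generateFrom (Set.range fun p : ℕ × (ℕ → ℤ) => cyl p.1 p.2) := by
  apply le_antisymm
  · refine iSup_le fun n => ?_
    rw [← measurable_iff_comap_le]
    refine @measurable_to_countable' _ _ _ _ (_) _ fun z => ?_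
    have : (fun X : ℕ → ℤ => X n) ⁻¹' {z} =
        ⋃ h : {h : Finset.Iic n → ℤ // h ⟨n, Finset.mem_Iic.2 le_rfl⟩ = z},
          cyl n (fun i => if hi : i ≤ n then h.1 ⟨i, Finset.mem_Iic.2 hi⟩ else 0) := by
      ext X
      simp only [Set.mem_preimage, Set.mem_singleton_iff, Set.mem_iUnion, cyl]
      constructor
      · intro h
        exact ⟨⟨fun i => X i, h⟩, fun i hi => by simp [hi]⟩
      · rintro ⟨⟨h, rfl⟩, hX⟩
        simpa using hX n le_rfl
    rw [this]
    refine MeasurableSet.iUnion fun h => MeasurableSpace.measurableSet_generateFrom ⟨(_, _), rfl⟩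
  · rw [MeasurableSpace.generateFrom_le_iff]
    rintro _ ⟨⟨n, Y⟩, rfl⟩
    exact measurableSet_cyl n Y

/-- The restriction of a path to the times `0, …, n`. -/
def restr (n : ℕ) (Y : ℕ → ℤ) : Finset.Iic n → ℤ := fun i => Y i

/-- The probability of the first `n` steps of the path `Y`. -/
def pathProb (ω : Env) (Y : ℕ → ℤ) (n : ℕ) : ℝ≥0∞ :=
  ∏ i ∈ Finset.range n, (ω (Y i) (visits Y i (Y i)) : Measure ℤ) {Y (i + 1) - Y i}

instance (ω : Env) (x : ℤ) : IsProbabilityMeasure (quenched ω x) := by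
  unfold quenched; infer_instance

lemma stepLaw_apply (ω : Env) (n : ℕ) (Y : ℕ → ℤ) (z : ℤ) :
    stepLaw ω n (restr n Y) {z} = (ω (Y n) (visits Y n (Y n)) : Measure ℤ) {z - Y n} := by
  unfold stepLaw restr
  have hk : (Finset.univ.filter fun i : Finset.Iic n => (i : ℕ) < n ∧ Y i = Y n).card
      = visits Y n (Y n) := by
    unfold visits
    refine Finset.card_bij (fun i _ => (i : ℕ)) ?_ ?_ ?_
    · intro i hi; simpa using hi
    · intro i _ j _ h; exact Subtype.ext h
    · intro j hj
      simp only [Finset.mem_filter, Finset.mem_range] at hj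
      exact ⟨⟨j, Finset.mem_Iic.2 hj.1.le⟩, by simpa using hj, rfl⟩
  simp only [hk]
  rw [Measure.map_apply Measurable.of_discrete (measurableSet_singleton _)]
  congr 1
  ext w
  simp only [Set.mem_preimage, Set.mem_singleton_iff]
  constructor <;> intro h <;> linarith

open Kernel in
-- Histories form a discrete space, so the transition to time `n + 1` charges the history of `Y`
-- only when it starts from the shorter history of `Y`; each induction step therefore contributes
-- one factor.
lemma partialTraj_singleton (ω : Env) (x : ℤ) (Y : ℕ → ℤ) (n : ℕ) :
    partialTraj (X := fun _ => ℤ) (stepKernel ω) 0 n (fun _ => x) {restr n Y} =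
      if Y 0 = x then pathProb ω Y n else 0 := by
  induction n with
  | zero =>
    simp only [partialTraj_self, Kernel.id_apply, pathProb, Finset.range_zero, Finset.prod_empty]
    rw [Measure.dirac_apply' _ (measurableSet_singleton _)]
    by_cases h : Y 0 = x
    · simp only [h, if_true]
      rw [Set.indicator_of_mem]; · rfl
      simp only [Set.mem_singleton_iff]
      ext ⟨i, hi⟩
      have : i = 0 := by simpa using hi
      simp [this, h, restr]
    · simp only [h, if_false]
      rw [Set.indicator_of_notMem]
      simp only [Set.mem_singleton_iff]
      intro h'
      exact h (congrFun h' ⟨0, by simp⟩).symm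
  | succ n ih =>
    have key : ∀ h : (Finset.Iic n → ℤ),
        partialTraj (X := fun _ => ℤ) (stepKernel ω) n (n + 1) h {restr (n + 1) Y} =
        ({restr n Y} : Set (Finset.Iic n → ℤ)).indicator
          (fun _ => (ω (Y n) (visits Y n (Y n)) : Measure ℤ) {Y (n + 1) - Y n}) h := by
      intro h
      rw [partialTraj_succ_self, Kernel.map_apply' _ (by fun_prop) _ (measurableSet_singleton _),
        Kernel.prod_apply, Kernel.id_apply, Measure.dirac_prod,
        Measure.map_apply (by fun_prop) ((by fun_prop : Measurable
          (IicProdIoc (X := fun _ => ℤ) n (n+1))) (measurableSet_singleton _)),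
        Kernel.map_apply' _ (by fun_prop) _ (((by fun_prop : Measurable
          (IicProdIoc (X := fun _ => ℤ) n (n+1))) (measurableSet_singleton _)).preimage (by fun_prop))]
      by_cases hh : h = restr n Y
      · subst hh
        rw [Set.indicator_of_mem (by simp), ← stepLaw_apply]
        change stepLaw _ _ _ _ = _
        congr 1
        ext z
        simp only [Set.mem_preimage, Set.mem_singleton_iff]
        constructor
        · intro h'
          have := congrFun h' ⟨n + 1, by simp⟩
          simpa [IicProdIoc, MeasurableEquiv.piSingleton, restr] using this
        · rintro rfl
          ext ⟨i, hi⟩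
          simp only [IicProdIoc]
          split_ifs with h1
          · rfl
          · have : i = n + 1 := by
              have := Finset.mem_Iic.1 hi
              have h1' : ¬ i ≤ n := by simpa using h1
              omega
            subst this
            simp [MeasurableEquiv.piSingleton, restr]
      · rw [Set.indicator_of_notMem (by simpa using hh)]
        convert measure_empty (μ := stepKernel ω n h)
        rw [Set.eq_empty_iff_forall_notMem]
        intro z hz
        apply hh
        simp only [Set.mem_preimage, Set.mem_singleton_iff] at hz
        ext ⟨i, hi⟩
        have := congrFun hz ⟨i, by simp at hi ⊢; omega⟩
        have hi' : i ≤ n := by simpa using hi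
        simpa [IicProdIoc, hi', restr] using this
    rw [partialTraj_succ_eq_comp (Nat.zero_le n),
      Kernel.comp_apply' _ _ _ (measurableSet_singleton _)]
    simp_rw [key]
    rw [lintegral_indicator_const (measurableSet_singleton _)]
    erw [ih]
    split_ifs with h
    · rw [pathProb, pathProb, Finset.prod_range_succ, mul_comm]
    · simp

lemma quenched_cyl (ω : Env) (x : ℤ) (Y : ℕ → ℤ) (n : ℕ) :
    quenched ω x (cyl n Y) = if Y 0 = x then pathProb ω Y n else 0 := by
  rw [← partialTraj_singleton, ← Kernel.traj_map_frestrictLe_apply,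
    Measure.map_apply (by fun_prop) (measurableSet_singleton _)]
  unfold quenched
  congr 1
  ext X
  simp only [cyl, Set.mem_preimage, Set.mem_singleton_iff, funext_iff, Subtype.forall,
    Finset.mem_Iic]
  rfl

lemma quenched_eq_of_cyl {ω : Env} {x : ℤ} {P : Measure (ℕ → ℤ)} [IsProbabilityMeasure P]
    (h : ∀ n Y, P (cyl n Y) = if Y 0 = x then pathProb ω Y n else 0) : quenched ω x = P := by
  refine ext_of_generate_finite _ generateFrom_cyl isPiSystem_cyl ?_ (by simp)
  rintro _ ⟨⟨n, Y⟩, rfl⟩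
  rw [quenched_cyl, h]

lemma measurable_apply_env (y : ℤ) (j : ℕ) (s : Set ℤ) :
    Measurable fun ω : Env => (ω y j : Measure ℤ) s := by
  have h1 : Measurable fun ω : Env => ω y j := by fun_prop
  exact (Measure.measurable_coe (MeasurableSet.of_discrete (s := s))).comp
    (measurable_subtype_coe.comp h1)

lemma measurable_pathProb (Y : ℕ → ℤ) (n : ℕ) : Measurable fun ω => pathProb ω Y n :=
  Finset.measurable_prod _ fun _ _ => measurable_apply_env _ _ _

/-- The quenched laws as a kernel. -/
def quenchedKernel : Kernel (Env × ℤ) (ℕ → ℤ) where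
  toFun p := quenched p.1 p.2
  measurable' := by
    refine Measurable.measure_of_isPiSystem_of_isProbabilityMeasure generateFrom_cyl
      isPiSystem_cyl ?_
    rintro _ ⟨⟨n, Y⟩, rfl⟩
    simp_rw [quenched_cyl]
    refine Measurable.ite ?_ ((measurable_pathProb Y n).comp measurable_fst) measurable_const
    exact measurable_snd (measurableSet_singleton (Y 0) |>.preimage measurable_id |> fun _ =>
      (MeasurableSet.of_discrete (s := {z : ℤ | Y 0 = z})))

@[simp] lemma quenchedKernel_apply (p : Env × ℤ) : quenchedKernel p = quenched p.1 p.2 := rfl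

instance : IsMarkovKernel quenchedKernel := ⟨fun p => by rw [quenchedKernel_apply]; infer_instance⟩

/-- Prepend a position to a path. -/
def cons (x : ℤ) (X : ℕ → ℤ) : ℕ → ℤ
  | 0 => x
  | n + 1 => X n

@[simp] lemma cons_zero (x : ℤ) (X : ℕ → ℤ) : cons x X 0 = x := rfl
@[simp] lemma cons_succ (x : ℤ) (X : ℕ → ℤ) (n : ℕ) : cons x X (n + 1) = X n := rfl

lemma measurable_cons (x : ℤ) : Measurable (cons x) := by
  refine measurable_pi_lambda _ fun n => ?_
  cases n with
  | zero => exact measurable_const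
  | succ n => exact measurable_pi_apply n

lemma visits_succ' (X : ℕ → ℤ) (n : ℕ) (y : ℤ) :
    visits X (n + 1) y = (if X 0 = y then 1 else 0) + visits (fun i => X (i + 1)) n y := by
  unfold visits
  rw [Finset.card_filter, Finset.card_filter, Finset.sum_range_succ', add_comm]

lemma visits_cons (x : ℤ) (X : ℕ → ℤ) (n : ℕ) :
    visits (cons x X) (n + 1) = Pi.single x 1 + visits X n := by
  funext y
  rw [visits_succ', Pi.add_apply, Pi.single_apply]
  simp only [cons_zero, cons_succ, eq_comm]
  rfl

lemma removeCookies_add (ω : Env) (l m : ℤ → ℕ) :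
    removeCookies (removeCookies ω l) m = removeCookies ω (l + m) := by
  funext x j
  simp [removeCookies, add_assoc]

/-- Both sides have the same cylinder probabilities: the visit to `x` at time `0` is recorded on the
right by deleting one cookie at `x`, so all later visit counts match. -/
lemma quenched_eq_bind (ω : Env) (x : ℤ) :
    quenched ω x = (ω x 0 : Measure ℤ).bind fun z =>
      (quenched (removeCookies ω (Pi.single x 1)) (x + z)).map (cons x) := by
  have hm : Measurable fun z : ℤ =>
    (quenched (removeCookies ω (Pi.single x 1)) (x + z)).map (cons x) := Measurable.of_discrete
  have : IsProbabilityMeasure ((ω x 0 : Measure ℤ).bind fun z =>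
      (quenched (removeCookies ω (Pi.single x 1)) (x + z)).map (cons x)) := by
    constructor
    rw [Measure.bind_apply MeasurableSet.univ hm.aemeasurable]
    simp [Measure.map_apply (measurable_cons x)]
  refine quenched_eq_of_cyl fun n Y => ?_
  rw [Measure.bind_apply (measurableSet_cyl n Y) hm.aemeasurable]
  simp_rw [Measure.map_apply (measurable_cons x) (measurableSet_cyl n Y)]
  by_cases h : Y 0 = x
  swap
  · have : cons x ⁻¹' cyl n Y = ∅ := by
      rw [Set.eq_empty_iff_forall_notMem]
      intro X hX
      exact h (hX 0 (Nat.zero_le _)).symm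
    simp [this, h]
  subst h
  rw [if_pos rfl]
  cases n with
  | zero =>
    have : cons (Y 0) ⁻¹' cyl 0 Y = Set.univ := by
      rw [Set.eq_univ_iff_forall]
      intro X i hi
      obtain rfl : i = 0 := by omega
      rfl
    simp [this, pathProb]
  | succ n =>
    have : cons (Y 0) ⁻¹' cyl (n + 1) Y = cyl n fun i => Y (i + 1) := by
      ext X
      simp only [cyl, Set.mem_preimage]
      constructor
      · intro h i hi
        exact h (i + 1) (by omega)
      · intro h i hi
        cases i with
        | zero => rfl
        | succ i => exact h i (by omega)
    simp_rw [this, quenched_cyl]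
    have h2 : ∀ z : ℤ, (if Y (0 + 1) = Y 0 + z then
        pathProb (removeCookies ω (Pi.single (Y 0) 1)) (fun i => Y (i + 1)) n else 0) =
        ({Y 1 - Y 0} : Set ℤ).indicator (fun _ =>
          pathProb (removeCookies ω (Pi.single (Y 0) 1)) (fun i => Y (i + 1)) n) z := by
      intro z
      rw [Set.indicator_apply]
      congr 1
      simp only [zero_add, Set.mem_singleton_iff, eq_iff_iff]
      constructor <;> intro h <;> linarith
    simp_rw [h2]
    rw [lintegral_indicator_const (measurableSet_singleton _), pathProb, pathProb,
      Finset.prod_range_succ']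
    congr 1
    refine Finset.prod_congr rfl fun i _ => ?_
    simp only [removeCookies]
    rw [visits_succ']
    simp only [Pi.single_apply, eq_comm]

/-- Decomposition of the walk according to its first step. -/
lemma lintegral_quenched (ω : Env) (x : ℤ) {F : (ℕ → ℤ) → ℝ≥0∞} (hF : Measurable F) :
    ∫⁻ X, F X ∂quenched ω x = ∫⁻ z, ∫⁻ X, F (cons x X)
      ∂quenched (removeCookies ω (Pi.single x 1)) (x + z) ∂(ω x 0 : Measure ℤ) := by
  rw [quenched_eq_bind, Measure.lintegral_bind Measurable.of_discrete.aemeasurable hF.aemeasurable]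
  congr 1
  funext z
  rw [lintegral_map hF (measurable_cons x)]

/-- The law of the walk that starts at `x` after `l y` cookies have been removed from each `y`. -/
def walk (ω : Env) (l : ℤ → ℕ) (x : ℤ) : Measure (ℕ → ℤ) := quenched (removeCookies ω l) x

instance (ω : Env) (l : ℤ → ℕ) (x : ℤ) : IsProbabilityMeasure (walk ω l x) := by
  unfold walk; infer_instance

lemma lintegral_walk (ω : Env) (l : ℤ → ℕ) (x : ℤ) {F : (ℕ → ℤ) → ℝ≥0∞} (hF : Measurable F) :
    ∫⁻ X, F X ∂walk ω l x = ∫⁻ z, ∫⁻ X, F (cons x X)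
      ∂walk ω (l + Pi.single x 1) (x + z) ∂(ω x (l x) : Measure ℤ) := by
  rw [walk, lintegral_quenched _ _ hF, removeCookies_add]
  rfl

lemma walk_start (ω : Env) (l : ℤ → ℕ) (x : ℤ) : ∀ᵐ X ∂walk ω l x, X 0 = x := by
  have h : walk ω l x (cyl 0 fun _ => x) = 1 := by simp [walk, quenched_cyl, pathProb]
  filter_upwards [(mem_ae_iff_prob_eq_one (measurableSet_cyl _ _)).2 h] with X hX
  exact hX 0 le_rfl

lemma quenched_shift (ω : Env) (x : ℤ) :
    quenched ω (x + 1) = (quenched (shift ω) x).map fun X n => X n + 1 := by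
  have hm : Measurable fun (X : ℕ → ℤ) n => X n + 1 := by fun_prop
  have : IsProbabilityMeasure ((quenched (shift ω) x).map fun X n => X n + 1) :=
    Measure.isProbabilityMeasure_map hm.aemeasurable
  refine quenched_eq_of_cyl fun n Y => ?_
  have : (fun (X : ℕ → ℤ) n => X n + 1) ⁻¹' cyl n Y = cyl n fun i => Y i - 1 := by
    ext X
    simp only [cyl, Set.mem_preimage]
    exact forall₂_congr fun i _ => ⟨fun h => by linarith, fun h => by linarith⟩
  rw [Measure.map_apply hm (measurableSet_cyl n Y), this, quenched_cyl]
  have h1 : (Y 0 - 1 = x) = (Y 0 = x + 1) := by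
    rw [eq_iff_iff]; constructor <;> intro h <;> linarith
  simp only [h1]
  congr 1
  unfold pathProb
  refine Finset.prod_congr rfl fun i _ => ?_
  have : visits (fun i => Y i - 1) i (Y i - 1) = visits Y i (Y i) := by
    unfold visits
    simp
  rw [this]
  simp [shift]

end

/-! ### First entrance to `[1, ∞)` and its truncations -/

section

lemma measurableSet_coord (j : ℕ) (s : Set ℤ) : MeasurableSet {X : ℕ → ℤ | X j ∈ s} := by
  have h : Measurable fun X : ℕ → ℤ => X j := by fun_prop
  exact h (MeasurableSet.of_discrete (s := s))

lemma tau_spec {X : ℕ → ℤ} {n : ℕ} (h : ∃ k, (n : ℤ) ≤ X k) :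
    (n : ℤ) ≤ X (tau X n) ∧ ∀ j < tau X n, X j < n :=
  ⟨Nat.sInf_mem h, fun _ hj => not_le.1 (Nat.notMem_of_lt_sInf hj)⟩

lemma tau_eq {X : ℕ → ℤ} {n k : ℕ} (h : (n : ℤ) ≤ X k) (h' : ∀ j < k, X j < n) : tau X n = k := by
  obtain ⟨h₁, h₂⟩ := tau_spec ⟨k, h⟩
  rcases lt_trichotomy (tau X n) k with hlt | heq | hgt
  · exact absurd (h' _ hlt) (not_lt.2 h₁)
  · exact heq
  · exact absurd (h₂ _ hgt) (not_lt.2 h)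

lemma tau_of_le {X : ℕ → ℤ} {n : ℕ} (h : (n : ℤ) ≤ X 0) : tau X n = 0 :=
  tau_eq h fun _ hj => absurd hj (Nat.not_lt_zero _)

lemma tau_of_forall_lt {X : ℕ → ℤ} {n : ℕ} (h : ∀ k, X k < n) : tau X n = 0 := by
  have : {k : ℕ | (n : ℤ) ≤ X k} = ∅ := by
    rw [Set.eq_empty_iff_forall_notMem]
    exact fun k hk => not_le.2 (h k) hk
  rw [tau, this, Nat.sInf_empty]

/-- The hitting hypothesis cannot be dropped: on paths that never reach the level both sides fall
back to the default `0` of `tau` and the recursion fails. -/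
lemma tau_cons {x : ℤ} {X : ℕ → ℤ} {n : ℕ} (hx : x < n) (h : ∃ k, (n : ℤ) ≤ X k) :
    tau (cons x X) n = tau X n + 1 := by
  obtain ⟨h₁, h₂⟩ := tau_spec h
  refine tau_eq (by simpa using h₁) fun j hj => ?_
  cases j with
  | zero => exact hx
  | succ j => exact h₂ j (by omega)

lemma measurable_tau (n : ℕ) : Measurable fun X => tau X n := by
  refine measurable_to_countable' fun k => ?_
  have h1 : ∀ j, MeasurableSet {X : ℕ → ℤ | (n : ℤ) ≤ X j} := fun j =>
    measurableSet_coord j {z | (n : ℤ) ≤ z}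
  have h2 : ∀ j, MeasurableSet {X : ℕ → ℤ | X j < (n : ℤ)} := fun j =>
    measurableSet_coord j {z | z < (n : ℤ)}
  have : (fun X => tau X n) ⁻¹' {k} =
      ({X : ℕ → ℤ | (n : ℤ) ≤ X k} ∩ ⋂ j ∈ Finset.range k, {X : ℕ → ℤ | X j < (n : ℤ)}) ∪
      ({X | k = 0} ∩ ⋂ j, {X : ℕ → ℤ | X j < (n : ℤ)}) := by
    ext X
    simp only [Set.mem_preimage, Set.mem_singleton_iff, Set.mem_union, Set.mem_inter_iff,
      Set.mem_iInter, Finset.mem_range, Set.mem_ofPred_eq]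
    constructor
    · rintro rfl
      by_cases h : ∃ k, (n : ℤ) ≤ X k
      · exact Or.inl (tau_spec h)
      · push Not at h
        exact Or.inr ⟨tau_of_forall_lt h, h⟩
    · rintro (⟨h, h'⟩ | ⟨h, h'⟩)
      · exact tau_eq h h'
      · rw [h, tau_of_forall_lt h']
  rw [this]
  exact ((h1 k).inter (Finset.measurableSet_biInter _ fun j _ => h2 j)).union
    ((MeasurableSet.const _).inter (MeasurableSet.iInter h2))

lemma measurable_visits (n : ℕ) (y : ℤ) : Measurable fun X => visits X n y := by
  unfold visits
  simp_rw [Finset.card_filter]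
  refine Finset.measurable_sum _ fun i _ => ?_
  exact Measurable.ite (measurableSet_coord i {y}) measurable_const
    measurable_const

lemma measurable_apply_tau (n : ℕ) : Measurable fun X : ℕ → ℤ => X (tau X n) := by
  have h : Measurable fun p : (ℕ → ℤ) × ℕ => p.1 p.2 :=
    measurable_from_prod_countable_left fun m => measurable_pi_apply m
  exact h.comp (measurable_id.prodMk (measurable_tau n))

lemma measurable_visits_tau (n : ℕ) : Measurable fun X : ℕ → ℤ => visits X (tau X n) := by
  refine measurable_pi_lambda _ fun y => ?_
  have h : Measurable fun p : (ℕ → ℤ) × ℕ => visits p.1 p.2 y :=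
    measurable_from_prod_countable_left fun m => measurable_visits m y
  exact h.comp (measurable_id.prodMk (measurable_tau n))

/-- The numbers of removed cookies and the position at the first entrance to `[1, ∞)`, for a walk
that starts when `l y` cookies have been removed from each site `y`. -/
def cross (l : ℤ → ℕ) (X : ℕ → ℤ) : (ℤ → ℕ) × ℤ := (l + visits X (tau X 1), X (tau X 1))

lemma measurable_uncurry_cross :
    Measurable fun p : (ℤ → ℕ) × (ℕ → ℤ) => cross p.1 p.2 := by
  refine Measurable.prodMk ?_ ((measurable_apply_tau 1).comp measurable_snd)
  refine measurable_pi_lambda _ fun y => ?_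
  exact ((measurable_pi_apply y).comp measurable_fst).add
    ((measurable_pi_apply y).comp ((measurable_visits_tau 1).comp measurable_snd))

lemma measurable_cross (l : ℤ → ℕ) : Measurable (cross l) :=
  measurable_uncurry_cross.comp measurable_prodMk_left

lemma cross_of_le (l : ℤ → ℕ) {X : ℕ → ℤ} (h : 1 ≤ X 0) : cross l X = (l, X 0) := by
  have : tau X 1 = 0 := tau_of_le (by exact_mod_cast h)
  simp [cross, this]
  rfl

lemma cross_cons (l : ℤ → ℕ) {x : ℤ} {X : ℕ → ℤ} (hx : x < 1) (h : ∃ k, 1 ≤ X k) :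
    cross l (cons x X) = cross (l + Pi.single x 1) X := by
  have : tau (cons x X) 1 = tau X 1 + 1 := tau_cons (by exact_mod_cast hx) (by exact_mod_cast h)
  simp [cross, this, visits_cons, add_assoc]

/-- The paths that enter `[1, ∞)` in at most `k` steps, with a bound on the sizes of these
steps. -/
def crossSet : ℕ → Set (ℕ → ℤ)
  | 0 => {X | 1 ≤ X 0}
  | k + 1 => {X | 1 ≤ X 0 ∨ (|X 1 - X 0| ≤ k ∧ (fun n => X (n + 1)) ∈ crossSet k)}

lemma measurableSet_crossSet (k : ℕ) : MeasurableSet (crossSet k) := by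
  have h0 : MeasurableSet {X : ℕ → ℤ | 1 ≤ X 0} :=
    measurableSet_coord 0 {z | 1 ≤ z}
  induction k with
  | zero => exact h0
  | succ k ih =>
    refine h0.union (MeasurableSet.inter ?_ ?_)
    · have : Measurable fun X : ℕ → ℤ => X 1 - X 0 := by fun_prop
      exact this (MeasurableSet.of_discrete (s := {z : ℤ | |z| ≤ k}))
    · have : Measurable fun (X : ℕ → ℤ) n => X (n + 1) := by fun_prop
      exact this ih

lemma monotone_crossSet : Monotone crossSet := by
  refine monotone_nat_of_le_succ fun k => ?_
  induction k with
  | zero => exact fun X hX => Or.inl hX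
  | succ k ih =>
    rintro X (hX | ⟨hX, hX'⟩)
    · exact Or.inl hX
    · exact Or.inr ⟨hX.trans (by push_cast; linarith), ih hX'⟩

lemma exists_le_of_mem_crossSet {k : ℕ} {X : ℕ → ℤ} (h : X ∈ crossSet k) : ∃ n, 1 ≤ X n := by
  induction k generalizing X with
  | zero => exact ⟨0, h⟩
  | succ k ih =>
    rcases h with h | ⟨-, h⟩
    · exact ⟨0, h⟩
    · obtain ⟨n, hn⟩ := ih h
      exact ⟨n + 1, hn⟩

lemma iUnion_crossSet : ⋃ k, crossSet k = {X | ∃ n, 1 ≤ X n} := by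
  ext X
  simp only [Set.mem_iUnion, Set.mem_ofPred_eq]
  refine ⟨fun ⟨k, hk⟩ => exists_le_of_mem_crossSet hk, ?_⟩
  rintro ⟨n, hn⟩
  induction n generalizing X with
  | zero => exact ⟨0, hn⟩
  | succ n ih =>
    obtain ⟨k, hk⟩ := ih (fun m => X (m + 1)) hn
    -- The index limits both the number of steps and their sizes, so it is raised until it also
    -- covers the first step.
    refine ⟨max k (X 1 - X 0).natAbs + 1, Or.inr ⟨?_, monotone_crossSet (le_max_left _ _) hk⟩⟩
    rw [Int.abs_eq_natAbs]
    exact_mod_cast le_max_right _ _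

lemma cons_mem_crossSet_succ {x : ℤ} (hx : x < 1) (k : ℕ) (X : ℕ → ℤ) :
    cons x X ∈ crossSet (k + 1) ↔ |X 0 - x| ≤ k ∧ X ∈ crossSet k := by
  change (1 ≤ x ∨ (|X 0 - x| ≤ k ∧ X ∈ crossSet k)) ↔ _
  simp [not_le.2 hx]

/-- The integral of `f` at the first entrance to `[1, ∞)`, on the event `crossSet k`. -/
def crossInt (ω : Env) (f : (ℤ → ℕ) × ℤ → ℝ≥0∞) (k : ℕ) (l : ℤ → ℕ) (x : ℤ) : ℝ≥0∞ :=
  ∫⁻ X in crossSet k, f (cross l X) ∂walk ω l x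

variable {ω : Env} {f : (ℤ → ℕ) × ℤ → ℝ≥0∞} {k : ℕ} {l : ℤ → ℕ} {x : ℤ}

lemma mem_crossSet_of_le {X : ℕ → ℤ} (h : 1 ≤ X 0) : X ∈ crossSet k :=
  monotone_crossSet (Nat.zero_le k) h

lemma crossInt_of_le (hx : 1 ≤ x) : crossInt ω f k l x = f (l, x) := by
  rw [crossInt, ← lintegral_indicator (measurableSet_crossSet k)]
  have : ∀ᵐ X ∂walk ω l x, (crossSet k).indicator (fun X => f (cross l X)) X = f (l, x) := by
    filter_upwards [walk_start ω l x] with X hX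
    have hX' : 1 ≤ X 0 := hX ▸ hx
    rw [Set.indicator_of_mem (mem_crossSet_of_le hX'), cross_of_le l hX', hX]
  rw [lintegral_congr_ae this]
  simp

lemma crossInt_zero (hx : x < 1) : crossInt ω f 0 l x = 0 := by
  rw [crossInt, ← lintegral_indicator (measurableSet_crossSet 0)]
  have : ∀ᵐ X ∂walk ω l x, (crossSet 0).indicator (fun X => f (cross l X)) X = 0 := by
    filter_upwards [walk_start ω l x] with X hX
    rw [Set.indicator_of_notMem]
    intro h
    have : 1 ≤ X 0 := h
    omega
  rw [lintegral_congr_ae this]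
  simp

/-- First-step decomposition. Together with the values at `x ≥ 1` and at `k = 0` it determines
`crossInt` recursively, and most facts about crossings below are inductions over it. The cutoff `|z|
≤ k` makes the integral a finite sum, which is what continuity in the environment needs. -/
lemma crossInt_succ (hf : Measurable f) (hx : x < 1) : crossInt ω f (k + 1) l x =
    ∫⁻ z, (if |z| ≤ k then crossInt ω f k (l + Pi.single x 1) (x + z) else 0)
      ∂(ω x (l x) : Measure ℤ) := by
  rw [crossInt, ← lintegral_indicator (measurableSet_crossSet _),
    lintegral_walk _ _ _ (F := (crossSet (k + 1)).indicator fun X => f (cross l X))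
    ((hf.comp (measurable_cross l)).indicator (measurableSet_crossSet _))]
  refine lintegral_congr fun z => ?_
  have : ∀ᵐ X ∂walk ω (l + Pi.single x 1) (x + z),
      (crossSet (k + 1)).indicator (fun X => f (cross l X)) (cons x X) =
      if |z| ≤ k then (crossSet k).indicator (fun X => f (cross (l + Pi.single x 1) X)) X
      else 0 := by
    filter_upwards [walk_start ω (l + Pi.single x 1) (x + z)] with X hX
    have hz : |X 0 - x| = |z| := by rw [hX]; congr 1; ring
    by_cases h : X ∈ crossSet k
    · rw [Set.indicator_of_mem h]
      split_ifs with hk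
      · rw [Set.indicator_of_mem ((cons_mem_crossSet_succ hx k X).2 ⟨hz ▸ hk, h⟩),
          cross_cons l hx (exists_le_of_mem_crossSet h)]
      · rw [Set.indicator_of_notMem]
        exact fun h' => hk (hz ▸ ((cons_mem_crossSet_succ hx k X).1 h').1)
    · rw [Set.indicator_of_notMem h, Set.indicator_of_notMem]
      · simp
      · exact fun h' => h ((cons_mem_crossSet_succ hx k X).1 h').2
  rw [lintegral_congr_ae this]
  split_ifs
  · rw [crossInt, ← lintegral_indicator (measurableSet_crossSet k)]
  · simp

/-- Monotone convergence: the sets `crossSet k` increase to the event that `[1, ∞)` is reached. -/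
lemma iSup_crossInt (hhit : ∀ᵐ X ∂walk ω l x, ∃ n, 1 ≤ X n) :
    ⨆ k, crossInt ω f k l x = ∫⁻ X, f (cross l X) ∂walk ω l x := by
  unfold crossInt
  rw [← setLIntegral_iUnion_of_directed _ monotone_crossSet.directed_le, iUnion_crossSet,
    Measure.restrict_eq_self_of_ae_mem (s := {X : ℕ → ℤ | ∃ n, 1 ≤ X n}) hhit]

end

/-! ### Supermartingales and the probability of staying below a level -/

section

lemma walk_apply (ω : Env) (l : ℤ → ℕ) (x : ℤ) {S : Set (ℕ → ℤ)} (hS : MeasurableSet S) :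
    walk ω l x S = ∫⁻ z, walk ω (l + Pi.single x 1) (x + z) (cons x ⁻¹' S)
      ∂(ω x (l x) : Measure ℤ) := by
  rw [← lintegral_indicator_one hS, lintegral_walk _ _ _ (measurable_one.indicator hS)]
  refine lintegral_congr fun z => ?_
  rw [← lintegral_indicator_one (measurable_cons x hS)]
  rfl

/-- The sum of the weights `e y j` over the remaining cookies. -/
def pot (M : ℕ) (e : ℤ → ℕ → ℝ≥0∞) (l : ℤ → ℕ) : ℝ≥0∞ :=
  ∑' y, ∑ j ∈ Finset.Ico (l y) M, e y j

section pot

variable {M : ℕ} {e : ℤ → ℕ → ℝ≥0∞} {l : ℤ → ℕ} {x : ℤ}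

lemma pot_add_single (h : l x < M) : pot M e (l + Pi.single x 1) + e x (l x) = pot M e l := by
  unfold pot
  rw [← tsum_pi_single x (e x (l x)), ← ENNReal.tsum_add]
  refine tsum_congr fun y => ?_
  by_cases hy : y = x
  · subst hy
    simp only [Pi.add_apply, Pi.single_eq_same]
    rw [Finset.sum_eq_sum_Ico_succ_bot h, add_comm]
  · simp [hy]

lemma pot_anti {l' : ℤ → ℕ} (h : l ≤ l') : pot M e l' ≤ pot M e l :=
  ENNReal.tsum_le_tsum fun y => Finset.sum_le_sum_of_subset (Finset.Ico_subset_Ico_left (h y))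

/-- One step of the walk does not increase the expectation of `h + pot M e`, if a step with the
cookie `j` at `x` increases the expectation of `h` by at most `e x j`. -/
lemma lintegral_add_pot_le {μ : ProbabilityMeasure ℤ} {ω : Env} (hω : ω ∈ OmegaPlus M μ)
    {h : ℤ → ℝ≥0∞} {c : ℝ≥0∞}
    (hcookie : ∀ j < M, ∫⁻ z, h (x + z) ∂(ω x j : Measure ℤ) + c ≤ h x + e x j)
    (hμ : ∫⁻ z, h (x + z) ∂(μ : Measure ℤ) + c ≤ h x) :
    ∫⁻ z, (h (x + z) + pot M e (l + Pi.single x 1)) ∂(ω x (l x) : Measure ℤ) + c ≤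
      h x + pot M e l := by
  rw [lintegral_add_right _ measurable_const, lintegral_const, measure_univ, mul_one,
    add_right_comm]
  by_cases hl : l x < M
  · rw [← pot_add_single hl, add_comm (pot _ _ _), ← add_assoc]
    exact add_le_add_left (hcookie _ hl) _
  · rw [(hω x).2 _ (not_lt.1 hl)]
    gcongr
    exact pot_anti (by simp)

end pot

/-- Integrate `(c - z)⁺ = (c - z) + (z - c)⁺` and drop the mean, which enters with a negative sign.
Thus a step with nonnegative mean increases the expected distance to a level by at most its expected
overshoot. -/
lemma lintegral_toNat_sub_le {ν : ProbabilityMeasure ℤ} (hν : HasFiniteMean ν)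
    (h0 : 0 ≤ mean ν) (c : ℕ) :
    ∫⁻ z : ℤ, (((c : ℤ) - z).toNat : ℝ≥0∞) ∂(ν : Measure ℤ) ≤
      c + ∫⁻ z : ℤ, ((z - c).toNat : ℝ≥0∞) ∂(ν : Measure ℤ) := by
  have hcast : ∀ a : ℤ, ((a.toNat : ℕ) : ℝ≥0∞) = ENNReal.ofReal (max (a : ℝ) 0) := by
    intro a
    rw [← ENNReal.ofReal_natCast]
    congr 1
    rw [← Int.cast_natCast, Int.toNat_eq_max]
    push_cast
    rfl
  have hb : Integrable (fun z : ℤ => max (((z - c : ℤ)) : ℝ) 0) (ν : Measure ℤ) := by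
    have : Integrable (fun z : ℤ => (z : ℝ) - c) (ν : Measure ℤ) := hν.sub (integrable_const _)
    simpa using this.pos_part
  have ha : ∀ z : ℤ, max ((((c : ℤ) - z : ℤ)) : ℝ) 0 =
      ((c : ℝ) - z) + max (((z - c : ℤ)) : ℝ) 0 := by
    intro z
    push_cast
    rcases le_total (z : ℝ) c with h | h
    · rw [max_eq_left (by linarith), max_eq_right (by linarith)]; ring
    · rw [max_eq_right (by linarith), max_eq_left (by linarith)]; ring
  have hi : Integrable (fun z : ℤ => (c : ℝ) - z) (ν : Measure ℤ) := (integrable_const _).sub hν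
  simp_rw [hcast]
  simp_rw [ha]
  rw [← ofReal_integral_eq_lintegral_ofReal
      (f := fun z : ℤ => (c : ℝ) - z + max (((z - c : ℤ)) : ℝ) 0) (hi.add hb)
      (ae_of_all _ fun z => by simp only [Pi.zero_apply]; rw [← ha]; exact le_max_right _ _),
    ← ofReal_integral_eq_lintegral_ofReal hb (ae_of_all _ fun z => le_max_right _ _),
    integral_add hi hb, integral_sub (integrable_const _) hν]
  have : ∫ z : ℤ, (z : ℝ) ∂(ν : Measure ℤ) = mean ν := rfl
  rw [this]
  simp only [integral_const, probReal_univ, smul_eq_mul, one_mul]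
  calc _ ≤ ENNReal.ofReal (c + ∫ z : ℤ, max (((z - c : ℤ)) : ℝ) 0 ∂(ν : Measure ℤ)) :=
        ENNReal.ofReal_le_ofReal (by linarith)
    _ ≤ _ := by
        refine ENNReal.ofReal_add_le.trans ?_
        simp

lemma measurableSet_stay (m : ℤ) (n : ℕ) :
    MeasurableSet {X : ℕ → ℤ | ∀ k ≤ n, X k < m} := by
  have : {X : ℕ → ℤ | ∀ k ≤ n, X k < m} =
      ⋂ k ∈ Finset.range (n + 1), {X : ℕ → ℤ | X k ∈ Set.Iio m} := by
    ext X; simp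
  rw [this]
  exact Finset.measurableSet_biInter _ fun i _ => measurableSet_coord i _

/-- A superharmonic function bounds the probability to stay below `m`. -/
lemma walk_stay_le {ω : Env} {G : (ℤ → ℕ) → ℤ → ℝ≥0∞} {m a : ℤ} {c : ℝ≥0∞}
    (hstep : ∀ l x, a < x → x < m →
      ∫⁻ z, G (l + Pi.single x 1) (x + z) ∂(ω x (l x) : Measure ℤ) + c ≤ G l x)
    (hG : ∀ l x, x ≤ a → 1 ≤ G l x) (n : ℕ) (hn : n * c ≤ 1) (l : ℤ → ℕ) (x : ℤ) :
    walk ω l x {X | ∀ k ≤ n, X k < m} + n * c ≤ G l x + 1 := by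
  induction n generalizing l x with
  | zero =>
    simp only [Nat.cast_zero, zero_mul, add_zero]
    -- The summand `1` on the right pays for `n * c`; it is cancelled later by choosing `c = 1 / n`.
    exact prob_le_one.trans le_add_self
  | succ n ih =>
    have hn' : n * c ≤ 1 := le_trans (by gcongr; simp) hn
    rcases le_or_gt m x with hx | hx
    · have : walk ω l x {X | ∀ k ≤ n + 1, X k < m} = 0 := by
        rw [measure_eq_zero_iff_ae_notMem]
        filter_upwards [walk_start ω l x] with X hX h
        have := h 0 (by omega)
        omega
      rw [this, zero_add]
      exact hn.trans le_add_self
    rcases le_or_gt x a with hxa | hxa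
    · exact add_le_add (prob_le_one.trans (hG l x hxa)) hn
    have hpre : cons x ⁻¹' {X | ∀ k ≤ n + 1, X k < m} = {X | ∀ k ≤ n, X k < m} := by
      ext X
      simp only [Set.mem_preimage, Set.mem_ofPred_eq]
      constructor
      · intro h k hk
        exact h (k + 1) (by omega)
      · intro h k hk
        cases k with
        | zero => exact hx
        | succ k => exact h k (by omega)
    rw [walk_apply _ _ _ (measurableSet_stay m _), hpre]
    calc _ = ∫⁻ z, (walk ω (l + Pi.single x 1) (x + z) {X | ∀ k ≤ n, X k < m} + n * c)
          ∂(ω x (l x) : Measure ℤ) + c := by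
          rw [lintegral_add_right _ measurable_const, lintegral_const, measure_univ]
          push_cast
          ring
      _ ≤ ∫⁻ z, (G (l + Pi.single x 1) (x + z) + 1) ∂(ω x (l x) : Measure ℤ) + c := by
          refine add_le_add_left (lintegral_mono fun z => ih hn' _ _) _
      _ ≤ G l x + 1 := by
          rw [lintegral_add_right _ measurable_const, lintegral_const, measure_univ, mul_one,
            add_right_comm]
          gcongr
          exact hstep l x hxa hx

/-- A positive step, of probability `2 s`, shortens the distance `d + 1` to at most `d`, so the mean
of `s ^ distance` after the step is at least `2 s ^ (d + 1)`, twice its present value. The gain `s ^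
(d + 1) ≥ s ^ D` is a uniform drift; it prevents the walk from staying forever in a bounded interval
below `m`. -/
lemma lintegral_one_sub_pow_le {μ : ProbabilityMeasure ℤ} {m x : ℤ} {D : ℕ} {s : ℝ≥0∞}
    (hs : 2 * s = (μ : Measure ℤ) (Set.Ioi (0 : ℤ))) (hx : x < m) (hD : (m - x).toNat ≤ D) :
    ∫⁻ z, (1 - s ^ (m - (x + z)).toNat) ∂(μ : Measure ℤ) + s ^ D ≤ 1 - s ^ (m - x).toNat := by
  have hs1' : 2 * s ≤ 1 := hs ▸ prob_le_one
  have hs1 : s ≤ 1 := le_trans (by rw [two_mul]; exact le_self_add) hs1'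
  obtain ⟨d, hd⟩ : ∃ d, (m - x).toNat = d + 1 := ⟨(m - x).toNat - 1, by omega⟩
  rw [hd] at hD ⊢
  have hle : ∀ z, s ^ (m - (x + z)).toNat ≤ 1 := fun z => pow_le_one₀ (zero_le) hs1
  have hlow : 2 * s ^ (d + 1) ≤ ∫⁻ z, s ^ (m - (x + z)).toNat ∂(μ : Measure ℤ) := by
    calc 2 * s ^ (d + 1) = ∫⁻ z in Set.Ioi 0, s ^ d ∂(μ : Measure ℤ) := by
          rw [setLIntegral_const, ← hs]; ring
      _ ≤ ∫⁻ z in Set.Ioi 0, s ^ (m - (x + z)).toNat ∂(μ : Measure ℤ) := by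
          refine setLIntegral_mono .of_discrete fun z hz => ?_
          refine pow_le_pow_of_le_one (zero_le) hs1 ?_
          have : 0 < z := hz
          omega
      _ ≤ _ := setLIntegral_le_lintegral _ _
  rw [lintegral_sub .of_discrete ?_ (ae_of_all _ hle)]
  · simp only [lintegral_const, measure_univ, mul_one]
    refine ENNReal.le_sub_of_add_le_right
      (ENNReal.pow_ne_top (ne_top_of_le_ne_top (by simp) hs1)) ?_
    have h2 : 2 * s ^ (d + 1) ≤ 1 := by
      rw [pow_succ, mul_left_comm]
      exact mul_le_one' (pow_le_one₀ (zero_le) hs1) hs1'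
    calc _ ≤ 1 - 2 * s ^ (d + 1) + s ^ (d + 1) + s ^ (d + 1) := by
          gcongr ?_ + ?_ + _
          · exact tsub_le_tsub_left hlow _
          · exact pow_le_pow_of_le_one (zero_le) hs1 hD
      _ = 1 := by rw [add_assoc, ← two_mul, tsub_add_cancel_of_le h2]
  · refine ne_top_of_le_ne_top (b := 1) (by simp) ?_
    calc _ ≤ ∫⁻ z, 1 ∂(μ : Measure ℤ) := lintegral_mono hle
      _ = 1 := by simp

/-- The expected overshoots over `m` of the jumps from the sites in `(-N, m)`. -/
def excess (ω : Env) (m : ℤ) (N : ℕ) (y : ℤ) (j : ℕ) : ℝ≥0∞ :=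
  if -(N : ℤ) < y ∧ y < m then ∫⁻ z : ℤ, ((z - (m - y).toNat).toNat : ℝ≥0∞) ∂(ω y j : Measure ℤ)
  else 0

/-- The environments for which the jumps over a level have a sublinear total overshoot. -/
def Good (M : ℕ) (μ : ProbabilityMeasure ℤ) : Set Env :=
  {ω | ω ∈ OmegaPlus M μ ∧
    ∀ m : ℤ, liminf (fun N : ℕ => pot M (excess ω m N) 0 / N) atTop = 0}

section hitting

variable {M : ℕ} {μ : ProbabilityMeasure ℤ} {ω : Env}

/-- The potential pays for the overshoots of the cookies. A `μ`-step needs no payment: from `x` with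
`x + B < m` it does not jump over `m`. -/
lemma lintegral_toNat_add_pot_le (hω : ω ∈ OmegaPlus M μ) (hfin : HasFiniteMean μ)
    (hzero : mean μ = 0) {B : ℕ} (hB : ∀ᵐ z ∂(μ : Measure ℤ), z ≤ (B : ℤ)) {m : ℤ} {N : ℕ}
    (l : ℤ → ℕ) {x : ℤ} (h1 : -(N : ℤ) < x) (h2 : x + B < m) :
    ∫⁻ z, (((m - (x + z)).toNat : ℝ≥0∞) + pot M (excess ω m N) (l + Pi.single x 1))
      ∂(ω x (l x) : Measure ℤ) ≤ ((m - x).toNat : ℝ≥0∞) + pot M (excess ω m N) l := by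
  have hc : ∀ z, m - (x + z) = ((m - x).toNat : ℤ) - z := by intro z; omega
  have := lintegral_add_pot_le (l := l) (e := excess ω m N) (x := x) (c := 0)
    (h := fun y => ((m - y).toNat : ℝ≥0∞)) hω ?_ ?_
  · simpa using this
  · intro j hj
    obtain ⟨ha, hb⟩ := (hω x).1 j hj
    have := lintegral_toNat_sub_le ha hb (m - x).toNat
    simp only [excess, h1, show x < m by omega, and_self, if_true, add_zero, hc]
    exact this
  · have := lintegral_toNat_sub_le hfin hzero.ge (m - x).toNat
    have h0 : ∫⁻ z : ℤ, ((z - (m - x).toNat).toNat : ℝ≥0∞) ∂(μ : Measure ℤ) = 0 := by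
      rw [lintegral_eq_zero_iff .of_discrete]
      filter_upwards [hB] with z hz
      simp only [Pi.zero_apply, Nat.cast_eq_zero]
      omega
    rw [h0, add_zero] at this
    simp only [add_zero, hc]
    exact this

/-- Gambler's ruin. `G` is the linear supermartingale for the interval `(-N, m)`, with target `m +
B` so that `μ`-steps from below `m` cause no overshoot. `W` loses at least `c` per step, which
excludes staying in the interval; its weight tends to `0` as the time horizon grows, and only `G /
H` remains. -/
lemma walk_stay_le_div (hω : ω ∈ OmegaPlus M μ) (hfin : HasFiniteMean μ)
    (hzero : mean μ = 0) (hpos : 0 < (μ : Measure ℤ) (Set.Ioi (0 : ℤ))) {B : ℕ}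
    (hB : ∀ᵐ z ∂(μ : Measure ℤ), z ≤ (B : ℤ)) (m : ℤ) {N : ℕ} (hN : 0 < m + B + N)
    (l : ℤ → ℕ) (x : ℤ) :
    walk ω l x {X | ∀ k, X k < m} ≤
      (((m + B - x).toNat : ℝ≥0∞) + pot M (excess ω (m + B) N) l) / ((m + B + N).toNat : ℝ≥0∞) := by
  set s := (μ : Measure ℤ) (Set.Ioi (0 : ℤ)) / 2 with hs
  have hs2 : 2 * s = (μ : Measure ℤ) (Set.Ioi (0 : ℤ)) :=
    ENNReal.mul_div_cancel (by simp) (by simp)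
  set D := (m + N).toNat
  have hs0 : s ≠ 0 := by simp [hs, hpos.ne']
  have hst : s ≠ ∞ := by
    have : 2 * s ≠ ∞ := hs2 ▸ measure_ne_top _ _
    exact fun h => this (by rw [h]; simp)
  set c := s ^ D with hc
  have hc0 : c ≠ 0 := pow_ne_zero _ hs0
  have hct : c ≠ ∞ := ENNReal.pow_ne_top hst
  set H : ℝ≥0∞ := ((m + B + N).toNat : ℝ≥0∞) with hH
  have hH0 : H ≠ 0 := by
    simp only [hH, ne_eq, Nat.cast_eq_zero]
    omega
  have hHt : H ≠ ∞ := ENNReal.natCast_ne_top _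
  -- A cookie step may undo the drift. It raises a function with values in `[0, 1]` by at most `1`,
  -- and another `1` covers the required loss `c ≤ 1`.
  let e₂ : ℤ → ℕ → ℝ≥0∞ := fun y _ => if -(N : ℤ) < y ∧ y < m then 2 else 0
  let W : (ℤ → ℕ) → ℤ → ℝ≥0∞ := fun l x => (1 - s ^ (m - x).toNat) + pot M e₂ l
  let G : (ℤ → ℕ) → ℤ → ℝ≥0∞ := fun l x =>
    ((m + B - x).toNat : ℝ≥0∞) + pot M (excess ω (m + B) N) l
  have hW : ∀ l x, -(N : ℤ) < x → x < m →
      ∫⁻ z, W (l + Pi.single x 1) (x + z) ∂(ω x (l x) : Measure ℤ) + c ≤ W l x := by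
    intro l x h1 h2
    refine lintegral_add_pot_le (h := fun y => 1 - s ^ (m - y).toNat) hω ?_ ?_
    · intro j _
      have hsle : c ≤ 1 := pow_le_one₀ (zero_le) (by
        calc s ≤ 2 * s := by rw [two_mul]; exact le_self_add
          _ ≤ 1 := hs2 ▸ prob_le_one)
      calc _ ≤ ∫⁻ z, 1 ∂(ω x j : Measure ℤ) + 1 := by
            gcongr with z
            exact tsub_le_self
        _ = 2 := by simp [one_add_one_eq_two]
        _ ≤ _ := by simp [e₂, h1, h2]
    · exact lintegral_one_sub_pow_le hs2 h2 (by omega)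
  have hG : ∀ l x, -(N : ℤ) < x → x < m →
      ∫⁻ z, G (l + Pi.single x 1) (x + z) ∂(ω x (l x) : Measure ℤ) ≤ G l x := fun l x h1 h2 =>
    lintegral_toNat_add_pot_le hω hfin hzero hB l h1 (by omega)
  have hWt : W l x ≠ ∞ := by
    refine ENNReal.add_ne_top.2 ⟨ne_top_of_le_ne_top ENNReal.one_ne_top tsub_le_self, ?_⟩
    have hfs : ∀ y ∉ Finset.Ioo (-(N : ℤ)) m, ∑ j ∈ Finset.Ico (l y) M, e₂ y j = 0 := by
      intro y hy
      simp only [Finset.mem_Ioo] at hy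
      simp [e₂, hy]
    unfold pot
    rw [tsum_eq_sum hfs]
    refine ENNReal.sum_ne_top.2 fun y _ => ENNReal.sum_ne_top.2 fun j _ => ?_
    simp only [e₂]
    split_ifs <;> simp
  have key : ∀ n : ℕ, 0 < n → walk ω l x {X | ∀ k, X k < m} ≤
      G l x / H + W l x / c * (n : ℝ≥0∞)⁻¹ := by
    intro n hn
    have hn0 : (n : ℝ≥0∞) ≠ 0 := by simpa using hn.ne'
    have hnt : (n : ℝ≥0∞) ≠ ∞ := ENNReal.natCast_ne_top n
    have h1 : (n : ℝ≥0∞) * (n : ℝ≥0∞)⁻¹ = 1 := ENNReal.mul_inv_cancel hn0 hnt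
    -- `W / c` loses at least `1` per step, hence after scaling `1 / n` per step; over the horizon
    -- `n` the total loss is exactly the `1` on the right of `walk_stay_le`.
    have := walk_stay_le (ω := ω) (m := m) (a := -(N : ℤ)) (c := (n : ℝ≥0∞)⁻¹)
      (G := fun l x => G l x / H + W l x / c * (n : ℝ≥0∞)⁻¹) ?_ ?_ n h1.le l x
    · rw [h1, ENNReal.add_le_add_iff_right ENNReal.one_ne_top] at this
      refine le_trans (measure_mono ?_) this
      exact fun X hX k _ => hX k
    · intro l x h1 h2
      simp only [ENNReal.div_eq_inv_mul]
      rw [lintegral_add_left .of_discrete, lintegral_const_mul _ .of_discrete,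
        lintegral_mul_const _ .of_discrete, lintegral_const_mul _ .of_discrete, add_assoc]
      gcongr
      · exact hG l x h1 h2
      · calc _ = c⁻¹ * (∫⁻ z, W (l + Pi.single x 1) (x + z) ∂(ω x (l x) : Measure ℤ) + c) *
              (n : ℝ≥0∞)⁻¹ := by
              rw [mul_add, ENNReal.inv_mul_cancel hc0 hct, add_mul, one_mul]
          _ ≤ _ := by
              gcongr
              exact hW l x h1 h2
    · intro l x hx
      refine le_trans ?_ le_self_add
      rw [ENNReal.le_div_iff_mul_le (Or.inl hH0) (Or.inl hHt), one_mul]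
      refine le_trans ?_ le_self_add
      simp only [hH, Nat.cast_le]
      omega
  have hlim : Tendsto (fun n : ℕ => G l x / H + W l x / c * (n : ℝ≥0∞)⁻¹) atTop
      (nhds (G l x / H + W l x / c * 0)) := by
    refine Tendsto.const_add _ (ENNReal.Tendsto.const_mul
      ENNReal.tendsto_inv_nat_nhds_zero (Or.inr ?_))
    exact ENNReal.div_ne_top hWt hc0
  rw [mul_zero, add_zero] at hlim
  exact ge_of_tendsto hlim (eventually_atTop.2 ⟨1, fun n hn => key n hn⟩)

/-- In a good environment the walk exceeds every level, however many cookies are removed. -/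
lemma walk_stay_eq_zero (hω : ω ∈ Good M μ) (hfin : HasFiniteMean μ)
    (hzero : mean μ = 0) (hpos : 0 < (μ : Measure ℤ) (Set.Ioi (0 : ℤ))) {B : ℕ}
    (hB : ∀ᵐ z ∂(μ : Measure ℤ), z ≤ (B : ℤ)) (m : ℤ) (l : ℤ → ℕ) (x : ℤ) :
    walk ω l x {X | ∀ k, X k < m} = 0 := by
  set V := walk ω l x {X | ∀ k, X k < m} with hV
  by_contra hV0
  have hVt : V ≠ ∞ := measure_ne_top _ _
  have hV4 : V / 4 ≠ 0 := by simp [hV0]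
  have h1 : ∃ᶠ N : ℕ in atTop, pot M (excess ω (m + B) N) 0 / N < V / 4 :=
    frequently_lt_of_liminf_lt (by isBoundedDefault) (by rw [hω.2]; exact pos_iff_ne_zero.2 hV4)
  have h2 : ∀ᶠ N : ℕ in atTop, ((m + B - x).toNat : ℝ≥0∞) * (N : ℝ≥0∞)⁻¹ < V / 4 := by
    have : Tendsto (fun N : ℕ => ((m + B - x).toNat : ℝ≥0∞) * (N : ℝ≥0∞)⁻¹) atTop
        (nhds (((m + B - x).toNat : ℝ≥0∞) * 0)) :=
      ENNReal.Tendsto.const_mul ENNReal.tendsto_inv_nat_nhds_zero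
        (Or.inr (ENNReal.natCast_ne_top _))
    rw [mul_zero] at this
    exact this.eventually_lt_const (pos_iff_ne_zero.2 hV4)
  obtain ⟨N, hN1, hN2, hN3⟩ := (h1.and_eventually (h2.and
    -- This makes `m + B + N ≥ N / 2`, so replacing the denominator by `N` costs a factor `2`; hence
    -- the budget `V / 4` for each of the two terms.
    (eventually_gt_atTop (2 * (m + B).natAbs)))).exists
  have hN0 : (N : ℝ≥0∞) ≠ 0 := by simp; omega
  have key := walk_stay_le_div hω.1 hfin hzero hpos hB m (N := N) (by omega) l x
  have hle : (N : ℝ≥0∞) ≤ 2 * ((m + B + N).toNat : ℝ≥0∞) := by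
    exact_mod_cast (by omega : N ≤ 2 * (m + B + N).toNat)
  have hinv : ((m + B + N).toNat : ℝ≥0∞)⁻¹ ≤ 2 * (N : ℝ≥0∞)⁻¹ := by
    calc ((m + B + N).toNat : ℝ≥0∞)⁻¹ = 2 * (2 * ((m + B + N).toNat : ℝ≥0∞))⁻¹ := by
          rw [ENNReal.mul_inv (by simp) (by simp), ← mul_assoc,
            ENNReal.mul_inv_cancel (by simp) (by simp), one_mul]
      _ ≤ _ := by gcongr
  have : V < V / 4 + V / 4 + (V / 4 + V / 4) := by
    calc V ≤ (((m + B - x).toNat : ℝ≥0∞) + pot M (excess ω (m + B) N) l) *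
          ((m + B + N).toNat : ℝ≥0∞)⁻¹ := key
      _ ≤ (((m + B - x).toNat : ℝ≥0∞) + pot M (excess ω (m + B) N) 0) *
          (2 * (N : ℝ≥0∞)⁻¹) := by
          gcongr
          exact pot_anti (by intro y; simp)
      _ = 2 * (((m + B - x).toNat : ℝ≥0∞) * (N : ℝ≥0∞)⁻¹) +
          2 * (pot M (excess ω (m + B) N) 0 / N) := by
          rw [ENNReal.div_eq_inv_mul]; ring
      _ < V / 4 + V / 4 + (V / 4 + V / 4) := by
          rw [two_mul, two_mul]
          gcongr
  have h4 : V / 4 + V / 4 + (V / 4 + V / 4) = V := by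
    rw [← two_mul, ← two_mul, ← mul_assoc]
    norm_num
    exact ENNReal.mul_div_cancel (by simp) (by simp)
  exact absurd this (by rw [h4]; exact lt_irrefl _)

end hitting

end

/-! ### First-moment bounds for overshoots under `η` -/

section

lemma toNat_sub_eq_tsum (c : ℕ) (z : ℤ) :
    ((z - c).toNat : ℝ≥0∞) = ∑' i : ℕ, {z : ℤ | ((c + i : ℕ) : ℤ) < z}.indicator 1 z := by
  rw [tsum_eq_sum (s := Finset.range (z - c).toNat)]
  · rw [Finset.sum_congr rfl (g := fun _ => (1 : ℝ≥0∞))]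
    · simp
    · intro i hi
      rw [Set.indicator_of_mem]
      · rfl
      · have := Finset.mem_range.1 hi
        simp only [Set.mem_ofPred_eq]
        omega
  · intro i hi
    rw [Set.indicator_of_notMem]
    have : ¬ i < (z - c).toNat := fun h => hi (Finset.mem_range.2 h)
    simp only [Set.mem_ofPred_eq]
    omega

lemma lintegral_toNat_sub (ν : Measure ℤ) (c : ℕ) :
    ∫⁻ z : ℤ, ((z - c).toNat : ℝ≥0∞) ∂ν = ∑' i : ℕ, ν {z : ℤ | ((c + i : ℕ) : ℤ) < z} := by
  simp_rw [toNat_sub_eq_tsum]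
  rw [lintegral_tsum fun _ => .of_discrete]
  refine tsum_congr fun i => ?_
  rw [lintegral_indicator_one .of_discrete]

lemma measurable_lintegral_env (y : ℤ) (j : ℕ) (g : ℤ → ℝ≥0∞) :
    Measurable fun ω : Env => ∫⁻ z, g z ∂(ω y j : Measure ℤ) := by
  have h1 : Measurable fun ω : Env => ω y j := by fun_prop
  exact (Measure.measurable_lintegral (.of_discrete)).comp (measurable_subtype_coe.comp h1)

/-- The expected number of the first `M` cookies at `0` whose step exceeds `i`. -/
def tailProb (η : Measure Env) (M i : ℕ) : ℝ≥0∞ :=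
  ∫⁻ ω, ∑ j ∈ Finset.range M, (ω 0 j : Measure ℤ) {z | (i : ℤ) < z} ∂η

/-- The expected excess over `K` of the steps of the first `M` cookies at `0`. -/
def tailSum (η : Measure Env) (M K : ℕ) : ℝ≥0∞ := ∑' i, tailProb η M (K + i)

variable {η : Measure Env} {M : ℕ}

lemma tailSum_eq (K : ℕ) : tailSum η M K =
    ∫⁻ ω, ∑ j ∈ Finset.range M, ∫⁻ z : ℤ, ((z - K).toNat : ℝ≥0∞) ∂(ω 0 j : Measure ℤ) ∂η := by
  unfold tailSum tailProb
  rw [← lintegral_tsum fun i => (Finset.measurable_sum _ fun j _ =>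
    measurable_apply_env 0 j _).aemeasurable]
  refine lintegral_congr fun ω => ?_
  simp_rw [lintegral_toNat_sub]
  exact Summable.tsum_finsetSum fun _ _ => ENNReal.summable

lemma tailSum_zero_ne_top (h : ∫⁻ ω, ∑ j ∈ Finset.range M,
      ∫⁻ z : ℤ, (z.natAbs : ℝ≥0∞) ∂(ω 0 j : Measure ℤ) ∂η < ∞) : tailSum η M 0 ≠ ∞ := by
  rw [tailSum_eq]
  refine (lt_of_le_of_lt ?_ h).ne
  gcongr
  simp only [Nat.cast_zero, sub_zero]
  omega

lemma tailSum_anti : Antitone (tailSum η M) := by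
  intro K L h
  rw [tailSum_eq, tailSum_eq]
  gcongr with ω j _ z
  omega

lemma tendsto_tailSum (h : tailSum η M 0 ≠ ∞) :
    Tendsto (tailSum η M) atTop (nhds 0) := by
  have h' : ∑' i, tailProb η M i ≠ ∞ := by simpa [tailSum] using h
  have := ENNReal.tendsto_sum_nat_add (tailProb η M) h'
  simp_rw [add_comm _ (_ : ℕ)] at this
  exact this

lemma lintegral_site_eq (h_ident : ∀ x : ℤ, IdentDistrib (fun ω : Env => ω x)
      (fun ω : Env => ω 0) η η) {g : (ℕ → ProbabilityMeasure ℤ) → ℝ≥0∞} (hg : Measurable g)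
    (y : ℤ) : ∫⁻ ω, g (ω y) ∂η = ∫⁻ ω, g (ω 0) ∂η :=
  ((h_ident y).comp hg).lintegral_eq

lemma lintegral_pot {e : Env → ℤ → ℕ → ℝ≥0∞} (he : ∀ y j, Measurable fun ω => e ω y j) :
    ∫⁻ ω, pot M (e ω) 0 ∂η = ∑' y, ∫⁻ ω, ∑ j ∈ Finset.range M, e ω y j ∂η := by
  simp only [pot, Pi.zero_apply, ← Finset.range_eq_Ico]
  exact lintegral_tsum fun y => (Finset.measurable_sum _ fun j _ => he y j).aemeasurable

lemma measurable_excess (m : ℤ) (N : ℕ) (y : ℤ) (j : ℕ) :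
    Measurable fun ω => excess ω m N y j := by
  unfold excess
  split_ifs
  · exact measurable_lintegral_env _ _ _
  · exact measurable_const

lemma measurable_site_lintegral (j : ℕ) (g : ℤ → ℝ≥0∞) :
    Measurable fun s : ℕ → ProbabilityMeasure ℤ => ∫⁻ z, g z ∂(s j : Measure ℤ) := by
  have h1 : Measurable fun s : ℕ → ProbabilityMeasure ℤ => s j := by fun_prop
  exact (Measure.measurable_lintegral (.of_discrete)).comp (measurable_subtype_coe.comp h1)

lemma measurable_site_apply (j : ℕ) (s : Set ℤ) :
    Measurable fun t : ℕ → ProbabilityMeasure ℤ => (t j : Measure ℤ) s := by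
  have h1 : Measurable fun s : ℕ → ProbabilityMeasure ℤ => s j := by fun_prop
  exact (Measure.measurable_coe (MeasurableSet.of_discrete (s := s))).comp
    (measurable_subtype_coe.comp h1)

/-- The sites are identically distributed, so the contribution of `y` depends only on its distance
to `m`. -/
lemma lintegral_pot_excess (h_ident : ∀ x : ℤ, IdentDistrib (fun ω : Env => ω x)
      (fun ω : Env => ω 0) η η) (m : ℤ) (N : ℕ) :
    ∫⁻ ω, pot M (excess ω m N) 0 ∂η =
      ∑ y ∈ Finset.Ioo (-(N : ℤ)) m, tailSum η M (m - y).toNat := by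
  rw [lintegral_pot (measurable_excess m N), tsum_eq_sum (s := Finset.Ioo (-(N : ℤ)) m)]
  · refine Finset.sum_congr rfl fun y hy => ?_
    have hy' := Finset.mem_Ioo.1 hy
    simp only [excess, hy'.1, hy'.2, and_self, if_true]
    rw [tailSum_eq]
    exact lintegral_site_eq h_ident (g := fun s => ∑ j ∈ Finset.range M,
      ∫⁻ z : ℤ, ((z - (m - y).toNat).toNat : ℝ≥0∞) ∂(s j : Measure ℤ))
      (Finset.measurable_sum _ fun j _ => measurable_site_lintegral j _) y
  · intro y hy
    simp only [Finset.mem_Ioo] at hy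
    simp [excess, hy]

/-- The mean of the total excess is a sum of terms `tailSum η M (m - y)` that vanish as `m - y → ∞`,
hence it is `o(N)`. Fatou's lemma makes the liminf of the quotients vanish almost surely, which
suffices because the ruin estimate is needed only along a subsequence. -/
lemma ae_good {μ : ProbabilityMeasure ℤ} (hη : ∀ᵐ ω ∂η, ω ∈ OmegaPlus M μ)
    (h_moment : tailSum η M 0 ≠ ∞)
    (h_ident : ∀ x : ℤ, IdentDistrib (fun ω : Env => ω x) (fun ω : Env => ω 0) η η) :
    ∀ᵐ ω ∂η, ω ∈ Good M μ := by
  have hmeas : ∀ m N, Measurable fun ω => pot M (excess ω m N) 0 := fun m N =>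
    Measurable.tsum fun y => Finset.measurable_sum _ fun j _ => measurable_excess m N y j
  have hlim : ∀ m : ℤ, ∀ᵐ ω ∂η, liminf (fun N : ℕ => pot M (excess ω m N) 0 / N) atTop = 0 := by
    intro m
    have hm : ∀ N : ℕ, Measurable fun ω => pot M (excess ω m N) 0 / (N : ℝ≥0∞) := fun N =>
      (hmeas m N).div_const _
    have h0 : ∫⁻ ω, liminf (fun N : ℕ => pot M (excess ω m N) 0 / N) atTop ∂η = 0 := by
      refine le_antisymm ((lintegral_liminf_le hm).trans ?_) zero_le
      refine ge_of_tendsto (x := atTop)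
        (f := fun K : ℕ => (1 + m.natAbs : ℝ≥0∞) * tailSum η M K) ?_ (Eventually.of_forall ?_)
      · have := ENNReal.Tendsto.const_mul (a := (1 + m.natAbs : ℝ≥0∞))
          (tendsto_tailSum h_moment) (Or.inr (by simp))
        simpa using this
      intro K
      have hbound : ∀ N : ℕ, 0 < N → ∫⁻ ω, pot M (excess ω m N) 0 / N ∂η ≤
          K * tailSum η M 0 * (N : ℝ≥0∞)⁻¹ + (1 + m.natAbs : ℝ≥0∞) * tailSum η M K := by
        intro N hN
        simp_rw [div_eq_mul_inv]
        rw [lintegral_mul_const _ (hmeas m N), lintegral_pot_excess h_ident]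
        -- The at most `K` sites close to `m` get the trivial bound; the others, at most `N * (1 +
        -- |m|)` in number, are at distance at least `K`.
        have hsum : ∑ y ∈ Finset.Ioo (-(N : ℤ)) m, tailSum η M (m - y).toNat ≤
            K * tailSum η M 0 + N * ((1 + m.natAbs : ℝ≥0∞) * tailSum η M K) := by
          calc _ ≤ ∑ y ∈ Finset.Ioo (-(N : ℤ)) m,
                ((if m - K < y then tailSum η M 0 else 0) + tailSum η M K) := by
                refine Finset.sum_le_sum fun y _ => ?_
                split_ifs with h
                · exact le_add_right (tailSum_anti (Nat.zero_le _))
                · rw [zero_add]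
                  exact tailSum_anti (by omega)
            _ ≤ _ := by
                rw [Finset.sum_add_distrib, ← Finset.sum_filter, Finset.sum_const,
                  Finset.sum_const, nsmul_eq_mul, nsmul_eq_mul, ← mul_assoc]
                gcongr
                · calc _ ≤ (Finset.Ioo (m - K) m).card := by
                        refine Finset.card_le_card fun y hy => ?_
                        simp only [Finset.mem_filter, Finset.mem_Ioo] at hy ⊢
                        exact ⟨hy.2, hy.1.2⟩
                    _ ≤ K := by rw [Int.card_Ioo]; omega
                · rw [Int.card_Ioo]
                  have : (m - -(N : ℤ) - 1).toNat ≤ N * (1 + m.natAbs) := by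
                    have : (m.natAbs : ℕ) ≤ N * m.natAbs := Nat.le_mul_of_pos_left _ hN
                    rw [mul_add, mul_one]
                    omega
                  exact_mod_cast this
        calc _ ≤ (K * tailSum η M 0 + N * ((1 + m.natAbs : ℝ≥0∞) * tailSum η M K)) *
              (N : ℝ≥0∞)⁻¹ := by gcongr
          _ = _ := by
              rw [add_mul, mul_comm (N : ℝ≥0∞), mul_assoc ((1 + m.natAbs : ℝ≥0∞) * _),
                ENNReal.mul_inv_cancel (by simp; omega) (by simp), mul_one]
      have ht : Tendsto (fun N : ℕ => K * tailSum η M 0 * (N : ℝ≥0∞)⁻¹ +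
          (1 + m.natAbs : ℝ≥0∞) * tailSum η M K) atTop
          (nhds (K * tailSum η M 0 * 0 + (1 + m.natAbs : ℝ≥0∞) * tailSum η M K)) :=
        (ENNReal.Tendsto.const_mul ENNReal.tendsto_inv_nat_nhds_zero
          (Or.inr (ENNReal.mul_ne_top (by simp) h_moment))).add_const _
      rw [mul_zero, zero_add] at ht
      rw [← ht.liminf_eq]
      exact liminf_le_liminf (eventually_atTop.2 ⟨1, fun N hN => hbound N hN⟩)
    rw [lintegral_eq_zero_iff (Measurable.liminf hm)] at h0
    exact h0
  filter_upwards [hη, ae_all_iff.2 hlim] with ω h1 h2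
  exact ⟨h1, h2⟩

/-- The probability that the cookie `j` at `y < m` leads to `[m + K, ∞)`. -/
def jump (ω : Env) (m : ℤ) (K : ℕ) (y : ℤ) (j : ℕ) : ℝ≥0∞ :=
  if y < m then (ω y j : Measure ℤ) {z | m + K ≤ y + z} else 0

lemma measurable_jump (m : ℤ) (K : ℕ) (y : ℤ) (j : ℕ) : Measurable fun ω => jump ω m K y j := by
  unfold jump
  split_ifs
  · exact measurable_apply_env _ _ _
  · exact measurable_const

/-- A bound for the probability that the overshoot over `m` will be at least `K`. -/
def overshoot (M : ℕ) (ω : Env) (m : ℤ) (K : ℕ) (p : (ℤ → ℕ) × ℤ) : ℝ≥0∞ :=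
  {x : ℤ | m + K ≤ x}.indicator 1 p.2 + pot M (jump ω m K) p.1

/-- The site at distance `i + 1` to the left of `m` must make a step larger than `K + i`. Summing
over `i` gives the tail sum, with a bound that does not depend on `m`. -/
lemma lintegral_pot_jump_le (h_ident : ∀ x : ℤ, IdentDistrib (fun ω : Env => ω x)
      (fun ω : Env => ω 0) η η) (m : ℤ) (K : ℕ) :
    ∫⁻ ω, pot M (jump ω m K) 0 ∂η ≤ tailSum η M K := by
  rw [lintegral_pot (measurable_jump m K)]
  have h : ∀ y : ℤ, ∫⁻ ω, ∑ j ∈ Finset.range M, jump ω m K y j ∂η =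
      {y : ℤ | y < m}.indicator (fun y => tailProb η M (K + (m - 1 - y).toNat)) y := by
    intro y
    by_cases hy : y < m
    · simp only [jump, hy, if_true]
      rw [Set.indicator_of_mem (by exact hy), tailProb]
      have hset : {z : ℤ | m + K ≤ y + z} = {z | ((K + (m - 1 - y).toNat : ℕ) : ℤ) < z} := by
        ext z
        simp only [Set.mem_ofPred_eq]
        omega
      rw [hset]
      exact lintegral_site_eq h_ident (g := fun s => ∑ j ∈ Finset.range M,
        (s j : Measure ℤ) {z | ((K + (m - 1 - y).toNat : ℕ) : ℤ) < z})
        (Finset.measurable_sum _ fun j _ => measurable_site_apply j _) y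
    · rw [Set.indicator_of_notMem (by exact hy)]
      simp [jump, hy]
  simp_rw [h]
  rw [← tsum_subtype]
  refine ENNReal.tsum_comp_le_tsum_of_injective
    (f := fun y : {y : ℤ | y < m} => (m - 1 - y.1).toNat)
    ?_ fun i => tailProb η M (K + i)
  rintro ⟨y, hy⟩ ⟨y', hy'⟩ h
  have hy1 : y < m := hy
  have hy2 : y' < m := hy'
  simp only at h
  refine Subtype.ext ?_
  change y = y'
  omega

/-- Optional stopping for a function that is superharmonic as long as the walk is below `1`. -/
lemma crossInt_le {ω : Env} {f : (ℤ → ℕ) × ℤ → ℝ≥0∞} (hf : Measurable f)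
    (hstep : ∀ l x, x < 1 → ∫⁻ z, f (l + Pi.single x 1, x + z) ∂(ω x (l x) : Measure ℤ) ≤ f (l, x))
    (k : ℕ) (l : ℤ → ℕ) (x : ℤ) : crossInt ω f k l x ≤ f (l, x) := by
  induction k generalizing l x with
  | zero =>
    rcases le_or_gt 1 x with hx | hx
    · exact (crossInt_of_le hx).le
    · rw [crossInt_zero hx]; exact zero_le
  | succ k ih =>
    rcases le_or_gt 1 x with hx | hx
    · exact (crossInt_of_le hx).le
    rw [crossInt_succ hf hx]
    refine le_trans (lintegral_mono fun z => ?_) (hstep l x hx)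
    dsimp only
    split_ifs
    · exact ih _ _
    · exact zero_le

lemma measurable_pot (e : ℤ → ℕ → ℝ≥0∞) : Measurable (pot M e) := by
  refine Measurable.tsum fun y => ?_
  exact (Measurable.of_discrete (f := fun n => ∑ j ∈ Finset.Ico n M, e y j)).comp
    (measurable_pi_apply y)

lemma measurable_overshoot (ω : Env) (m : ℤ) (K : ℕ) : Measurable (overshoot M ω m K) :=
  ((measurable_one.indicator MeasurableSet.of_discrete).comp measurable_snd).add
    ((measurable_pot _).comp measurable_fst)

/-- Before the crossing the walk is below `m`, so a `μ`-step, of size at most `B ≤ K`, cannot reach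
`m + K`. A cookie does so with the probability that is removed from the potential when the cookie is
used. -/
lemma crossInt_overshoot_le {μ : ProbabilityMeasure ℤ} {ω : Env} (hω : ω ∈ OmegaPlus M μ) {B : ℕ}
    (hB : ∀ᵐ z ∂(μ : Measure ℤ), z ≤ (B : ℤ)) {K : ℕ} (hK : B ≤ K) {m : ℤ} (hm : 1 ≤ m)
    (k : ℕ) (l : ℤ → ℕ) (x : ℤ) :
    crossInt ω (overshoot M ω m K) k l x ≤ overshoot M ω m K (l, x) := by
  refine crossInt_le (measurable_overshoot ω m K) (fun l x hx => ?_) k l x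
  have hx0 : {x : ℤ | m + K ≤ x}.indicator (1 : ℤ → ℝ≥0∞) x = 0 := by
    refine Set.indicator_of_notMem ?_ _
    simp only [Set.mem_ofPred_eq]
    omega
  have hpre : ∀ ν : Measure ℤ, ∫⁻ z, {x : ℤ | m + K ≤ x}.indicator (1 : ℤ → ℝ≥0∞) (x + z) ∂ν =
      ν {z | m + K ≤ x + z} := by
    intro ν
    rw [← lintegral_indicator_one .of_discrete]
    rfl
  have := lintegral_add_pot_le (l := l) (e := jump ω m K) (x := x) (c := 0)
    (h := {x : ℤ | m + K ≤ x}.indicator 1) hω ?_ ?_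
  · simpa [overshoot] using this
  · intro j _
    rw [hpre, hx0]
    simp [jump, show x < m by omega]
  · rw [hpre, hx0, add_zero, nonpos_iff_eq_zero, measure_eq_zero_iff_ae_notMem]
    filter_upwards [hB] with z hz
    omega

end

section

/-! ### The environment measure -/

section env

variable {η : Measure Env}

lemma measurable_shift : Measurable shift :=
  measurable_pi_lambda _ fun x => measurable_pi_apply (x + 1)

lemma measurable_rightEnv : Measurable rightEnv :=
  measurable_pi_lambda _ fun x => measurable_pi_apply (x : ℤ)

lemma measurable_leftEnv : Measurable leftEnv :=
  measurable_pi_lambda _ fun x => measurable_pi_apply (x : ℤ)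

/-- Both laws are infinite products with the same marginal at every site. -/
lemma map_shift_eq [IsProbabilityMeasure η]
    (h_indep : iIndepFun (fun (x : ℤ) (ω : Env) => ω x) η)
    (h_ident : ∀ x : ℤ, IdentDistrib (fun ω : Env => ω x) (fun ω : Env => ω 0) η η) :
    η.map shift = η := by
  have h0 : η = Measure.infinitePi fun x : ℤ => η.map fun ω : Env => ω x := by
    have := h_indep.map_fun_eq_infinitePi_map₀ (by fun_prop)
    rwa [show (fun (ω : Env) i => ω i) = id from rfl, Measure.map_id] at this
  have h1 : iIndepFun (fun (x : ℤ) (ω : Env) => ω (x + 1)) η :=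
    h_indep.precomp (add_left_injective 1)
  have h2 : η.map shift = Measure.infinitePi fun x : ℤ => η.map fun ω : Env => ω (x + 1) := by
    exact h1.map_fun_eq_infinitePi_map₀ measurable_shift.aemeasurable
  conv_rhs => rw [h0]
  rw [h2]
  congr 1
  funext x
  rw [(h_ident (x + 1)).map_eq, (h_ident x).map_eq]

lemma indepFun_restrict
    (h_indep : iIndepFun (fun (x : ℤ) (ω : Env) => ω x) η) {S T : Set ℤ} (hST : Disjoint S T) :
    IndepFun (fun (ω : Env) (x : S) => ω x) (fun (ω : Env) (x : T) => ω x) η := by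
  have hcomap : ∀ S : Set ℤ, MeasurableSpace.comap (fun (ω : Env) (x : S) => ω x) inferInstance =
      ⨆ x ∈ S, MeasurableSpace.comap (fun ω : Env => ω x) inferInstance := by
    intro S
    change MeasurableSpace.comap _ (⨆ x : S, MeasurableSpace.comap _ _) = _
    rw [MeasurableSpace.comap_iSup, iSup_subtype']
    refine iSup_congr fun x => ?_
    rw [MeasurableSpace.comap_comp]
    rfl
  have := indep_iSup_of_disjoint (m := fun x => MeasurableSpace.comap (fun ω : Env => ω x)
    inferInstance) (fun x => (measurable_pi_apply x).comap_le) h_indep hST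
  rw [← hcomap, ← hcomap] at this
  exact this

end env

/-! ### The augmented chain -/

/-- The states of the augmented chain: an environment, the numbers of cookies that have been
removed from its sites, and an overshoot. -/
abbrev AugState : Type := Env × (ℤ → ℕ) × ℕ

/-- The state of the augmented chain after the first entrance to `[1, ∞)`. -/
def land (M : ℕ) (ω : Env) (p : (ℤ → ℕ) × ℤ) : AugState :=
  (shift ω, fun y => min M (p.1 (y + 1)), (p.2 - 1).toNat)

lemma measurable_uncurry_land (M : ℕ) :
    Measurable fun q : Env × (ℤ → ℕ) × ℤ => land M q.1 q.2 := by
  refine (measurable_shift.comp measurable_fst).prodMk (Measurable.prodMk ?_ ?_)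
  · refine measurable_pi_lambda _ fun y => ?_
    exact measurable_const.min ((measurable_pi_apply (y + 1)).comp
      (measurable_fst.comp measurable_snd))
  · exact (Measurable.of_discrete (f := fun x : ℤ => (x - 1).toNat)).comp
      (measurable_snd.comp measurable_snd)

lemma measurable_removeCookies :
    Measurable fun q : Env × (ℤ → ℕ) => removeCookies q.1 q.2 := by
  refine measurable_pi_lambda _ fun x => measurable_pi_lambda _ fun j => ?_
  have h : Measurable fun q : (ℕ → ProbabilityMeasure ℤ) × ℕ => q.1 (q.2 + j) :=
    measurable_from_prod_countable_left fun m => measurable_pi_apply (m + j)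
  exact h.comp (by fun_prop : Measurable fun q : Env × (ℤ → ℕ) => (q.1 x, q.2 x))

/-- The law of the walk as a kernel on the augmented states. -/
def walkKernel : Kernel AugState (ℕ → ℤ) :=
  quenchedKernel.comap (fun a : AugState => (removeCookies a.1 a.2.1, (a.2.2 : ℤ)))
    ((measurable_removeCookies.comp (measurable_fst.prodMk
      (measurable_fst.comp measurable_snd))).prodMk
      ((Measurable.of_discrete (f := fun n : ℕ => (n : ℤ))).comp
        (measurable_snd.comp measurable_snd)))

lemma walkKernel_apply (a : AugState) : walkKernel a = walk a.1 a.2.1 a.2.2 := rfl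

instance : IsMarkovKernel walkKernel := by unfold walkKernel; infer_instance

lemma measurable_land_cross (M : ℕ) :
    Measurable fun q : AugState × (ℕ → ℤ) => land M q.1.1 (cross q.1.2.1 q.2) :=
  (measurable_uncurry_land M).comp ((measurable_fst.comp measurable_fst).prodMk
    (measurable_uncurry_cross.comp (((measurable_fst.comp measurable_snd).comp
      measurable_fst).prodMk measurable_snd)))

/-- The transition kernel of the augmented chain. -/
def crossKernel (M : ℕ) : Kernel AugState AugState :=
  (Kernel.id ×ₖ walkKernel).map fun q => land M q.1.1 (cross q.1.2.1 q.2)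

instance (M : ℕ) : IsMarkovKernel (crossKernel M) := by
  unfold crossKernel
  exact Kernel.IsMarkovKernel.map _ (measurable_land_cross M)

lemma lintegral_crossKernel (M : ℕ) (a : AugState) {f : AugState → ℝ≥0∞} (hf : Measurable f) :
    ∫⁻ b, f b ∂crossKernel M a = ∫⁻ X, f (land M a.1 (cross a.2.1 X)) ∂walk a.1 a.2.1 a.2.2 := by
  rw [crossKernel, Kernel.lintegral_map _ (measurable_land_cross M) _ hf,
    Kernel.lintegral_id_prod
      (f := fun q : AugState × (ℕ → ℤ) => f (land M q.1.1 (cross q.1.2.1 q.2)))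
      (hf.comp (measurable_land_cross M)), walkKernel_apply]

/-- The laws of the augmented chain that starts in `(ω, 0, 0)`, where `ω` has the law `η`. -/
def chain (η : Measure Env) (M : ℕ) : ℕ → Measure AugState
  | 0 => η.map fun ω => (ω, 0, 0)
  | n + 1 => (chain η M n).bind (crossKernel M)

lemma add_one_mem_Ici_zero (y : Set.Ici (0 : ℤ)) : (y : ℤ) + 1 ∈ Set.Ici (0 : ℤ) := by
  have := Set.mem_Ici.1 y.2
  exact Set.mem_Ici.2 (by omega)

lemma add_one_mem_Ici_one (y : Set.Ici (0 : ℤ)) : (y : ℤ) + 1 ∈ Set.Ici (1 : ℤ) := by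
  have := Set.mem_Ici.1 y.2
  exact Set.mem_Ici.2 (by omega)

/-- The environments on the sites `x ≥ 0`. -/
abbrev RightEnv : Type := Set.Ici (0 : ℤ) → ℕ → ProbabilityMeasure ℤ

/-- The environments on the sites `x < 0`, with removed cookies and overshoots. -/
abbrev Past : Type := (Set.Iio (0 : ℤ) → ℕ → ProbabilityMeasure ℤ) × (ℤ → ℕ) × ℕ

/-- The environment at the sites `x < 0`, the removed cookies and the overshoot. -/
def past (a : AugState) : Past :=
  (leftEnv a.1, a.2)

lemma measurable_past : Measurable past :=
  (measurable_leftEnv.comp measurable_fst).prodMk measurable_snd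

/-- The properties that are inherited by the laws of the augmented chain. -/
structure Inherited (η : Measure Env) (M : ℕ) (ν : Measure AugState) : Prop where
  prob : IsProbabilityMeasure ν
  fst : ∀ S, MeasurableSet S → ν (Prod.fst ⁻¹' S) = η S
  cap : ∀ᵐ a ∂ν, ∀ y, a.2.1 y ≤ M
  right : ∀ᵐ a ∂ν, ∀ y, 0 ≤ y → a.2.1 y = 0
  indep : ∀ S T, MeasurableSet S → MeasurableSet T →
    ν ((fun a => rightEnv a.1) ⁻¹' S ∩ past ⁻¹' T) = η (rightEnv ⁻¹' S) * ν (past ⁻¹' T)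

namespace Inherited

variable {η : Measure Env} {M : ℕ} {ν : Measure AugState}

lemma map_fst (h : Inherited η M ν) : ν.map Prod.fst = η := by
  ext S hS
  rw [Measure.map_apply measurable_fst hS, h.fst S hS]

lemma ae_fst (h : Inherited η M ν) {p : Env → Prop} (hp : ∀ᵐ ω ∂η, p ω) : ∀ᵐ a ∂ν, p a.1 := by
  rw [← h.map_fst] at hp
  exact ae_of_ae_map measurable_fst.aemeasurable hp

lemma map_prod (h : Inherited η M ν) [IsProbabilityMeasure η] :
    ν.map (fun a => (rightEnv a.1, past a)) = (η.map rightEnv).prod (ν.map past) := by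
  have := h.prob
  have h1 : Measurable fun a : AugState => rightEnv a.1 := measurable_rightEnv.comp measurable_fst
  have : IsProbabilityMeasure (η.map rightEnv) :=
    Measure.isProbabilityMeasure_map measurable_rightEnv.aemeasurable
  have : IsProbabilityMeasure (ν.map past) :=
    Measure.isProbabilityMeasure_map measurable_past.aemeasurable
  symm
  refine Measure.prod_eq fun S T hS hT => ?_
  rw [Measure.map_apply (h1.prodMk measurable_past) (hS.prod hT),
    Measure.map_apply measurable_rightEnv hS, Measure.map_apply measurable_past hT,
    ← h.indep S T hS hT]
  rfl

end Inherited

section inherited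

variable {η : Measure Env} {M : ℕ} {μ : ProbabilityMeasure ℤ}

lemma inherited_chain_zero [IsProbabilityMeasure η]
    (h_indep : iIndepFun (fun (x : ℤ) (ω : Env) => ω x) η) :
    Inherited η M (chain η M 0) := by
  have hm : Measurable fun ω : Env => ((ω, 0, 0) : AugState) :=
    measurable_id.prodMk measurable_const
  have hind : IndepFun rightEnv leftEnv η :=
    indepFun_restrict h_indep (S := Set.Ici 0) (T := Set.Iio 0)
      (Set.disjoint_left.2 fun x hx hx' => not_lt.2 (Set.mem_Ici.1 hx) hx')
  refine ⟨Measure.isProbabilityMeasure_map hm.aemeasurable, fun S hS => ?_, ?_, ?_,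
    fun S T hS hT => ?_⟩
  · rw [chain, Measure.map_apply hm (measurable_fst hS)]
    rfl
  · refine (ae_map_iff hm.aemeasurable ?_).2 (ae_of_all _ fun ω => by simp)
    have : {a : AugState | ∀ y, a.2.1 y ≤ M} = ⋂ y, {a : AugState | a.2.1 y ≤ M} := by ext; simp
    rw [this]
    refine MeasurableSet.iInter fun y => ?_
    exact measurableSet_le (by fun_prop) measurable_const
  · refine (ae_map_iff hm.aemeasurable ?_).2 (ae_of_all _ fun ω => by simp)
    have : {a : AugState | ∀ y, 0 ≤ y → a.2.1 y = 0} =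
        ⋂ y, ⋂ _ : 0 ≤ y, {a : AugState | a.2.1 y = 0} := by ext; simp
    rw [this]
    refine MeasurableSet.iInter fun y => MeasurableSet.iInter fun _ => ?_
    exact measurableSet_eq_fun (by fun_prop) measurable_const
  · have h1 : Measurable fun a : AugState => rightEnv a.1 :=
      measurable_rightEnv.comp measurable_fst
    rw [chain, Measure.map_apply hm ((h1 hS).inter (measurable_past hT)),
      Measure.map_apply hm (measurable_past hT)]
    have hT' : MeasurableSet ((fun s => ((s, 0, 0) :
        (Set.Iio (0 : ℤ) → ℕ → ProbabilityMeasure ℤ) × (ℤ → ℕ) × ℕ)) ⁻¹' T) :=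
      (measurable_id.prodMk measurable_const) hT
    exact hind.measure_inter_preimage_eq_mul _ _ hS hT'

/-- Until the entrance to `[1, ∞)` the walk uses cookies only at sites below `1`. -/
lemma crossInt_congr {ω ω' : Env} (h : ∀ y < 1, ω y = ω' y) {f : (ℤ → ℕ) × ℤ → ℝ≥0∞}
    (hf : Measurable f) (k : ℕ) (l : ℤ → ℕ) (x : ℤ) :
    crossInt ω f k l x = crossInt ω' f k l x := by
  induction k generalizing l x with
  | zero =>
    rcases le_or_gt 1 x with hx | hx
    · rw [crossInt_of_le hx, crossInt_of_le hx]
    · rw [crossInt_zero hx, crossInt_zero hx]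
  | succ k ih =>
    rcases le_or_gt 1 x with hx | hx
    · rw [crossInt_of_le hx, crossInt_of_le hx]
    · rw [crossInt_succ hf hx, crossInt_succ hf hx, h x hx]
      simp_rw [ih]

lemma ae_hit_congr {ω ω' : Env} (h : ∀ y < 1, ω y = ω' y) {l : ℤ → ℕ} {x : ℤ}
    (hhit : ∀ᵐ X ∂walk ω l x, ∃ n, 1 ≤ X n) : ∀ᵐ X ∂walk ω' l x, ∃ n, 1 ≤ X n := by
  have hS : ∀ ω, ⨆ k, crossInt ω (fun _ => 1) k l x = walk ω l x {X | ∃ n, 1 ≤ X n} := by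
    intro ω
    rw [← iUnion_crossSet, monotone_crossSet.measure_iUnion]
    simp [crossInt]
  have hm : MeasurableSet {X : ℕ → ℤ | ∃ n, 1 ≤ X n} := by
    rw [← iUnion_crossSet]
    exact MeasurableSet.iUnion measurableSet_crossSet
  refine (mem_ae_iff_prob_eq_one hm).2 ?_
  rw [← hS ω']
  simp_rw [← crossInt_congr h measurable_const]
  rw [hS ω]
  exact (mem_ae_iff_prob_eq_one hm).1 hhit

lemma lintegral_cross_congr {ω ω' : Env} (h : ∀ y < 1, ω y = ω' y) {l : ℤ → ℕ} {x : ℤ}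
    (hhit : ∀ᵐ X ∂walk ω l x, ∃ n, 1 ≤ X n) {f : (ℤ → ℕ) × ℤ → ℝ≥0∞} (hf : Measurable f) :
    ∫⁻ X, f (cross l X) ∂walk ω l x = ∫⁻ X, f (cross l X) ∂walk ω' l x := by
  rw [← iSup_crossInt hhit, ← iSup_crossInt (ae_hit_congr h hhit)]
  simp_rw [crossInt_congr h hf]

/-- The environment with the sites `x < 0` from `s`, and `t` at all other sites. -/
def glue (t : ℕ → ProbabilityMeasure ℤ) (s : Set.Iio (0 : ℤ) → ℕ → ProbabilityMeasure ℤ) : Env :=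
  fun y => if h : y < 0 then s ⟨y, h⟩ else t

lemma measurable_glue :
    Measurable fun q : (ℕ → ProbabilityMeasure ℤ) ×
      (Set.Iio (0 : ℤ) → ℕ → ProbabilityMeasure ℤ) => glue q.1 q.2 := by
  refine measurable_pi_lambda _ fun y => ?_
  unfold glue
  split_ifs with h
  · exact (measurable_pi_apply (⟨y, h⟩ : Set.Iio (0 : ℤ))).comp measurable_snd
  · exact measurable_fst

/-- The past after a crossing depends on `a` only through the site `0` and the old past: `glue`
keeps these and overwrites the sites `y ≥ 1`, which are neither read by the walk nor moved to the
left half-line by the shift. -/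
lemma crossKernel_past_eq {a : AugState}
    (hhit : ∀ᵐ X ∂walk a.1 a.2.1 a.2.2, ∃ n, 1 ≤ X n)
    {T : Set Past}
    (hT : MeasurableSet T) : crossKernel M a (past ⁻¹' T) =
      crossKernel M (glue (a.1 0) (leftEnv a.1), a.2) (past ⁻¹' T) := by
  have h : ∀ y < 1, a.1 y = glue (a.1 0) (leftEnv a.1) y := by
    intro y hy
    unfold glue
    split_ifs with h
    · rfl
    · rw [show y = 0 by omega]
  have hm : Measurable ((past ⁻¹' T).indicator (1 : AugState → ℝ≥0∞)) :=
    measurable_one.indicator (measurable_past hT)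
  rw [← lintegral_indicator_one (measurable_past hT),
    ← lintegral_indicator_one (measurable_past hT), lintegral_crossKernel _ _ hm,
    lintegral_crossKernel _ _ hm]
  have hland : ∀ p, (past ⁻¹' T).indicator (1 : AugState → ℝ≥0∞) (land M a.1 p) =
      (past ⁻¹' T).indicator (1 : AugState → ℝ≥0∞)
        (land M (glue (a.1 0) (leftEnv a.1)) p) := by
    intro p
    have : past (land M a.1 p) = past (land M (glue (a.1 0) (leftEnv a.1)) p) := by
      refine Prod.ext ?_ rfl
      funext y
      have hy : (y : ℤ) < 0 := y.2
      exact h (y + 1) (by omega)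
    have he : ∀ b, (past ⁻¹' T).indicator (1 : AugState → ℝ≥0∞) b =
        T.indicator (1 : Past → ℝ≥0∞) (past b) := fun b => rfl
    rw [he, he, this]
  refine (lintegral_congr fun X => hland _).trans ?_
  exact lintegral_cross_congr h hhit
    (f := fun p => (past ⁻¹' T).indicator (1 : AugState → ℝ≥0∞)
      (land M (glue (a.1 0) (leftEnv a.1)) p))
    (hm.comp ((measurable_uncurry_land M).comp measurable_prodMk_left))

/-- Preservation of independence: the new right environment is `(ω_x)_{x ≥ 1}`, while the new past
is produced from `ω 0` and the old past. Since `ω 0`, `(ω_x)_{x ≥ 1}` and the old past are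
independent, Fubini and independence of sites give the product. -/
lemma Inherited.bind [IsProbabilityMeasure η]
    (h_indep : iIndepFun (fun (x : ℤ) (ω : Env) => ω x) η) (hshift : η.map shift = η)
    (hhit : ∀ᵐ ω ∂η, ∀ l x, ∀ᵐ X ∂walk ω l x, ∃ n, 1 ≤ X n)
    {ν : Measure AugState} (h : Inherited η M ν) : Inherited η M (ν.bind (crossKernel M)) := by
  have := h.prob
  have hker : ∀ (a : AugState) {A : Set AugState} (_ : MeasurableSet A), crossKernel M a A =
      walk a.1 a.2.1 a.2.2 {X | land M a.1 (cross a.2.1 X) ∈ A} := by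
    intro a A hA
    have hX : MeasurableSet {X | land M a.1 (cross a.2.1 X) ∈ A} :=
      ((measurable_land_cross M).comp (measurable_prodMk_left (x := a))) hA
    rw [← lintegral_indicator_one hA, lintegral_crossKernel _ _ (measurable_one.indicator hA),
      ← lintegral_indicator_one hX]
    rfl
  have hae : ∀ {p : AugState → Prop}, MeasurableSet {a | p a} →
      (∀ᵐ a ∂ν, ∀ X, p (land M a.1 (cross a.2.1 X))) → ∀ᵐ b ∂ν.bind (crossKernel M), p b := by
    intro p hp hpX
    rw [ae_iff, Measure.bind_apply (by exact hp.compl) (crossKernel M).measurable.aemeasurable,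
      lintegral_eq_zero_iff ((crossKernel M).measurable_coe (by exact hp.compl))]
    filter_upwards [hpX] with a ha
    rw [hker a (by exact hp.compl)]
    simp [ha]
  have hS₀ : ∀ {S : Set RightEnv}, MeasurableSet S →
      η (rightEnv ⁻¹' S) = η ((fun ω => rightEnv (shift ω)) ⁻¹' S) := by
    intro S hS
    conv_lhs => rw [← hshift]
    rw [Measure.map_apply measurable_shift (measurable_rightEnv hS)]
    rfl
  refine ⟨inferInstance, fun S hS => ?_, ?_, ?_, fun S T hS hT => ?_⟩
  · rw [Measure.bind_apply (measurable_fst hS) (crossKernel M).measurable.aemeasurable]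
    have : ∀ a : AugState, crossKernel M a (Prod.fst ⁻¹' S) =
        ((fun a : AugState => shift a.1) ⁻¹' S).indicator 1 a := by
      intro a
      rw [hker a (measurable_fst hS)]
      by_cases ha : shift a.1 ∈ S
      · rw [Set.indicator_of_mem (by exact ha)]
        simp [land, ha]
      · rw [Set.indicator_of_notMem (by exact ha)]
        simp [land, ha]
    simp_rw [this]
    refine (lintegral_indicator_one (s := (fun a : AugState => shift a.1) ⁻¹' S)
      ((measurable_shift.comp measurable_fst) hS)).trans ?_
    change ν (Prod.fst ⁻¹' (shift ⁻¹' S)) = _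
    rw [h.fst _ (measurable_shift hS)]
    conv_rhs => rw [← hshift, Measure.map_apply measurable_shift hS]
  · refine hae ?_ (ae_of_all _ fun a X y => min_le_left _ _)
    have : {a : AugState | ∀ y, a.2.1 y ≤ M} = ⋂ y, {a : AugState | a.2.1 y ≤ M} := by ext; simp
    rw [this]
    refine MeasurableSet.iInter fun y => ?_
    exact measurableSet_le (by fun_prop) measurable_const
  · refine hae ?_ ?_
    · have : {a : AugState | ∀ y, 0 ≤ y → a.2.1 y = 0} =
          ⋂ y, ⋂ _ : 0 ≤ y, {a : AugState | a.2.1 y = 0} := by ext; simp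
      rw [this]
      refine MeasurableSet.iInter fun y => MeasurableSet.iInter fun _ => ?_
      exact measurableSet_eq_fun (by fun_prop) measurable_const
    · filter_upwards [h.right] with a ha X y hy
      -- Sites `y + 1 ≥ 1` are not visited before the entrance time. On paths that never enter, that
      -- time is `0` by convention and there are no earlier visits at all.
      have hv : visits X (tau X 1) (y + 1) = 0 := by
        unfold visits
        rw [Finset.card_eq_zero, Finset.filter_eq_empty_iff]
        intro k hk hXk
        have hk' := Finset.mem_range.1 hk
        by_cases hex : ∃ k, ((1 : ℕ) : ℤ) ≤ X k
        · have := (tau_spec hex).2 k hk'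
          push_cast at this
          omega
        · push Not at hex
          rw [tau_of_forall_lt hex] at hk'
          omega
      simp [land, cross, hv, ha (y + 1) (by omega)]
  · have hm1 : Measurable fun a : AugState => rightEnv a.1 :=
      measurable_rightEnv.comp measurable_fst
    have hmS : Measurable fun r : RightEnv =>
        fun y : Set.Ici (0 : ℤ) => r ⟨y + 1, add_one_mem_Ici_zero y⟩ :=
      measurable_pi_lambda _ fun y => measurable_pi_apply _
    let S' := (fun r : RightEnv =>
        fun y : Set.Ici (0 : ℤ) => r ⟨y + 1, add_one_mem_Ici_zero y⟩) ⁻¹' S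
    have hS' : MeasurableSet S' := hmS hS
    let Φ : (ℕ → ProbabilityMeasure ℤ) →
        Past → ℝ≥0∞ := fun t p =>
      crossKernel M (glue t p.1, p.2) (past ⁻¹' T)
    have hΦ : Measurable fun q : (ℕ → ProbabilityMeasure ℤ) ×
        Past => Φ q.1 q.2 :=
      ((crossKernel M).measurable_coe (measurable_past hT)).comp
        ((measurable_glue.comp (measurable_fst.prodMk (measurable_fst.comp measurable_snd))).prodMk
          (measurable_snd.comp measurable_snd))
    have h0 : (0 : ℤ) ∈ Set.Ici (0 : ℤ) := by simp
    have hΦ' : ∀ᵐ a ∂ν, crossKernel M a (past ⁻¹' T) = Φ (rightEnv a.1 ⟨0, h0⟩) (past a) := by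
      filter_upwards [h.ae_fst hhit] with a ha
      exact crossKernel_past_eq (ha _ _) hT
    have hr0 : Measurable fun r : RightEnv => r ⟨0, h0⟩ :=
      measurable_pi_apply _
    have hG : Measurable fun q : RightEnv ×
        Past => Φ (q.1 ⟨0, h0⟩) q.2 :=
      hΦ.comp ((hr0.comp measurable_fst).prodMk measurable_snd)
    have hI : Measurable fun r : RightEnv =>
        S'.indicator (1 : RightEnv → ℝ≥0∞) r := measurable_one.indicator hS'
    have : SFinite (ν.map past) := by
      have : IsProbabilityMeasure (ν.map past) :=
        Measure.isProbabilityMeasure_map measurable_past.aemeasurable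
      infer_instance
    have hind : IndepFun (fun ω : Env => ω 0) (fun ω => rightEnv (shift ω)) η := by
      have := indepFun_restrict h_indep (S := {0}) (T := Set.Ici 1) (by simp)
      have hmT : Measurable fun r : Set.Ici (1 : ℤ) → ℕ → ProbabilityMeasure ℤ =>
          fun y : Set.Ici (0 : ℤ) => r ⟨y + 1, add_one_mem_Ici_one y⟩ :=
        measurable_pi_lambda _ fun y => measurable_pi_apply _
      have hm0 : Measurable fun r : ({0} : Set ℤ) → ℕ → ProbabilityMeasure ℤ => r ⟨0, rfl⟩ :=
        measurable_pi_apply _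
      exact this.comp hm0 hmT
    have hinner : ∀ p,
        ∫⁻ r, S'.indicator (1 : RightEnv → ℝ≥0∞) r * Φ (r ⟨0, h0⟩) p ∂(η.map rightEnv) =
        η (rightEnv ⁻¹' S) * ∫⁻ r, Φ (r ⟨0, h0⟩) p ∂(η.map rightEnv) := by
      intro p
      have hp : Measurable fun r : RightEnv => Φ (r ⟨0, h0⟩) p :=
        hG.comp measurable_prodMk_right
      have hp' : Measurable fun t => Φ t p := hΦ.comp measurable_prodMk_right
      rw [lintegral_map (f := fun r => S'.indicator (1 : RightEnv → ℝ≥0∞) r * Φ (r ⟨0, h0⟩) p)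
          (hI.mul hp) measurable_rightEnv, lintegral_map hp measurable_rightEnv,
        hS₀ hS, ← lintegral_indicator_one (s := (fun ω => rightEnv (shift ω)) ⁻¹' S)
          ((measurable_rightEnv.comp measurable_shift) hS)]
      have := lintegral_mul_eq_lintegral_mul_lintegral_of_indepFun
        (f := fun ω : Env => S.indicator (1 : RightEnv → ℝ≥0∞) (rightEnv (shift ω)))
        (g := fun ω : Env => Φ (ω 0) p)
        ((measurable_one.indicator hS).comp (measurable_rightEnv.comp measurable_shift))
        (hp'.comp (measurable_pi_apply 0))
        (hind.symm.comp (φ := S.indicator (1 : RightEnv → ℝ≥0∞)) (ψ := fun t => Φ t p)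
          (measurable_one.indicator hS) hp')
      exact this
    calc (ν.bind (crossKernel M)) ((fun a => rightEnv a.1) ⁻¹' S ∩ past ⁻¹' T)
        = ∫⁻ a, crossKernel M a ((fun a => rightEnv a.1) ⁻¹' S ∩ past ⁻¹' T) ∂ν :=
          Measure.bind_apply ((hm1 hS).inter (measurable_past hT))
            (crossKernel M).measurable.aemeasurable
      _ = ∫⁻ a, S'.indicator (1 : RightEnv → ℝ≥0∞) (rightEnv a.1) *
            Φ (rightEnv a.1 ⟨0, h0⟩) (past a) ∂ν := by
          refine lintegral_congr_ae ?_
          filter_upwards [hΦ'] with a ha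
          rw [← ha, hker a ((hm1 hS).inter (measurable_past hT)), hker a (measurable_past hT)]
          by_cases hmem : rightEnv (shift a.1) ∈ S
          · rw [Set.indicator_of_mem (by exact hmem), Pi.one_apply, one_mul]
            congr 1
            ext X
            simp [land, hmem]
          · rw [Set.indicator_of_notMem (by exact hmem), zero_mul]
            simp [land, hmem]
      _ = ∫⁻ q, S'.indicator (1 : RightEnv → ℝ≥0∞) q.1 * Φ (q.1 ⟨0, h0⟩) q.2
            ∂((η.map rightEnv).prod (ν.map past)) := by
          rw [← h.map_prod, lintegral_map
            (f := fun q => S'.indicator (1 : RightEnv → ℝ≥0∞) q.1 * Φ (q.1 ⟨0, h0⟩) q.2)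
            ((hI.comp measurable_fst).mul hG) (hm1.prodMk measurable_past)]
      _ = ∫⁻ p, ∫⁻ r, S'.indicator (1 : RightEnv → ℝ≥0∞) r * Φ (r ⟨0, h0⟩) p ∂(η.map rightEnv)
            ∂(ν.map past) := lintegral_prod_symm' _ ((hI.comp measurable_fst).mul hG)
      _ = η (rightEnv ⁻¹' S) * ∫⁻ p, ∫⁻ r, Φ (r ⟨0, h0⟩) p ∂(η.map rightEnv) ∂(ν.map past) := by
          simp_rw [hinner]
          rw [lintegral_const_mul _ (Measurable.lintegral_prod_left' hG)]
      _ = η (rightEnv ⁻¹' S) * ∫⁻ q, Φ (q.1 ⟨0, h0⟩) q.2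
            ∂((η.map rightEnv).prod (ν.map past)) := by
          rw [lintegral_prod_symm' _ hG]
      _ = η (rightEnv ⁻¹' S) * ∫⁻ a, Φ (rightEnv a.1 ⟨0, h0⟩) (past a) ∂ν := by
          rw [← h.map_prod, lintegral_map hG (hm1.prodMk measurable_past)]
      _ = η (rightEnv ⁻¹' S) * (ν.bind (crossKernel M)) (past ⁻¹' T) := by
          rw [Measure.bind_apply (measurable_past hT) (crossKernel M).measurable.aemeasurable,
            lintegral_congr_ae hΦ']

end inherited

end

/-! ### Uniform overshoot tails for the chain, and Cesàro averages -/

section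

variable {η : Measure Env} {M : ℕ} {μ : ProbabilityMeasure ℤ}

lemma measurable_overshoot_aug (m : ℤ) (K : ℕ) :
    Measurable fun a : AugState => overshoot M a.1 m K (a.2.1, (a.2.2 : ℤ)) := by
  refine Measurable.add ?_ ?_
  · exact (Measurable.of_discrete (f := fun n : ℕ =>
      {x : ℤ | m + K ≤ x}.indicator (1 : ℤ → ℝ≥0∞) (n : ℤ))).comp
      (measurable_snd.comp measurable_snd)
  · refine Measurable.tsum fun y => ?_
    have h : Measurable fun q : Env × ℕ => ∑ j ∈ Finset.Ico q.2 M, jump q.1 m K y j :=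
      measurable_from_prod_countable_left fun n =>
        Finset.measurable_sum (Finset.Ico n M) fun j _ => measurable_jump m K y j
    exact h.comp (by fun_prop : Measurable fun a : AugState => (a.1, a.2.1 y))

/-- The shift turns level `m + 1` into level `m`. The cap at `M` does no harm because the potential
sums only over cookies with number below `M`. -/
lemma overshoot_land (ω : Env) (m : ℤ) (K : ℕ) {p : (ℤ → ℕ) × ℤ} (hp : 1 ≤ p.2) :
    overshoot M (land M ω p).1 m K ((land M ω p).2.1, ((land M ω p).2.2 : ℤ)) =
      overshoot M ω (m + 1) K p := by
  unfold overshoot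
  congr 1
  · have : (m + K ≤ ((land M ω p).2.2 : ℤ)) = (m + 1 + K ≤ p.2) := by
      simp only [land]
      rw [eq_iff_iff]
      omega
    simp only [Set.indicator_apply, Set.mem_ofPred_eq, this]
    rfl
  · unfold pot
    rw [← (Equiv.addRight (1 : ℤ)).tsum_eq fun y =>
      ∑ j ∈ Finset.Ico (p.1 y) M, jump ω (m + 1) K y j]
    refine tsum_congr fun y => ?_
    simp only [land, Equiv.coe_addRight]
    have hIco : Finset.Ico (min M (p.1 (y + 1))) M = Finset.Ico (p.1 (y + 1)) M := by
      ext j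
      simp only [Finset.mem_Ico]
      omega
    rw [hIco]
    refine Finset.sum_congr rfl fun j _ => ?_
    have hset : {z : ℤ | m + K ≤ y + z} = {z | m + 1 + K ≤ y + 1 + z} := by
      ext z
      simp only [Set.mem_ofPred_eq]
      omega
    simp [jump, shift, hset]

lemma lintegral_overshoot_crossKernel_le {B : ℕ} (hB : ∀ᵐ z ∂(μ : Measure ℤ), z ≤ (B : ℤ)) {K : ℕ}
    (hK : B ≤ K) {m : ℤ} (hm : 0 ≤ m) {a : AugState} (ha : a.1 ∈ OmegaPlus M μ)
    (hhit : ∀ᵐ X ∂walk a.1 a.2.1 a.2.2, ∃ n, 1 ≤ X n) :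
    ∫⁻ b, overshoot M b.1 m K (b.2.1, (b.2.2 : ℤ)) ∂crossKernel M a ≤
      overshoot M a.1 (m + 1) K (a.2.1, (a.2.2 : ℤ)) := by
  rw [lintegral_crossKernel _ _ (measurable_overshoot_aug m K)]
  calc _ = ∫⁻ X, overshoot M a.1 (m + 1) K (cross a.2.1 X) ∂walk a.1 a.2.1 a.2.2 := by
        refine lintegral_congr_ae ?_
        filter_upwards [hhit] with X hX
        refine overshoot_land _ _ _ ?_
        have := (tau_spec (X := X) (n := 1) (by exact_mod_cast hX)).1
        exact_mod_cast this
    _ ≤ _ := by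
        rw [← iSup_crossInt hhit]
        exact iSup_le fun k => crossInt_overshoot_le ha hB hK (by omega) _ _ _

/-- Each crossing trades one unit of time for one unit of level, so level `m` at time `n` is
controlled by level `m + n` at time `0`, where no cookie has been used. -/
lemma lintegral_overshoot_chain_le {B : ℕ} (hB : ∀ᵐ z ∂(μ : Measure ℤ), z ≤ (B : ℤ)) {K : ℕ}
    (hK : B ≤ K) (hη : ∀ᵐ ω ∂η, ω ∈ OmegaPlus M μ)
    (hhit : ∀ᵐ ω ∂η, ∀ l x, ∀ᵐ X ∂walk ω l x, ∃ n, 1 ≤ X n)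
    (hinh : ∀ n, Inherited η M (chain η M n)) (n : ℕ) {m : ℤ} (hm : 0 ≤ m) :
    ∫⁻ a, overshoot M a.1 m K (a.2.1, (a.2.2 : ℤ)) ∂chain η M n ≤
      ∫⁻ a, overshoot M a.1 (m + n) K (a.2.1, (a.2.2 : ℤ)) ∂chain η M 0 := by
  induction n generalizing m with
  | zero => simp
  | succ n ih =>
    conv_lhs => rw [chain, Measure.lintegral_bind (crossKernel M).measurable.aemeasurable
      (measurable_overshoot_aug m K).aemeasurable]
    calc _ ≤ ∫⁻ a, overshoot M a.1 (m + 1) K (a.2.1, (a.2.2 : ℤ)) ∂chain η M n := by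
          refine lintegral_mono_ae ?_
          filter_upwards [(hinh n).ae_fst hη, (hinh n).ae_fst hhit] with a h1 h2
          exact lintegral_overshoot_crossKernel_le hB hK hm h1 (h2 _ _)
      _ ≤ _ := by
          refine (ih (by omega)).trans (le_of_eq ?_)
          push_cast
          simp_rw [add_assoc, add_comm (1 : ℤ)]

lemma chain_overshoot_le {B : ℕ} (hB : ∀ᵐ z ∂(μ : Measure ℤ), z ≤ (B : ℤ)) {K : ℕ}
    (hK : B < K) (hη : ∀ᵐ ω ∂η, ω ∈ OmegaPlus M μ)
    (hhit : ∀ᵐ ω ∂η, ∀ l x, ∀ᵐ X ∂walk ω l x, ∃ n, 1 ≤ X n)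
    (hinh : ∀ n, Inherited η M (chain η M n))
    (h_ident : ∀ x : ℤ, IdentDistrib (fun ω : Env => ω x) (fun ω : Env => ω 0) η η) (n : ℕ) :
    chain η M n {a | K ≤ a.2.2} ≤ tailSum η M K := by
  have hm : MeasurableSet {a : AugState | K ≤ a.2.2} :=
    (measurable_snd.comp measurable_snd) (MeasurableSet.of_discrete (s := {n : ℕ | K ≤ n}))
  have hm0 : Measurable fun ω : Env => ((ω, 0, 0) : AugState) :=
    measurable_id.prodMk measurable_const
  calc _ ≤ ∫⁻ a, overshoot M a.1 0 K (a.2.1, (a.2.2 : ℤ)) ∂chain η M n := by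
        rw [← lintegral_indicator_one hm]
        refine lintegral_mono fun a => ?_
        by_cases ha : K ≤ a.2.2
        · rw [Set.indicator_of_mem (by exact ha)]
          refine le_trans ?_ le_self_add
          rw [Set.indicator_of_mem]
          · simp
          · simpa using ha
        · rw [Set.indicator_of_notMem (by exact ha)]
          exact zero_le
    _ ≤ ∫⁻ a, overshoot M a.1 (0 + n) K (a.2.1, (a.2.2 : ℤ)) ∂chain η M 0 :=
        lintegral_overshoot_chain_le hB hK.le hη hhit hinh n le_rfl
    _ = ∫⁻ ω, pot M (jump ω n K) 0 ∂η := by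
        rw [chain, lintegral_map (measurable_overshoot_aug _ K) hm0]
        refine lintegral_congr fun ω => ?_
        unfold overshoot
        -- `B < K` gives `K ≥ 1`, so the starting point `0` is below `n + K` even for `n = 0`.
        rw [Set.indicator_of_notMem]
        · simp
        · simp only [Set.mem_ofPred_eq]
          omega
    _ ≤ _ := lintegral_pot_jump_le h_ident n K

/-- The Cesàro averages of the laws of the augmented chain. -/
def avg (η : Measure Env) (M n : ℕ) : Measure AugState :=
  ((n + 1 : ℕ) : ℝ≥0∞)⁻¹ • ∑ k ∈ Finset.range (n + 1), chain η M k

lemma avg_apply (n : ℕ) (S : Set AugState) : avg η M n S =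
    ((n + 1 : ℕ) : ℝ≥0∞)⁻¹ * ∑ k ∈ Finset.range (n + 1), chain η M k S := by
  simp [avg]

lemma lintegral_avg (n : ℕ) (f : AugState → ℝ≥0∞) : ∫⁻ a, f a ∂avg η M n =
    ((n + 1 : ℕ) : ℝ≥0∞)⁻¹ * ∑ k ∈ Finset.range (n + 1), ∫⁻ a, f a ∂chain η M k := by
  rw [avg, lintegral_smul_measure, lintegral_finsetSum_measure, smul_eq_mul]

lemma inv_mul_sum_const (n : ℕ) (c : ℝ≥0∞) :
    ((n + 1 : ℕ) : ℝ≥0∞)⁻¹ * ∑ _k ∈ Finset.range (n + 1), c = c := by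
  rw [Finset.sum_const, Finset.card_range, nsmul_eq_mul, ← mul_assoc,
    ENNReal.inv_mul_cancel (by simp) (by simp), one_mul]

lemma avg_apply_eq {n : ℕ} {S : Set AugState} {c : ℝ≥0∞} (h : ∀ k, chain η M k S = c) :
    avg η M n S = c := by
  simp_rw [avg_apply, h]
  exact inv_mul_sum_const n c

lemma avg_apply_le {n : ℕ} {S : Set AugState} {c : ℝ≥0∞} (h : ∀ k, chain η M k S ≤ c) :
    avg η M n S ≤ c := by
  rw [avg_apply]
  refine le_trans ?_ (inv_mul_sum_const n c).le
  gcongr with k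
  exact h k

lemma Inherited.avg (hinh : ∀ n, Inherited η M (chain η M n)) (n : ℕ) :
    Inherited η M (avg η M n) := by
  refine ⟨⟨avg_apply_eq fun k => (hinh k).prob.measure_univ⟩,
    fun S hS => avg_apply_eq fun k => (hinh k).fst S hS, avg_apply_eq fun k => (hinh k).cap,
    avg_apply_eq fun k => (hinh k).right, fun S T hS hT => ?_⟩
  simp_rw [avg_apply, fun k => (hinh k).indep S T hS hT]
  rw [← Finset.mul_sum]
  ring

/-- One application of the kernel moves the window of the average by one, so only a boundary term of
size `C / (n + 1)` is gained. -/
lemma lintegral_avg_bind_le {f : AugState → ℝ≥0∞} (hf : Measurable f) {C : ℝ≥0∞}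
    (hC : ∀ a, f a ≤ C) (hinh : ∀ n, Inherited η M (chain η M n)) (n : ℕ) :
    ∫⁻ a, ∫⁻ b, f b ∂crossKernel M a ∂avg η M n ≤
      ∫⁻ a, f a ∂avg η M n + C * ((n + 1 : ℕ) : ℝ≥0∞)⁻¹ := by
  have h1 : ∀ k, ∫⁻ a, ∫⁻ b, f b ∂crossKernel M a ∂chain η M k = ∫⁻ a, f a ∂chain η M (k + 1) := by
    intro k
    rw [chain, Measure.lintegral_bind (crossKernel M).measurable.aemeasurable hf.aemeasurable]
  rw [lintegral_avg, lintegral_avg]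
  simp_rw [h1]
  rw [mul_comm C, ← mul_add]
  refine mul_le_mul_right ?_ _
  have hCn : ∫⁻ a, f a ∂chain η M (n + 1) ≤ C := by
    have := (hinh (n + 1)).prob
    calc _ ≤ ∫⁻ _, C ∂chain η M (n + 1) := lintegral_mono hC
      _ = C := by simp
  calc _ ≤ ∑ k ∈ Finset.range (n + 2), ∫⁻ a, f a ∂chain η M k := by
        rw [Finset.sum_range_succ' _ (n + 1)]
        exact le_self_add
    _ ≤ _ := by
        rw [Finset.sum_range_succ]
        gcongr

end

section

/-! ### Environments as arrays of numbers -/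

/-- The weights of a probability measure on `ℤ`. -/
def weights (ν : ProbabilityMeasure ℤ) : ℤ → ℝ≥0 := fun z => ν {z}

open Classical in
/-- The probability measure with the given weights; `dirac 0` if the weights do not sum to one. -/
def weightMeasure (s : ℤ → ℝ≥0) : Measure ℤ :=
  if ∑' z, (s z : ℝ≥0∞) = 1 then Measure.sum fun z => (s z : ℝ≥0∞) • Measure.dirac z
  else Measure.dirac 0

instance (s : ℤ → ℝ≥0) : IsProbabilityMeasure (weightMeasure s) := by
  unfold weightMeasure
  split_ifs with h
  · exact ⟨by simpa using h⟩
  · infer_instance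

/-- `weightMeasure` as a probability measure. -/
def ofWeights (s : ℤ → ℝ≥0) : ProbabilityMeasure ℤ := ⟨weightMeasure s, inferInstance⟩

lemma ofWeights_weights (ν : ProbabilityMeasure ℤ) : ofWeights (weights ν) = ν := by
  have hw : ∀ z, (weights ν z : ℝ≥0∞) = (ν : Measure ℤ) {z} := fun z => by simp [weights]
  have h : ∑' z, (weights ν z : ℝ≥0∞) = 1 := by
    simp_rw [hw]
    have := Measure.tsum_indicator_apply_singleton (ν : Measure ℤ) Set.univ MeasurableSet.univ
    simpa using this
  refine Subtype.ext ?_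
  change weightMeasure (weights ν) = ν
  rw [weightMeasure, if_pos h]
  simp_rw [hw]
  exact Measure.sum_smul_dirac (ν : Measure ℤ)

lemma measurable_weights : Measurable weights := by
  refine measurable_pi_lambda _ fun z => ?_
  exact ((Measure.measurable_coe (measurableSet_singleton z)).comp
    measurable_subtype_coe).ennreal_toNNReal

lemma measurable_ofWeights : Measurable ofWeights := by
  refine Measurable.subtype_mk (p := fun ν : Measure ℤ => IsProbabilityMeasure ν)
    (f := weightMeasure) (h := fun s => inferInstance) ?_
  have hset : MeasurableSet {s : ℤ → ℝ≥0 | ∑' z, (s z : ℝ≥0∞) = 1} :=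
    measurableSet_eq_fun (Measurable.tsum fun z => by fun_prop) measurable_const
  have : weightMeasure = {s : ℤ → ℝ≥0 | ∑' z, (s z : ℝ≥0∞) = 1}.piecewise
      (fun s => Measure.sum fun z => (s z : ℝ≥0∞) • Measure.dirac z) fun _ => Measure.dirac 0 := by
    funext s
    by_cases h : ∑' z, (s z : ℝ≥0∞) = 1
    · rw [Set.piecewise_eq_of_mem _ _ _ (by exact h), weightMeasure, if_pos h]
    · rw [Set.piecewise_eq_of_notMem _ _ _ (by exact h), weightMeasure, if_neg h]
  rw [this]
  refine Measurable.piecewise hset ?_ measurable_const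
  refine Measure.measurable_of_measurable_coe _ fun A hA => ?_
  simp only [Measure.sum_apply _ hA, Measure.smul_apply, smul_eq_mul]
  exact Measurable.tsum fun z => by fun_prop

section fields

variable {I : Type*}

/-- The array of weights of a field of probability measures. -/
def embed (ω : I → ℕ → ProbabilityMeasure ℤ) : I → ℕ → ℤ → ℝ≥0 := fun x j => weights (ω x j)

/-- The field of probability measures with the given array of weights. -/
def unembed (t : I → ℕ → ℤ → ℝ≥0) : I → ℕ → ProbabilityMeasure ℤ := fun x j => ofWeights (t x j)

@[simp] lemma unembed_embed (ω : I → ℕ → ProbabilityMeasure ℤ) : unembed (embed ω) = ω := by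
  funext x j
  exact ofWeights_weights _

lemma measurable_embed : Measurable (embed : (I → ℕ → ProbabilityMeasure ℤ) → _) := by
  refine measurable_pi_lambda _ fun x => measurable_pi_lambda _ fun j => ?_
  exact measurable_weights.comp ((measurable_pi_apply j).comp (measurable_pi_apply x))

lemma measurable_unembed : Measurable (unembed : (I → ℕ → ℤ → ℝ≥0) → _) := by
  refine measurable_pi_lambda _ fun x => measurable_pi_lambda _ fun j => ?_
  exact measurable_ofWeights.comp ((measurable_pi_apply j).comp (measurable_pi_apply x))

end fields

/-- Arrays of weights for all sites. -/
abbrev NumEnv : Type := ℤ → ℕ → ℤ → ℝ≥0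

/-- The augmented states, with the environment as an array of weights. -/
abbrev NumState : Type := NumEnv × (ℤ → ℕ) × ℕ

/-- The embedding of the augmented states. -/
def toNum (a : AugState) : NumState := (embed a.1, a.2)

/-- A left inverse of `toNum`. -/
def ofNum (b : NumState) : AugState := (unembed b.1, b.2)

@[simp] lemma ofNum_toNum (a : AugState) : ofNum (toNum a) = a := by
  simp [ofNum, toNum]

lemma measurable_toNum : Measurable toNum :=
  (measurable_embed.comp measurable_fst).prodMk measurable_snd

lemma measurable_ofNum : Measurable ofNum :=
  (measurable_unembed.comp measurable_fst).prodMk measurable_snd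

/-! ### Continuity of the crossing kernel -/

/-- The analogue of `crossInt` for arrays of weights. -/
def numInt (M : ℕ) (F : NumState → ℝ≥0) : ℕ → NumEnv → (ℤ → ℕ) → ℤ → ℝ≥0
  | 0, t, l, x =>
      if 1 ≤ x then F (fun y => t (y + 1), fun y => min M (l (y + 1)), (x - 1).toNat) else 0
  | k + 1, t, l, x =>
      if 1 ≤ x then F (fun y => t (y + 1), fun y => min M (l (y + 1)), (x - 1).toNat)
      else ∑ z ∈ Finset.Icc (-(k : ℤ)) k, t x (l x) z * numInt M F k t (l + Pi.single x 1) (x + z)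

/-- Finite sums of products of coordinates. The choice of the entry `t x (l x)` is continuous
because `l x` takes values in a discrete space. -/
lemma continuous_numInt (M : ℕ) {F : NumState → ℝ≥0} (hF : Continuous F) (k : ℕ) (x : ℤ) :
    Continuous fun q : NumEnv × (ℤ → ℕ) => numInt M F k q.1 q.2 x := by
  have h1 : ∀ x : ℤ, Continuous fun q : NumEnv × (ℤ → ℕ) =>
      F (fun y => q.1 (y + 1), fun y => min M (q.2 (y + 1)), (x - 1).toNat) := by
    intro x
    refine hF.comp ?_
    refine Continuous.prodMk (by fun_prop) (Continuous.prodMk ?_ continuous_const)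
    refine continuous_pi fun y => ?_
    exact continuous_const.min ((continuous_apply (y + 1)).comp continuous_snd)
  induction k generalizing x with
  | zero =>
    unfold numInt
    split_ifs
    · exact h1 x
    · exact continuous_const
  | succ k ih =>
    unfold numInt
    split_ifs
    · exact h1 x
    · refine continuous_finsetSum _ fun z _ => Continuous.mul ?_ ?_
      · have h2 : Continuous fun p : (ℕ → ℤ → ℝ≥0) × ℕ => p.1 p.2 z :=
          continuous_prod_of_discrete_right.2 fun n => by fun_prop
        exact h2.comp (by fun_prop : Continuous fun q : NumEnv × (ℤ → ℕ) => (q.1 x, q.2 x))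
      · have h3 : Continuous fun q : NumEnv × (ℤ → ℕ) => (q.1, q.2 + Pi.single x 1) := by
          refine continuous_fst.prodMk (continuous_pi fun y => ?_)
          simp only [Pi.add_apply]
          exact ((continuous_apply y).comp continuous_snd).add continuous_const
        exact (ih (x + z)).comp h3

lemma continuous_numInt' (M : ℕ) {F : NumState → ℝ≥0} (hF : Continuous F) (k : ℕ) :
    Continuous fun b : NumState => numInt M F k b.1 b.2.1 (b.2.2 : ℤ) := by
  have h : Continuous fun p : (NumEnv × (ℤ → ℕ)) × ℕ => numInt M F k p.1.1 p.1.2 (p.2 : ℤ) :=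
    continuous_prod_of_discrete_right.2 fun n => continuous_numInt M hF k n
  exact h.comp (by fun_prop : Continuous fun b : NumState => ((b.1, b.2.1), b.2.2))

lemma crossInt_eq_numInt (M : ℕ) {F : NumState → ℝ≥0} (hF : Measurable F) (ω : Env) (k : ℕ)
    (l : ℤ → ℕ) (x : ℤ) :
    crossInt ω (fun p => (F (toNum (land M ω p)) : ℝ≥0∞)) k l x =
      (numInt M F k (embed ω) l x : ℝ≥0∞) := by
  have hm : Measurable fun p : (ℤ → ℕ) × ℤ => (F (toNum (land M ω p)) : ℝ≥0∞) :=
    (hF.comp (measurable_toNum.comp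
      ((measurable_uncurry_land M).comp measurable_prodMk_left))).coe_nnreal_ennreal
  induction k generalizing l x with
  | zero =>
    rcases le_or_gt 1 x with hx | hx
    · rw [crossInt_of_le hx, numInt, if_pos hx]
      rfl
    · rw [crossInt_zero hx, numInt, if_neg (not_le.2 hx)]
      rfl
  | succ k ih =>
    rcases le_or_gt 1 x with hx | hx
    · rw [crossInt_of_le hx, numInt, if_pos hx]
      rfl
    · rw [crossInt_succ hm hx, numInt, if_neg (not_le.2 hx), lintegral_countable',
        tsum_eq_sum (s := Finset.Icc (-(k : ℤ)) k)]
      · push_cast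
        refine Finset.sum_congr rfl fun z hz => ?_
        have hz' : |z| ≤ k := abs_le.2 (Finset.mem_Icc.1 hz)
        rw [if_pos hz', ih, mul_comm]
        congr 1
        simp [embed, weights]
      · intro z hz
        have hz' : ¬ |z| ≤ k := fun h => hz (Finset.mem_Icc.2 (abs_le.1 h))
        rw [if_neg hz', zero_mul]

/-! ### The limit -/

variable {η : Measure Env} {M : ℕ} {μ : ProbabilityMeasure ℤ}

/-- Only `t x j z ≤ 1` is required, not that the weights sum to one, so compactness is Tychonoff's
theorem; escape of mass is excluded afterwards by `map_fst_limit`. The cap at `M` makes the counts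
compact. -/
lemma isCompact_boundedStates (M K : ℕ) :
    IsCompact {b : NumState | (∀ x j z, b.1 x j z ≤ 1) ∧ (∀ y, b.2.1 y ≤ M) ∧ b.2.2 ≤ K} := by
  have h1 : IsCompact {t : NumEnv | ∀ x j z, t x j z ≤ 1} := by
    have := isCompact_univ_pi fun _ : ℤ => isCompact_univ_pi fun _ : ℕ =>
      isCompact_univ_pi fun _ : ℤ => (isCompact_Icc : IsCompact (Set.Icc (0 : ℝ≥0) 1))
    convert this using 1
    ext t
    simp only [Set.mem_pi, Set.mem_univ, true_imp_iff, Set.mem_Icc, zero_le, true_and,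
      Set.mem_ofPred_eq]
  have h2 : IsCompact {l : ℤ → ℕ | ∀ y, l y ≤ M} := by
    have := isCompact_univ_pi fun _ : ℤ => (Set.finite_Iic M).isCompact
    convert this using 1
    ext t
    simp only [Set.mem_pi, Set.mem_univ, true_imp_iff, Set.mem_Iic, Set.mem_ofPred_eq]
  have h3 : IsCompact {n : ℕ | n ≤ K} := (Set.finite_Iic K).isCompact
  exact h1.prod (h2.prod h3)

lemma weights_le_one (ν : ProbabilityMeasure ℤ) (z : ℤ) : weights ν z ≤ 1 :=
  ν.apply_le_one _

/-- Prokhorov's theorem; the limit is taken along an ultrafilter finer than `atTop`, which replaces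
a subsequence. -/
lemma exists_limit {Q : ℕ → ProbabilityMeasure AugState}
    (hcap : ∀ n, ∀ᵐ a ∂(Q n : Measure AugState), ∀ y, a.2.1 y ≤ M)
    {u : ℕ → ℝ≥0∞} (hu : Tendsto u atTop (𝓝 0)) {K₀ : ℕ}
    (htail : ∀ n, ∀ K > K₀, (Q n : Measure AugState) {a | K ≤ a.2.2} ≤ u K) :
    ∃ q : ProbabilityMeasure NumState, ∃ f : Filter ℕ, f.NeBot ∧ f ≤ atTop ∧
      Tendsto (fun n => (Q n).map measurable_toNum.aemeasurable) f (𝓝 q) := by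
  let S : Set (ProbabilityMeasure NumState) :=
    Set.range fun n => (Q n).map measurable_toNum.aemeasurable
  have htight : IsTightMeasureSet
      {((μ : ProbabilityMeasure NumState) : Measure NumState) | μ ∈ S} := by
    rw [isTightMeasureSet_iff_exists_isCompact_measure_compl_le]
    intro ε hε
    obtain ⟨K, hK1, hK2⟩ := ((hu.eventually_le_const hε).and (eventually_gt_atTop K₀)).exists
    refine ⟨_, isCompact_boundedStates M K, ?_⟩
    rintro _ ⟨_, ⟨n, rfl⟩, rfl⟩
    rw [ProbabilityMeasure.toMeasure_map,
      Measure.map_apply measurable_toNum (isCompact_boundedStates M K).measurableSet.compl]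
    refine le_trans (measure_mono_ae ?_) ((htail n K hK2).trans hK1)
    filter_upwards [hcap n] with a ha hb
    by_contra hK
    refine hb ⟨fun x j z => weights_le_one _ _, ha, ?_⟩
    exact (not_le.1 hK).le
  have hcomp := isCompact_closure_of_isTightMeasureSet htight
  obtain ⟨q, -, hq⟩ := hcomp.ultrafilter_le_nhds'
    ((hyperfilter ℕ).map fun n => (Q n).map measurable_toNum.aemeasurable)
    (Filter.mem_of_superset (Filter.mem_map.2 (Filter.univ_mem' fun n =>
      Set.mem_range_self n)) subset_closure)
  exact ⟨q, hyperfilter ℕ, inferInstance, Nat.hyperfilter_le_atTop, hq⟩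

end

/-! ### Passage to the limit: inherited properties and invariance -/

section

variable {η : Measure Env} {M : ℕ} {Q : ℕ → ProbabilityMeasure AugState}
  {q : ProbabilityMeasure NumState} {f : Filter ℕ}

lemma tendsto_lintegral_toNum
    (hlim : Tendsto (fun n => (Q n).map measurable_toNum.aemeasurable) f (𝓝 q))
    (F : NumState →ᵇ ℝ≥0) :
    Tendsto (fun n => ∫⁻ a, F (toNum a) ∂(Q n : Measure AugState)) f
      (𝓝 (∫⁻ b, F b ∂(q : Measure NumState))) := by
  have := ProbabilityMeasure.tendsto_iff_forall_lintegral_tendsto.1 hlim F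
  refine this.congr fun n => ?_
  rw [ProbabilityMeasure.toMeasure_map,
    lintegral_map F.continuous.measurable.coe_nnreal_ennreal measurable_toNum]

lemma tendsto_integral_toNum
    (hlim : Tendsto (fun n => (Q n).map measurable_toNum.aemeasurable) f (𝓝 q))
    (F : NumState →ᵇ ℝ) :
    Tendsto (fun n => ∫ a, F (toNum a) ∂(Q n : Measure AugState)) f
      (𝓝 (∫ b, F b ∂(q : Measure NumState))) := by
  have := ProbabilityMeasure.tendsto_iff_forall_integral_tendsto.1 hlim F
  refine this.congr fun n => ?_
  rw [ProbabilityMeasure.toMeasure_map,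
    integral_map measurable_toNum.aemeasurable F.continuous.aestronglyMeasurable]

section

variable [f.NeBot]

lemma map_fst_limit
    (hlim : Tendsto (fun n => (Q n).map measurable_toNum.aemeasurable) f (𝓝 q))
    (hinh : ∀ n, Inherited η M (Q n : Measure AugState)) :
    (q : Measure NumState).map Prod.fst = η.map embed := by
  refine ext_of_forall_lintegral_eq_of_IsFiniteMeasure fun F => ?_
  rw [lintegral_map F.continuous.measurable.coe_nnreal_ennreal measurable_fst,
    lintegral_map F.continuous.measurable.coe_nnreal_ennreal measurable_embed]
  have h := tendsto_lintegral_toNum hlim (F.compContinuous ⟨Prod.fst, continuous_fst⟩)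
  have hc : ∀ n, ∫⁻ a, F (embed a.1) ∂(Q n : Measure AugState) = ∫⁻ ω, F (embed ω) ∂η := by
    intro n
    rw [← (hinh n).map_fst, lintegral_map (f := fun ω => (F (embed ω) : ℝ≥0∞))
      (F.continuous.measurable.coe_nnreal_ennreal.comp measurable_embed) measurable_fst]
  exact tendsto_nhds_unique h (tendsto_const_nhds.congr fun n => (hc n).symm)

/-- The environment marginal of the limit is the image of `η` under `embed`, so almost every array
in the limit consists of genuine probability weights. -/
lemma ae_toNum_ofNum_limit
    (hlim : Tendsto (fun n => (Q n).map measurable_toNum.aemeasurable) f (𝓝 q))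
    (hinh : ∀ n, Inherited η M (Q n : Measure AugState)) :
    ∀ᵐ b ∂(q : Measure NumState), toNum (ofNum b) = b := by
  have h1 : ∀ᵐ t ∂(q : Measure NumState).map Prod.fst, embed (unembed t) = t := by
    rw [map_fst_limit hlim hinh]
    refine (ae_map_iff measurable_embed.aemeasurable
      (measurableSet_eq_fun (measurable_embed.comp measurable_unembed) measurable_id)).2 ?_
    exact ae_of_all _ fun ω => by simp
  filter_upwards [ae_of_ae_map measurable_fst.aemeasurable h1] with b hb
  exact Prod.ext hb rfl

lemma lintegral_toNum_limit
    (hlim : Tendsto (fun n => (Q n).map measurable_toNum.aemeasurable) f (𝓝 q))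
    (hinh : ∀ n, Inherited η M (Q n : Measure AugState))
    (F : NumState → ℝ≥0∞) (hF : Measurable F) :
    ∫⁻ a, F (toNum a) ∂(q : Measure NumState).map ofNum = ∫⁻ b, F b ∂(q : Measure NumState) := by
  rw [lintegral_map (f := fun a => F (toNum a)) (hF.comp measurable_toNum) measurable_ofNum]
  refine lintegral_congr_ae ?_
  filter_upwards [ae_toNum_ofNum_limit hlim hinh] with b hb
  rw [hb]

/-- A clopen set has empty boundary, so its probabilities converge. It is applied to conditions on a
single count `l y`, which is integer-valued. -/
lemma ae_limit_of_isClopen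
    (hlim : Tendsto (fun n => (Q n).map measurable_toNum.aemeasurable) f (𝓝 q))
    {E : Set NumState} (hE : IsClopen E)
    (h : ∀ n, ∀ᵐ a ∂(Q n : Measure AugState), toNum a ∈ E) :
    ∀ᵐ b ∂(q : Measure NumState), b ∈ E := by
  have h1 := ProbabilityMeasure.tendsto_measure_of_isClopen_of_tendsto hlim hE
  have h2 : ∀ n, (Q n).map measurable_toNum.aemeasurable E = 1 := by
    intro n
    have : ((Q n).map measurable_toNum.aemeasurable : Measure NumState) E = 1 := by
      refine (mem_ae_iff_prob_eq_one hE.isOpen.measurableSet).1 ?_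
      rw [ProbabilityMeasure.toMeasure_map]
      exact (ae_map_iff measurable_toNum.aemeasurable hE.isOpen.measurableSet).2 (h n)
    rw [← ENNReal.coe_inj, ProbabilityMeasure.ennreal_coeFn_eq_coeFn_toMeasure, this]
    rfl
  have h3 : q E = 1 := tendsto_nhds_unique h1 (tendsto_const_nhds.congr fun n => (h2 n).symm)
  refine (mem_ae_iff_prob_eq_one hE.isOpen.measurableSet).2 ?_
  rw [← ENNReal.coe_one, ← h3]
  exact (ProbabilityMeasure.ennreal_coeFn_eq_coeFn_toMeasure _ _).symm

/-- Independence is the factorization of expectations of bounded continuous functions of the two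
parts, and this passes to weak limits. -/
lemma indepFun_limit [IsProbabilityMeasure η]
    (hlim : Tendsto (fun n => (Q n).map measurable_toNum.aemeasurable) f (𝓝 q))
    (hinh : ∀ n, Inherited η M (Q n : Measure AugState)) :
    IndepFun (fun (b : NumState) (x : Set.Ici (0 : ℤ)) => b.1 x)
      (fun b : NumState => ((fun x : Set.Iio (0 : ℤ) => b.1 x), b.2)) (q : Measure NumState) := by
  have hc1 : Continuous fun (b : NumState) (x : Set.Ici (0 : ℤ)) => b.1 x := by fun_prop
  have hc2 : Continuous fun b : NumState => ((fun x : Set.Iio (0 : ℤ) => b.1 x), b.2) := by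
    fun_prop
  refine indepFun_of_bcf hc1.measurable.aemeasurable hc2.measurable.aemeasurable fun F G => ?_
  have t1 := tendsto_integral_toNum hlim (F.compContinuous ⟨_, hc1⟩)
  have t2 := tendsto_integral_toNum hlim (G.compContinuous ⟨_, hc2⟩)
  have t3 := tendsto_integral_toNum hlim (F.compContinuous ⟨_, hc1⟩ * G.compContinuous ⟨_, hc2⟩)
  refine tendsto_nhds_unique t3 ((t1.mul t2).congr fun n => ?_)
  have hind : IndepFun (fun a : AugState => rightEnv a.1) past (Q n : Measure AugState) := by
    rw [indepFun_iff_measure_inter_preimage_eq_mul]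
    intro S T hS hT
    rw [(hinh n).indep S T hS hT]
    congr 1
    exact ((hinh n).fst _ (measurable_rightEnv hS)).symm
  have hF : Measurable fun r : RightEnv => F (embed r) :=
    F.continuous.measurable.comp measurable_embed
  have hG : Measurable fun p : Past => G (embed p.1, p.2) :=
    G.continuous.measurable.comp ((measurable_embed.comp measurable_fst).prodMk measurable_snd)
  have := hind.integral_comp_mul_comp (f := fun r : RightEnv => F (embed r))
    (g := fun p : Past => G (embed p.1, p.2))
    (measurable_rightEnv.comp measurable_fst).aemeasurable measurable_past.aemeasurable
    hF.aestronglyMeasurable hG.aestronglyMeasurable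
  exact this.symm

lemma inherited_limit [IsProbabilityMeasure η]
    (hlim : Tendsto (fun n => (Q n).map measurable_toNum.aemeasurable) f (𝓝 q))
    (hinh : ∀ n, Inherited η M (Q n : Measure AugState)) :
    Inherited η M ((q : Measure NumState).map ofNum) := by
  have hfst : ∀ S, MeasurableSet S →
      (q : Measure NumState).map ofNum (Prod.fst ⁻¹' S) = η S := by
    intro S hS
    rw [Measure.map_apply measurable_ofNum (measurable_fst hS)]
    change (q : Measure NumState) (Prod.fst ⁻¹' (unembed ⁻¹' S)) = _
    rw [← Measure.map_apply measurable_fst (measurable_unembed hS), map_fst_limit hlim hinh,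
      Measure.map_apply measurable_embed (measurable_unembed hS)]
    congr 1
    ext ω
    simp
  have hco : ∀ y, Continuous fun b : NumState => b.2.1 y := fun y => by fun_prop
  refine ⟨Measure.isProbabilityMeasure_map measurable_ofNum.aemeasurable, hfst, ?_, ?_,
    fun S T hS hT => ?_⟩
  · refine ae_all_iff.2 fun y => (ae_map_iff measurable_ofNum.aemeasurable
      (measurableSet_le (by fun_prop) measurable_const)).2 ?_
    exact ae_limit_of_isClopen hlim ((isClopen_discrete {n : ℕ | n ≤ M}).preimage (hco y))
      fun n => (hinh n).cap.mono fun a ha => ha y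
  · refine ae_all_iff.2 fun y => ?_
    by_cases hy : 0 ≤ y
    · have h0 : ∀ᵐ a ∂(q : Measure NumState).map ofNum, a.2.1 y = 0 := by
        refine (ae_map_iff measurable_ofNum.aemeasurable
          (measurableSet_eq_fun (by fun_prop) measurable_const)).2 ?_
        exact ae_limit_of_isClopen hlim ((isClopen_discrete {n : ℕ | n = 0}).preimage (hco y))
          fun n => (hinh n).right.mono fun a ha => ha y hy
      exact h0.mono fun a ha _ => ha
    · exact ae_of_all _ fun a h => absurd h hy
  · have hm1 : Measurable fun a : AugState => rightEnv a.1 :=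
      measurable_rightEnv.comp measurable_fst
    have hps : Measurable fun p : (Set.Iio (0 : ℤ) → ℕ → ℤ → ℝ≥0) × (ℤ → ℕ) × ℕ =>
        ((unembed p.1, p.2) : Past) :=
      (measurable_unembed.comp measurable_fst).prodMk measurable_snd
    have := (indepFun_limit hlim hinh).measure_inter_preimage_eq_mul _ _
      (measurable_unembed hS) (hps hT)
    rw [← hfst _ (measurable_rightEnv hS),
      Measure.map_apply measurable_ofNum ((hm1 hS).inter (measurable_past hT)),
      Measure.map_apply measurable_ofNum (measurable_past hT),
      Measure.map_apply measurable_ofNum (measurable_fst (measurable_rightEnv hS))]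
    exact this

end

/-- The truncated integrals over one crossing, as bounded continuous functions. -/
def numIntBCF (M : ℕ) (F : NumState →ᵇ ℝ≥0) (k : ℕ) (C : ℝ≥0) : NumState →ᵇ ℝ≥0 :=
  BoundedContinuousFunction.mkOfBound
    ⟨fun b => min (numInt M F k b.1 b.2.1 (b.2.2 : ℤ)) C,
      (continuous_numInt' M F.continuous k).min continuous_const⟩ C fun a b => by
    rw [NNReal.dist_eq, abs_le]
    have h1 : ((min (numInt M F k a.1 a.2.1 (a.2.2 : ℤ)) C : ℝ≥0) : ℝ) ≤ C := by
      exact_mod_cast min_le_right _ _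
    have h2 : ((min (numInt M F k b.1 b.2.1 (b.2.2 : ℤ)) C : ℝ≥0) : ℝ) ≤ C := by
      exact_mod_cast min_le_right _ _
    have h3 := (min (numInt M F k a.1 a.2.1 (a.2.2 : ℤ)) C).coe_nonneg
    have h4 := (min (numInt M F k b.1 b.2.1 (b.2.2 : ℤ)) C).coe_nonneg
    constructor <;> simp only [ContinuousMap.coe_mk] <;> linarith

lemma lintegral_crossKernel_toNum {a : AugState} {F : NumState → ℝ≥0} (hF : Measurable F)
    (hhit : ∀ᵐ X ∂walk a.1 a.2.1 a.2.2, ∃ n, 1 ≤ X n) :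
    ∫⁻ b, F (toNum b) ∂crossKernel M a =
      ⨆ k, (numInt M F k (toNum a).1 (toNum a).2.1 ((toNum a).2.2 : ℤ) : ℝ≥0∞) := by
  rw [lintegral_crossKernel (f := fun b => (F (toNum b) : ℝ≥0∞)) _ _
    (hF.comp measurable_toNum).coe_nnreal_ennreal]
  have := iSup_crossInt (f := fun p => (F (toNum (land M a.1 p)) : ℝ≥0∞)) hhit
  rw [← this]
  exact iSup_congr fun k => crossInt_eq_numInt M hF _ _ _ _

lemma monotone_numInt_toNum {F : NumState → ℝ≥0} (hF : Measurable F) (a : AugState) :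
    Monotone fun k => (numInt M F k (toNum a).1 (toNum a).2.1 ((toNum a).2.2 : ℤ) : ℝ≥0∞) := by
  intro k k' h
  simp only
  have := fun k => crossInt_eq_numInt M hF a.1 k a.2.1 (a.2.2 : ℤ)
  refine ((this k).symm.trans_le ?_).trans_eq (this k')
  exact lintegral_mono_set (monotone_crossSet h)

/-- For fixed `k` the truncated integral is a bounded continuous function, so it converges along
`f`; it is at most the full integral over a crossing, which is almost invariant under the averages.
The supremum over `k` is taken only in the limit law. -/
lemma lintegral_bind_limit_le [f.NeBot] [IsProbabilityMeasure η] (hf : f ≤ atTop)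
    (hlim : Tendsto (fun n => (Q n).map measurable_toNum.aemeasurable) f (𝓝 q))
    (hinh : ∀ n, Inherited η M (Q n : Measure AugState))
    (hstep : ∀ (g : AugState → ℝ≥0∞) (_ : Measurable g) (C : ℝ≥0∞) (_ : ∀ a, g a ≤ C) (n : ℕ),
      ∫⁻ a, ∫⁻ b, g b ∂crossKernel M a ∂(Q n : Measure AugState) ≤
        ∫⁻ a, g a ∂(Q n : Measure AugState) + C * ((n + 1 : ℕ) : ℝ≥0∞)⁻¹)
    (hhit : ∀ᵐ ω ∂η, ∀ l x, ∀ᵐ X ∂walk ω l x, ∃ n, 1 ≤ X n) (F : NumState →ᵇ ℝ≥0) :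
    ∫⁻ a, F (toNum a) ∂((q : Measure NumState).map ofNum).bind (crossKernel M) ≤
      ∫⁻ b, F b ∂(q : Measure NumState) := by
  have hFm : Measurable F := F.continuous.measurable
  have hFn : Measurable fun a => (F (toNum a) : ℝ≥0∞) :=
    (hFm.comp measurable_toNum).coe_nnreal_ennreal
  have hν := inherited_limit hlim hinh
  have hν' := hν.ae_fst hhit
  obtain ⟨C, hC⟩ : ∃ C : ℝ≥0, ∀ b, F b ≤ C :=
    ⟨nndist F 0, BoundedContinuousFunction.NNReal.upper_bound F⟩
  rw [Measure.lintegral_bind (crossKernel M).measurable.aemeasurable hFn.aemeasurable]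
  have hle : ∀ {a : AugState}, (∀ᵐ X ∂walk a.1 a.2.1 a.2.2, ∃ n, 1 ≤ X n) → ∀ k,
      numInt M F k (toNum a).1 (toNum a).2.1 ((toNum a).2.2 : ℤ) ≤ C := by
    intro a ha k
    have h1 : ∫⁻ b, F (toNum b) ∂crossKernel M a ≤ C :=
      calc _ ≤ ∫⁻ _, (C : ℝ≥0∞) ∂crossKernel M a :=
            lintegral_mono fun b => ENNReal.coe_le_coe.2 (hC _)
        _ = C := by simp
    rw [lintegral_crossKernel_toNum hFm ha] at h1
    exact ENNReal.coe_le_coe.1 ((le_iSup (fun k =>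
      (numInt M F k (toNum a).1 (toNum a).2.1 ((toNum a).2.2 : ℤ) : ℝ≥0∞)) k).trans h1)
  have hmk : ∀ k, Measurable fun a =>
      (numInt M F k (toNum a).1 (toNum a).2.1 ((toNum a).2.2 : ℤ) : ℝ≥0∞) := fun k =>
    ((continuous_numInt' M F.continuous k).measurable.comp measurable_toNum).coe_nnreal_ennreal
  rw [lintegral_congr_ae (hν'.mono fun a ha => lintegral_crossKernel_toNum hFm (ha _ _)),
    lintegral_iSup hmk fun k k' h a => monotone_numInt_toNum hFm a h]
  refine iSup_le fun k => ?_
  -- The minimum with `C` makes the function bounded on arrays that are not probability weights; on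
  -- states from which the walk crosses almost surely it changes nothing.
  have hG : ∀ {a : AugState}, (∀ᵐ X ∂walk a.1 a.2.1 a.2.2, ∃ n, 1 ≤ X n) →
      numIntBCF M F k C (toNum a) =
        numInt M F k (toNum a).1 (toNum a).2.1 ((toNum a).2.2 : ℤ) :=
    fun ha => min_eq_left (hle ha k)
  calc _ = ∫⁻ a, numIntBCF M F k C (toNum a) ∂(q : Measure NumState).map ofNum :=
        lintegral_congr_ae (hν'.mono fun a ha => by simp only; rw [hG (ha _ _)])
    _ = ∫⁻ b, numIntBCF M F k C b ∂(q : Measure NumState) :=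
        lintegral_toNum_limit hlim hinh (fun b => (numIntBCF M F k C b : ℝ≥0∞))
          (numIntBCF M F k C).continuous.measurable.coe_nnreal_ennreal
    _ ≤ _ := ?_
  have herr : Tendsto (fun n : ℕ => (C : ℝ≥0∞) * ((n + 1 : ℕ) : ℝ≥0∞)⁻¹) f (𝓝 0) := by
    have h1 : Tendsto (fun n : ℕ => ((n + 1 : ℕ) : ℝ≥0∞)⁻¹) atTop (𝓝 0) :=
      (tendsto_add_atTop_iff_nat 1).2 ENNReal.tendsto_inv_nat_nhds_zero
    have := ENNReal.Tendsto.const_mul (a := (C : ℝ≥0∞)) h1 (Or.inr ENNReal.coe_ne_top)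
    rw [mul_zero] at this
    exact this.mono_left hf
  have hr := (tendsto_lintegral_toNum hlim F).add herr
  rw [add_zero] at hr
  refine le_of_tendsto_of_tendsto' (tendsto_lintegral_toNum hlim (numIntBCF M F k C)) hr
    fun n => ?_
  refine le_trans ?_ (hstep _ hFn C (fun a => ENNReal.coe_le_coe.2 (hC _)) n)
  refine lintegral_mono_ae (((hinh n).ae_fst hhit).mono fun a ha => ?_)
  rw [lintegral_crossKernel_toNum hFm (ha _ _), hG (ha _ _)]
  exact le_iSup (fun k =>
      (numInt M F k (toNum a).1 (toNum a).2.1 ((toNum a).2.2 : ℤ) : ℝ≥0∞)) k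

/-- Both laws have total mass one, so the inequality for `C - F` is the reverse of the inequality
for `F`. -/
lemma bind_limit_eq [f.NeBot] [IsProbabilityMeasure η] (hf : f ≤ atTop)
    (hlim : Tendsto (fun n => (Q n).map measurable_toNum.aemeasurable) f (𝓝 q))
    (hinh : ∀ n, Inherited η M (Q n : Measure AugState))
    (hstep : ∀ (g : AugState → ℝ≥0∞) (_ : Measurable g) (C : ℝ≥0∞) (_ : ∀ a, g a ≤ C) (n : ℕ),
      ∫⁻ a, ∫⁻ b, g b ∂crossKernel M a ∂(Q n : Measure AugState) ≤
        ∫⁻ a, g a ∂(Q n : Measure AugState) + C * ((n + 1 : ℕ) : ℝ≥0∞)⁻¹)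
    (hhit : ∀ᵐ ω ∂η, ∀ l x, ∀ᵐ X ∂walk ω l x, ∃ n, 1 ≤ X n) :
    ((q : Measure NumState).map ofNum).bind (crossKernel M) = (q : Measure NumState).map ofNum := by
  have hle := lintegral_bind_limit_le hf hlim hinh hstep hhit
  set ρ := ((q : Measure NumState).map ofNum).bind (crossKernel M) with hρ
  have : IsProbabilityMeasure ((q : Measure NumState).map ofNum) :=
    Measure.isProbabilityMeasure_map measurable_ofNum.aemeasurable
  have : IsProbabilityMeasure ρ := by rw [hρ]; infer_instance
  have : IsProbabilityMeasure (ρ.map toNum) :=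
    Measure.isProbabilityMeasure_map measurable_toNum.aemeasurable
  have heq : ρ.map toNum = q := by
    refine ext_of_forall_lintegral_eq_of_IsFiniteMeasure fun F => ?_
    rw [lintegral_map F.continuous.measurable.coe_nnreal_ennreal measurable_toNum]
    refine le_antisymm (hle F) ?_
    let C := nndist F 0
    have hC : ∀ b, F b ≤ C := BoundedContinuousFunction.NNReal.upper_bound F
    have h1 := hle (BoundedContinuousFunction.const _ C - F)
    have hFt : ∀ (P : Measure NumState) [IsProbabilityMeasure P],
        ∫⁻ b, (BoundedContinuousFunction.const NumState C - F : NumState →ᵇ ℝ≥0) b ∂P =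
          C - ∫⁻ b, F b ∂P := by
      intro P _
      simp only [BoundedContinuousFunction.sub_apply, BoundedContinuousFunction.const_apply,
        ENNReal.coe_sub]
      rw [lintegral_sub F.continuous.measurable.coe_nnreal_ennreal
        (F.lintegral_lt_top_of_nnreal P).ne (ae_of_all _ fun b => ENNReal.coe_le_coe.2 (hC b))]
      simp
    have h2 := hFt (ρ.map toNum)
    rw [lintegral_map (BoundedContinuousFunction.continuous _).measurable.coe_nnreal_ennreal
        measurable_toNum,
      lintegral_map F.continuous.measurable.coe_nnreal_ennreal measurable_toNum] at h2
    rw [h2, hFt q] at h1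
    have hCq : ∫⁻ b, F b ∂(q : Measure NumState) ≤ C :=
      calc _ ≤ ∫⁻ _, (C : ℝ≥0∞) ∂(q : Measure NumState) :=
            lintegral_mono fun b => ENNReal.coe_le_coe.2 (hC b)
        _ = C := by simp
    exact (ENNReal.sub_le_sub_iff_left hCq ENNReal.coe_ne_top).1 h1
  rw [← heq, Measure.map_map measurable_ofNum measurable_toNum]
  have : ofNum ∘ toNum = id := funext fun a => ofNum_toNum a
  rw [this, Measure.map_id]

end

section

variable {η : Measure Env} {M : ℕ} {μ : ProbabilityMeasure ℤ}

/-! ### Recurrence to the right -/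

/-- A centred law without mass on the positive integers is concentrated at `0`. -/
lemma measure_Ioi_zero_pos (hfin : HasFiniteMean μ) (hzero : mean μ = 0)
    (hne : (μ : Measure ℤ) ≠ Measure.dirac 0) : 0 < (μ : Measure ℤ) (Set.Ioi (0 : ℤ)) := by
  refine pos_iff_ne_zero.2 fun h => hne ?_
  have h1 : ∀ᵐ z : ℤ ∂(μ : Measure ℤ), z ≤ 0 := by
    rw [ae_iff]
    simpa [Set.Ioi] using h
  have h2 : ∫ z : ℤ, -(z : ℝ) ∂(μ : Measure ℤ) = 0 := by
    rw [integral_neg]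
    exact neg_eq_zero.2 hzero
  have h3 : 0 ≤ᵐ[(μ : Measure ℤ)] fun z : ℤ => -(z : ℝ) := by
    filter_upwards [h1] with z hz
    simpa using hz
  have h4 := (integral_eq_zero_iff_of_nonneg_ae h3 (Integrable.neg hfin)).1 h2
  have h5 : id =ᵐ[(μ : Measure ℤ)] fun _ => (0 : ℤ) := by
    filter_upwards [h4] with z hz
    simpa using hz
  calc (μ : Measure ℤ) = (μ : Measure ℤ).map id := Measure.map_id.symm
    _ = (μ : Measure ℤ).map fun _ => (0 : ℤ) := Measure.map_congr h5
    _ = Measure.dirac 0 := by simp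

lemma limsupTop_of_forall_exists {X : ℕ → ℤ} (h : ∀ m, ∃ k, m ≤ X k) : LimsupTop X := by
  intro m
  rw [frequently_atTop]
  intro N
  obtain ⟨C, hC⟩ := ((Finset.range N).image X).bddAbove
  obtain ⟨k, hk⟩ := h (max m (C + 1))
  refine ⟨k, ?_, (le_max_left _ _).trans hk⟩
  by_contra hN
  have h1 : X k ≤ C := hC (by
    simp only [Finset.coe_image, Finset.coe_range]
    exact ⟨k, not_le.1 hN, rfl⟩)
  have h2 := (le_max_right m (C + 1)).trans hk
  omega

/-- The exceptional set of environments does not depend on `l` and `x`; therefore the statement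
applies to any law of augmented states whose environment marginal is `η`. -/
lemma ae_limsupTop (hη : ∀ᵐ ω ∂η, ω ∈ OmegaPlus M μ) (h_moment : tailSum η M 0 ≠ ∞)
    (h_ident : ∀ x : ℤ, IdentDistrib (fun ω : Env => ω x) (fun ω : Env => ω 0) η η)
    (hfin : HasFiniteMean μ) (hzero : mean μ = 0) (hne : (μ : Measure ℤ) ≠ Measure.dirac 0)
    {B : ℕ} (hB : ∀ᵐ z ∂(μ : Measure ℤ), z ≤ (B : ℤ)) :
    ∀ᵐ ω ∂η, ∀ l x, ∀ᵐ X ∂walk ω l x, LimsupTop X := by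
  filter_upwards [ae_good hη h_moment h_ident] with ω hω l x
  have h : ∀ m, ∀ᵐ X ∂walk ω l x, ∃ k, m ≤ X k := by
    intro m
    rw [ae_iff]
    simpa only [not_exists, not_le] using
      walk_stay_eq_zero hω hfin hzero (measure_Ioi_zero_pos hfin hzero hne) hB m l x
  filter_upwards [ae_all_iff.2 h] with X hX
  exact limsupTop_of_forall_exists hX

lemma LimsupTop.exists_le {X : ℕ → ℤ} (h : LimsupTop X) (m : ℤ) : ∃ n, m ≤ X n := (h m).exists

/-- The augmented chain has a stationary law with the properties of its marginals. -/
theorem exists_invariant_crossKernel [IsProbabilityMeasure η] (hη : ∀ᵐ ω ∂η, ω ∈ OmegaPlus M μ)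
    (h_moment : tailSum η M 0 ≠ ∞)
    (h_indep : iIndepFun (fun (x : ℤ) (ω : Env) => ω x) η)
    (h_ident : ∀ x : ℤ, IdentDistrib (fun ω : Env => ω x) (fun ω : Env => ω 0) η η)
    {B : ℕ} (hB : ∀ᵐ z ∂(μ : Measure ℤ), z ≤ (B : ℤ))
    (hhit : ∀ᵐ ω ∂η, ∀ l x, ∀ᵐ X ∂walk ω l x, ∃ n, 1 ≤ X n) :
    ∃ ν : Measure AugState, Inherited η M ν ∧ ν.bind (crossKernel M) = ν := by
  have hchain : ∀ n, Inherited η M (chain η M n) := by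
    intro n
    induction n with
    | zero => exact inherited_chain_zero h_indep
    | succ n ih => exact ih.bind h_indep (map_shift_eq h_indep h_ident) hhit
  have havg := fun n => Inherited.avg hchain n
  let Q : ℕ → ProbabilityMeasure AugState := fun n => ⟨avg η M n, (havg n).prob⟩
  obtain ⟨q, f, hf, hle, hlim⟩ := exists_limit (M := M) (Q := Q) (fun n => (havg n).cap)
    (tendsto_tailSum h_moment) (K₀ := B) fun n K hK =>
      avg_apply_le fun k => chain_overshoot_le hB hK hη hhit hchain h_ident k
  exact ⟨_, inherited_limit hlim havg, bind_limit_eq hle hlim havg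
    (fun g hg C hC n => lintegral_avg_bind_le hg hC hchain n) hhit⟩

/-! ### The cookie environment process -/

lemma measurable_uncurry_zeta (n : ℕ) :
    Measurable fun p : Env × (ℕ → ℤ) => zeta p.1 p.2 n := by
  refine Measurable.prodMk ?_ ?_
  · refine (measurable_shift.iterate n).comp ?_
    exact measurable_removeCookies.comp (measurable_fst.prodMk
      ((measurable_visits_tau n).comp measurable_snd))
  · exact (Measurable.of_discrete (f := fun z : ℤ => (z - n).toNat)).comp
      ((measurable_apply_tau n).comp measurable_snd)

lemma shift_removeCookies (ω : Env) (l : ℤ → ℕ) :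
    shift (removeCookies ω l) = removeCookies (shift ω) fun y => l (y + 1) := rfl

lemma zeta_add_one (ω : Env) (X : ℕ → ℤ) (n : ℕ) :
    zeta ω (fun i => X i + 1) (n + 1) = zeta (shift ω) X n := by
  have htau : tau (fun i => X i + 1) (n + 1) = tau X n := by
    unfold tau
    congr 1
    ext k
    simp
  have hvis : ∀ y, visits (fun i => X i + 1) (tau X n) (y + 1) = visits X (tau X n) y := by
    intro y
    simp [visits]
  unfold zeta
  rw [htau]
  refine Prod.ext ?_ ?_
  · simp only [Function.iterate_succ, Function.comp_apply, remaining, shift_removeCookies, hvis]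
  · simp

lemma zeta_cons (ω : Env) {x : ℤ} {X : ℕ → ℤ} {n : ℕ} (hx : x < n) (h : ∃ k, (n : ℤ) ≤ X k) :
    zeta ω (cons x X) n = zeta (removeCookies ω (Pi.single x 1)) X n := by
  simp only [zeta, tau_cons hx h, remaining, visits_cons, removeCookies_add, cons_succ]

/-- The law of the walk as a kernel on the states. -/
def stateKernel : Kernel State (ℕ → ℤ) :=
  quenchedKernel.comap (fun p : State => (p.1, (p.2 : ℤ)))
    (measurable_fst.prodMk
      ((Measurable.of_discrete (f := fun n : ℕ => (n : ℤ))).comp measurable_snd))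

instance : IsMarkovKernel stateKernel := by unfold stateKernel; infer_instance

lemma measurable_quenched_apply {S : Set (State × (ℕ → ℤ))} (hS : MeasurableSet S) :
    Measurable fun p : State => quenched p.1 (p.2 : ℤ) {X | (p, X) ∈ S} :=
  Kernel.measurable_kernel_prodMk_left (κ := stateKernel) hS

lemma measurableSet_limsupTop : MeasurableSet {X : ℕ → ℤ | LimsupTop X} := by
  have : {X : ℕ → ℤ | LimsupTop X} =
      ⋂ m : ℤ, ⋂ N : ℕ, ⋃ n : ℕ, ⋃ _ : N ≤ n, {X | X n ∈ Set.Ici m} := by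
    ext X
    simp [LimsupTop, frequently_atTop]
  rw [this]
  exact MeasurableSet.iInter fun m => MeasurableSet.iInter fun N => MeasurableSet.iUnion fun n =>
    MeasurableSet.iUnion fun _ => measurableSet_coord n _

lemma measurableSet_psi : MeasurableSet Psi :=
  measurable_quenched_apply (S := {q : State × (ℕ → ℤ) | ¬ LimsupTop q.2})
    (measurable_snd measurableSet_limsupTop.compl) (measurableSet_singleton 0)

/-- The state of the cookie environment process that belongs to a state of the augmented chain. -/
def toState (a : AugState) : State := (removeCookies a.1 a.2.1, a.2.2)

lemma measurable_toState : Measurable toState :=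
  (measurable_removeCookies.comp (measurable_fst.prodMk
    (measurable_fst.comp measurable_snd))).prodMk (measurable_snd.comp measurable_snd)

/-- Capping the counts at `M` does not change the remaining environment, since all cookies from
number `M` on equal `μ`. -/
lemma toState_land {ω : Env} (hω : ω ∈ OmegaPlus M μ) (p : (ℤ → ℕ) × ℤ) :
    toState (land M ω p) = (shift (removeCookies ω p.1), (p.2 - 1).toNat) := by
  refine Prod.ext ?_ rfl
  funext y j
  simp only [toState, land, removeCookies, shift]
  rcases le_total (p.1 (y + 1)) M with h | h
  · rw [min_eq_right h]
  · rw [min_eq_left h, (hω (y + 1)).2 _ (by omega), (hω (y + 1)).2 _ (by omega)]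

lemma zeta_one {ω : Env} (hω : ω ∈ OmegaPlus M μ) (l : ℤ → ℕ) (X : ℕ → ℤ) :
    zeta (removeCookies ω l) X 1 = toState (land M ω (cross l X)) := by
  rw [toState_land hω]
  simp [zeta, cross, remaining, removeCookies_add]

/-- The probability that the cookie environment process that starts in `p` is in `A`. -/
def zetaProb (A : Set (ℕ → State)) (p : State) : ℝ≥0∞ :=
  quenched p.1 (p.2 : ℤ) {X | (fun n => zeta p.1 X n) ∈ A}

lemma measurableSet_zeta (ω : Env) {A : Set (ℕ → State)} (hA : MeasurableSet A) (k : ℕ) :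
    MeasurableSet {X | (fun n => zeta ω X (n + k)) ∈ A} :=
  (measurable_pi_lambda _ fun n =>
    (measurable_uncurry_zeta (n + k)).comp measurable_prodMk_left) hA

lemma measurable_zetaProb_add {A : Set (ℕ → State)} (hA : MeasurableSet A) (k : ℕ) :
    Measurable fun p : State => quenched p.1 (p.2 : ℤ) {X | (fun n => zeta p.1 X (n + k)) ∈ A} := by
  have : Measurable fun (q : State × (ℕ → ℤ)) n => zeta q.1.1 q.2 (n + k) :=
    measurable_pi_lambda _ fun n => (measurable_uncurry_zeta (n + k)).comp
      ((measurable_fst.comp measurable_fst).prodMk measurable_snd)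
  exact measurable_quenched_apply
    (S := {q : State × (ℕ → ℤ) | (fun n => zeta q.1.1 q.2 (n + k)) ∈ A}) (this hA)

lemma measurable_zetaProb {A : Set (ℕ → State)} (hA : MeasurableSet A) :
    Measurable (zetaProb A) := measurable_zetaProb_add hA 0

/-- The strong Markov property at the first entrance to `[1, ∞)`, for the entrances in
`crossSet k`. -/
lemma walk_crossSet_inter {ω : Env} (hω : ω ∈ OmegaPlus M μ)
    (htop : ∀ l x, ∀ᵐ X ∂walk ω l x, LimsupTop X) {A : Set (ℕ → State)} (hA : MeasurableSet A)
    (k : ℕ) (l : ℤ → ℕ) (x : ℤ) :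
    ∫⁻ X in crossSet k, {X | (fun n => zeta (removeCookies ω l) X (n + 1)) ∈ A}.indicator 1 X
      ∂walk ω l x = crossInt ω (fun p => zetaProb A (toState (land M ω p))) k l x := by
  have hmf : Measurable fun p => zetaProb A (toState (land M ω p)) :=
    (measurable_zetaProb hA).comp (measurable_toState.comp
      ((measurable_uncurry_land M).comp measurable_prodMk_left))
  have hmA : ∀ l, MeasurableSet {X | (fun n => zeta (removeCookies ω l) X (n + 1)) ∈ A} :=
    fun l => measurableSet_zeta _ hA 1
  have hmI : ∀ l, Measurable (Set.indicator
      {X | (fun n => zeta (removeCookies ω l) X (n + 1)) ∈ A} (1 : (ℕ → ℤ) → ℝ≥0∞)) :=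
    fun l => measurable_one.indicator (hmA l)
  have hge : ∀ k l x, 1 ≤ x → ∫⁻ X in crossSet k,
      {X | (fun n => zeta (removeCookies ω l) X (n + 1)) ∈ A}.indicator 1 X ∂walk ω l x =
        crossInt ω (fun p => zetaProb A (toState (land M ω p))) k l x := by
    intro k l x hx
    rw [crossInt_of_le hx, Measure.restrict_eq_self_of_ae_mem
      ((walk_start ω l x).mono fun X hX => mem_crossSet_of_le (by omega)),
      lintegral_indicator_one (hmA l), toState_land hω, zetaProb, walk]
    -- The walk has already crossed, and translation by one turns its process from index `1` on into
    -- the process of the landed state from index `0` on.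
    obtain ⟨y, rfl⟩ : ∃ y : ℕ, x = y + 1 := ⟨(x - 1).toNat, by omega⟩
    have hm1 : Measurable fun (X : ℕ → ℤ) n => X n + 1 := by fun_prop
    rw [quenched_shift, Measure.map_apply hm1 (hmA l)]
    simp [zeta_add_one]
  induction k generalizing l x with
  | zero =>
    rcases le_or_gt 1 x with hx | hx
    · exact hge 0 l x hx
    · rw [crossInt_zero hx]
      have h0 : walk ω l x (crossSet 0) = 0 := by
        refine measure_mono_null (t := {X : ℕ → ℤ | ¬ X 0 = x}) ?_ (ae_iff.1 (walk_start ω l x))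
        intro X hX h'
        have h1 : 1 ≤ X 0 := hX
        rw [h'] at h1
        omega
      rw [Measure.restrict_eq_zero.2 h0, lintegral_zero_measure]
  | succ k ih =>
    rcases le_or_gt 1 x with hx | hx
    · exact hge _ l x hx
    rw [crossInt_succ hmf hx, ← lintegral_indicator (measurableSet_crossSet _), lintegral_walk _ _ _
      (F := (crossSet (k + 1)).indicator fun X => Set.indicator
        {X | (fun n => zeta (removeCookies ω l) X (n + 1)) ∈ A} 1 X)
      ((hmI l).indicator (measurableSet_crossSet _))]
    refine lintegral_congr fun z => ?_
    rw [← ih, ← lintegral_indicator (measurableSet_crossSet k)]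
    have : ∀ᵐ X ∂walk ω (l + Pi.single x 1) (x + z),
        (crossSet (k + 1)).indicator (fun X => Set.indicator
          {X | (fun n => zeta (removeCookies ω l) X (n + 1)) ∈ A}
            (1 : (ℕ → ℤ) → ℝ≥0∞) X) (cons x X) =
        if |z| ≤ k then (crossSet k).indicator (fun X => Set.indicator
          {X | (fun n => zeta (removeCookies ω (l + Pi.single x 1)) X (n + 1)) ∈ A} 1 X) X
        else 0 := by
      filter_upwards [walk_start ω (l + Pi.single x 1) (x + z),
        htop (l + Pi.single x 1) (x + z)] with X hX hXtop
      have hz : |X 0 - x| = |z| := by rw [hX]; congr 1; ring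
      -- All levels `n + 1` must be reached after the prepended step, since `tau` has a default
      -- value; hence the assumption `LimsupTop` and not only a hit of `[1, ∞)`.
      have hzeta : (fun n => zeta (removeCookies ω l) (cons x X) (n + 1)) =
          fun n => zeta (removeCookies ω (l + Pi.single x 1)) X (n + 1) := by
        funext n
        rw [zeta_cons _ (by push_cast; omega) (hXtop.exists_le _), removeCookies_add]
      have hind : Set.indicator {X | (fun n => zeta (removeCookies ω l) X (n + 1)) ∈ A}
          (1 : (ℕ → ℤ) → ℝ≥0∞) (cons x X) = Set.indicator
          {X | (fun n => zeta (removeCookies ω (l + Pi.single x 1)) X (n + 1)) ∈ A} 1 X := by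
        classical
        rw [Set.indicator_apply, Set.indicator_apply]
        simp only [Set.mem_ofPred_eq, hzeta, Pi.one_apply]
      by_cases h : X ∈ crossSet k
      · rw [Set.indicator_of_mem h]
        split_ifs with hk
        · rw [Set.indicator_of_mem ((cons_mem_crossSet_succ hx k X).2 ⟨hz ▸ hk, h⟩), hind]
        · rw [Set.indicator_of_notMem]
          exact fun h' => hk (hz ▸ ((cons_mem_crossSet_succ hx k X).1 h').1)
      · rw [Set.indicator_of_notMem h, Set.indicator_of_notMem]
        · simp
        · exact fun h' => h ((cons_mem_crossSet_succ hx k X).1 h').2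
    rw [lintegral_congr_ae this]
    split_ifs
    · rfl
    · simp

lemma walk_zeta_succ {ω : Env} (hω : ω ∈ OmegaPlus M μ)
    (htop : ∀ l x, ∀ᵐ X ∂walk ω l x, LimsupTop X) {A : Set (ℕ → State)} (hA : MeasurableSet A)
    (l : ℤ → ℕ) (x : ℤ) :
    walk ω l x {X | (fun n => zeta (removeCookies ω l) X (n + 1)) ∈ A} =
      ∫⁻ X, zetaProb A (toState (land M ω (cross l X))) ∂walk ω l x := by
  have hhit : ∀ᵐ X ∂walk ω l x, ∃ n, 1 ≤ X n := (htop l x).mono fun X hX => hX.exists_le 1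
  rw [← iSup_crossInt (f := fun p => zetaProb A (toState (land M ω p))) hhit]
  simp_rw [← walk_crossSet_inter hω htop hA]
  rw [← setLIntegral_iUnion_of_directed _ monotone_crossSet.directed_le, iUnion_crossSet,
    Measure.restrict_eq_self_of_ae_mem (s := {X : ℕ → ℤ | ∃ n, 1 ≤ X n}) hhit,
    lintegral_indicator_one (measurableSet_zeta _ hA 1)]

/-- For `OmegaPlus` environments `toState` carries a step of the chain to a step of the cookie
environment process (`zeta_one`). Invariance of `ν` then gives one-step stationarity, and with the
strong Markov property stationarity of the whole process. -/
theorem isStationaryLaw_map_toState {ν : Measure AugState} (hν : ν.bind (crossKernel M) = ν)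
    (hω : ∀ᵐ a ∂ν, a.1 ∈ OmegaPlus M μ)
    (htop : ∀ᵐ a ∂ν, ∀ l x, ∀ᵐ X ∂walk a.1 l x, LimsupTop X) :
    IsStationaryLaw (ν.map toState) := by
  constructor
  · intro A hA
    have hm : Measurable fun p : State => quenched p.1 (p.2 : ℤ) {X | zeta p.1 X 1 ∈ A} :=
      measurable_quenched_apply (S := {q : State × (ℕ → ℤ) | zeta q.1.1 q.2 1 ∈ A})
        (((measurable_uncurry_zeta 1).comp
          ((measurable_fst.comp measurable_fst).prodMk measurable_snd)) hA)
    have hA' := measurable_toState hA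
    rw [lintegral_map hm measurable_toState, Measure.map_apply measurable_toState hA]
    conv_rhs => rw [← hν, Measure.bind_apply hA' (crossKernel M).measurable.aemeasurable]
    refine lintegral_congr_ae ?_
    filter_upwards [hω] with a ha
    rw [← lintegral_indicator_one hA', lintegral_crossKernel _ _ (measurable_one.indicator hA'),
      ← lintegral_indicator_one (s := {X | zeta (toState a).1 X 1 ∈ A})
        (((measurable_uncurry_zeta 1).comp measurable_prodMk_left) hA)]
    refine lintegral_congr fun X => ?_
    classical
    rw [Set.indicator_apply, Set.indicator_apply, Set.mem_preimage, ← zeta_one ha]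
    rfl
  · intro A hA
    change _ = ∫⁻ p, zetaProb A p ∂ν.map toState
    have hP := (measurable_zetaProb hA).comp measurable_toState
    rw [lintegral_map (measurable_zetaProb_add hA 1) measurable_toState,
      lintegral_map (measurable_zetaProb hA) measurable_toState]
    conv_rhs => rw [← hν, Measure.lintegral_bind (f := fun a => zetaProb A (toState a))
      (crossKernel M).measurable.aemeasurable hP.aemeasurable]
    refine lintegral_congr_ae ?_
    filter_upwards [hω, htop] with a ha ha'
    rw [lintegral_crossKernel _ _ (f := fun a => zetaProb A (toState a)) hP]
    exact walk_zeta_succ ha ha' hA _ _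

end

section

variable {η : Measure Env} {M : ℕ} {μ : ProbabilityMeasure ℤ} {ν : Measure AugState}

/-! ### The drifts of the cookies -/

/-- The evaluation of probability measures as a kernel. -/
def evalKernel : Kernel (ProbabilityMeasure ℤ) ℤ := ⟨fun ν => ν, measurable_subtype_coe⟩

instance : IsMarkovKernel evalKernel := ⟨fun ν => ν.2⟩

lemma measurable_mean : Measurable mean :=
  (StronglyMeasurable.integral_kernel_prod_right' (κ := evalKernel)
    (f := fun p : ProbabilityMeasure ℤ × ℤ => (p.2 : ℝ))
    (Measurable.stronglyMeasurable (Measurable.of_discrete.comp measurable_snd))).measurable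

lemma hasFiniteMean_iff (ν : ProbabilityMeasure ℤ) :
    HasFiniteMean ν ↔ ∫⁻ z : ℤ, (z.natAbs : ℝ≥0∞) ∂(ν : Measure ℤ) < ∞ := by
  have h : ∀ z : ℤ, ‖(z : ℝ)‖ₑ = (z.natAbs : ℝ≥0∞) := by
    intro z
    rw [Real.enorm_eq_ofReal_abs, ← Int.cast_abs, Int.abs_eq_natAbs, Int.cast_natCast,
      ENNReal.ofReal_natCast]
  rw [HasFiniteMean, Integrable, and_iff_right Measurable.of_discrete.aestronglyMeasurable,
    hasFiniteIntegral_iff_enorm]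
  simp_rw [h]

lemma enorm_mean_le (ν : ProbabilityMeasure ℤ) :
    ‖mean ν‖ₑ ≤ ∫⁻ z : ℤ, (z.natAbs : ℝ≥0∞) ∂(ν : Measure ℤ) := by
  refine (enorm_integral_le_lintegral_enorm _).trans (le_of_eq (lintegral_congr fun z => ?_))
  rw [Real.enorm_eq_ofReal_abs, ← Int.cast_abs, Int.abs_eq_natAbs, Int.cast_natCast,
    ENNReal.ofReal_natCast]

lemma measurableSet_hasFiniteMean : MeasurableSet {ν : ProbabilityMeasure ℤ | HasFiniteMean ν} := by
  simp_rw [hasFiniteMean_iff]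
  exact measurableSet_lt ((Measure.measurable_lintegral .of_discrete).comp measurable_subtype_coe)
    measurable_const

lemma measurableSet_eq_probabilityMeasure (μ : ProbabilityMeasure ℤ) :
    MeasurableSet {ν : ProbabilityMeasure ℤ | ν = μ} := by
  have : {ν : ProbabilityMeasure ℤ | ν = μ} =
      ⋂ z : ℤ, {ν : ProbabilityMeasure ℤ | (ν : Measure ℤ) {z} = (μ : Measure ℤ) {z}} := by
    ext ν
    simp only [Set.mem_iInter, Set.mem_ofPred_eq]
    refine ⟨fun h z => h ▸ rfl, fun h => Subtype.ext (Measure.ext_of_singleton h)⟩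
  rw [this]
  refine MeasurableSet.iInter fun z => measurableSet_eq_fun ?_ measurable_const
  exact (Measure.measurable_coe (measurableSet_singleton z)).comp measurable_subtype_coe

lemma measurableSet_omegaPlus (M : ℕ) (μ : ProbabilityMeasure ℤ) :
    MeasurableSet (OmegaPlus M μ) := by
  have he : ∀ x j, Measurable fun ω : Env => ω x j := fun x j => by fun_prop
  have : OmegaPlus M μ = ⋂ x : ℤ, (⋂ j : ℕ, ⋂ _ : j < M,
      {ω : Env | HasFiniteMean (ω x j)} ∩ {ω : Env | 0 ≤ mean (ω x j)}) ∩
      ⋂ j : ℕ, ⋂ _ : M ≤ j, {ω : Env | ω x j = μ} := by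
    ext ω
    simp [OmegaPlus]
  rw [this]
  refine MeasurableSet.iInter fun x => MeasurableSet.inter ?_ ?_
  · refine MeasurableSet.iInter fun j => MeasurableSet.iInter fun _ => MeasurableSet.inter ?_ ?_
    · exact he x j measurableSet_hasFiniteMean
    · exact measurableSet_le measurable_const (measurable_mean.comp (he x j))
  · exact MeasurableSet.iInter fun j => MeasurableSet.iInter fun _ =>
      he x j (measurableSet_eq_probabilityMeasure μ)

/-- Removal can bring `μ` into the first `M` places, which is allowed because `μ` has finite mean
`0`. -/
lemma removeCookies_mem_omegaPlus (hfin : HasFiniteMean μ) (hzero : mean μ = 0) {ω : Env}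
    (hω : ω ∈ OmegaPlus M μ) (l : ℤ → ℕ) : removeCookies ω l ∈ OmegaPlus M μ := by
  refine fun x => ⟨fun j _ => ?_, fun j hj => (hω x).2 _ (hj.trans (Nat.le_add_left _ _))⟩
  rcases lt_or_ge (l x + j) M with h | h
  · exact (hω x).1 _ h
  · simp only [removeCookies, (hω x).2 _ h, hzero]
    exact ⟨hfin, le_rfl⟩

lemma mean_nonneg_of_mem_omegaPlus (hzero : mean μ = 0) {ω : Env} (hω : ω ∈ OmegaPlus M μ) (x : ℤ)
    (j : ℕ) : 0 ≤ mean (ω x j) := by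
  rcases lt_or_ge j M with h | h
  · exact ((hω x).1 j h).2
  · rw [(hω x).2 j h, hzero]

/-- The removed drifts are nonnegative, and the copies of `μ` that move up have drift `0`. -/
lemma dbar_removeCookies_le (hzero : mean μ = 0) {ω : Env} (hω : ω ∈ OmegaPlus M μ)
    (l : ℤ → ℕ) (x : ℤ) : dbar M (removeCookies ω l) x ≤ dbar M ω x := by
  have h0 := mean_nonneg_of_mem_omegaPlus hzero hω x
  have hsub : Finset.range M ⊆ Finset.range (l x + M) :=
    Finset.range_subset_range.2 (Nat.le_add_left _ _)
  calc dbar M (removeCookies ω l) x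
      ≤ ∑ j ∈ Finset.range (l x), mean (ω x j) + ∑ j ∈ Finset.range M, mean (ω x (l x + j)) :=
        le_add_of_nonneg_left (Finset.sum_nonneg fun j _ => h0 j)
    _ = ∑ j ∈ Finset.range (l x + M), mean (ω x j) := (Finset.sum_range_add _ _ _).symm
    _ = dbar M ω x := by
        refine (Finset.sum_subset hsub fun j _ hj => ?_).symm
        rw [(hω x).2 j (by simpa using hj), hzero]

lemma measurable_dbar (M : ℕ) (y : ℤ) : Measurable fun ω : Env => dbar M ω y :=
  Finset.measurable_sum _ fun j _ => measurable_mean.comp (by fun_prop)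

lemma integrable_dbar_zero (h_moment : ∫⁻ ω, ∑ j ∈ Finset.range M,
      ∫⁻ z : ℤ, (z.natAbs : ℝ≥0∞) ∂(ω 0 j : Measure ℤ) ∂η < ∞) :
    Integrable (fun ω => dbar M ω 0) η := by
  refine ⟨(measurable_dbar M 0).aestronglyMeasurable, ?_⟩
  rw [hasFiniteIntegral_iff_enorm]
  refine lt_of_le_of_lt (lintegral_mono fun ω => ?_) h_moment
  refine (enorm_sum_le _ _).trans ?_
  exact Finset.sum_le_sum fun j _ => enorm_mean_le _

lemma identDistrib_dbar
    (h_ident : ∀ x : ℤ, IdentDistrib (fun ω : Env => ω x) (fun ω : Env => ω 0) η η) (y : ℤ) :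
    IdentDistrib (fun ω => dbar M ω y) (fun ω => dbar M ω 0) η η := by
  have h : Measurable fun s : ℕ → ProbabilityMeasure ℤ => ∑ j ∈ Finset.range M, mean (s j) :=
    Finset.measurable_sum _ fun j _ => measurable_mean.comp (by fun_prop)
  exact (h_ident y).comp h

lemma delta_eq (hzero : mean μ = 0) (hη : ∀ᵐ ω ∂η, ω ∈ OmegaPlus M μ) :
    delta η = ∫ ω, dbar M ω 0 ∂η := by
  refine integral_congr_ae ?_
  filter_upwards [hη] with ω hω
  refine tsum_eq_sum fun j hj => ?_
  rw [(hω 0).2 j (by simpa using hj), hzero]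

lemma integrable_dbar_map_toState (hzero : mean μ = 0) (hη : ∀ᵐ ω ∂η, ω ∈ OmegaPlus M μ)
    (h_moment : ∫⁻ ω, ∑ j ∈ Finset.range M,
      ∫⁻ z : ℤ, (z.natAbs : ℝ≥0∞) ∂(ω 0 j : Measure ℤ) ∂η < ∞)
    (h_ident : ∀ x : ℤ, IdentDistrib (fun ω : Env => ω x) (fun ω : Env => ω 0) η η)
    (hν : Inherited η M ν) (y : ℤ) :
    Integrable (fun p : State => dbar M p.1 y) (ν.map toState) ∧
      ∫ p, dbar M p.1 y ∂ν.map toState ≤ delta η := by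
  have hη' : Integrable (fun ω => dbar M ω y) η :=
    (identDistrib_dbar h_ident y).integrable_iff.2 (integrable_dbar_zero h_moment)
  have hm : Measurable fun p : State => dbar M p.1 y := (measurable_dbar M y).comp measurable_fst
  have hmη : AEStronglyMeasurable (fun ω => dbar M ω y) (ν.map Prod.fst) :=
    (measurable_dbar M y).aestronglyMeasurable
  have h1 : Integrable (fun a : AugState => dbar M a.1 y) ν := by
    rw [← hν.map_fst] at hη'
    exact (integrable_map_measure hmη measurable_fst.aemeasurable).1 hη'
  have hω := hν.ae_fst hη
  have h2 : Integrable (fun a : AugState => dbar M (toState a).1 y) ν := by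
    refine h1.mono' (hm.comp measurable_toState).aestronglyMeasurable ?_
    filter_upwards [hω] with a ha
    have h0 : 0 ≤ dbar M (toState a).1 y :=
      Finset.sum_nonneg fun j _ => mean_nonneg_of_mem_omegaPlus hzero ha y _
    rw [Real.norm_of_nonneg h0]
    exact dbar_removeCookies_le hzero ha _ y
  refine ⟨(integrable_map_measure hm.aestronglyMeasurable measurable_toState.aemeasurable).2 h2, ?_⟩
  rw [integral_map measurable_toState.aemeasurable hm.aestronglyMeasurable, delta_eq hzero hη,
    ← (identDistrib_dbar h_ident y).integral_eq]
  calc _ ≤ ∫ a, dbar M a.1 y ∂ν := by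
        refine integral_mono_ae h2 h1 ?_
        filter_upwards [hω] with a ha
        exact dbar_removeCookies_le hzero ha _ y
    _ = ∫ ω, dbar M ω y ∂η := by
        rw [← integral_map measurable_fst.aemeasurable hmη, hν.map_fst]

/-! ### The environment on the two half-lines -/

/-- No cookie has been removed at the sites `x ≥ 0`, so `toState` leaves the right half unchanged.
-/
lemma Inherited.rightEnv_toState (hν : Inherited η M ν) :
    (fun a => rightEnv (toState a).1) =ᵐ[ν] fun a => rightEnv a.1 := by
  filter_upwards [hν.right] with a ha
  funext x j
  simp [toState, rightEnv, removeCookies, ha x x.2]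

lemma Inherited.map_rightEnv_toState (hν : Inherited η M ν) :
    (ν.map toState).map (fun p => rightEnv p.1) = η.map rightEnv := by
  have hm : Measurable fun p : State => rightEnv p.1 := measurable_rightEnv.comp measurable_fst
  rw [Measure.map_map hm measurable_toState]
  refine (Measure.map_congr hν.rightEnv_toState).trans ?_
  rw [← hν.map_fst, Measure.map_map measurable_rightEnv measurable_fst]
  rfl

lemma Inherited.indepFun_toState (hν : Inherited η M ν) :
    IndepFun (fun p : State => rightEnv p.1) (fun p : State => (p.2, leftEnv p.1))
      (ν.map toState) := by
  have hind : IndepFun (fun a : AugState => rightEnv a.1) past ν := by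
    rw [indepFun_iff_measure_inter_preimage_eq_mul]
    intro S T hS hT
    rw [hν.indep S T hS hT]
    congr 1
    exact (hν.fst _ (measurable_rightEnv hS)).symm
  -- An arbitrary filler for the sites `x ≥ 0`; it shows that the overshoot and the remaining left
  -- environment are a function of the past alone.
  let t : ℕ → ProbabilityMeasure ℤ := fun _ => ⟨Measure.dirac 0, inferInstance⟩
  let h : Past → ℕ × (Set.Iio (0 : ℤ) → ℕ → ProbabilityMeasure ℤ) := fun p =>
    (p.2.2, leftEnv (removeCookies (glue t p.1) p.2.1))
  have hh : Measurable h := by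
    refine (measurable_snd.comp measurable_snd).prodMk (measurable_leftEnv.comp ?_)
    exact measurable_removeCookies.comp ((measurable_glue.comp
      (measurable_const.prodMk measurable_fst)).prodMk (measurable_fst.comp measurable_snd))
  have hp : ∀ a, h (past a) = ((toState a).2, leftEnv (toState a).1) := by
    intro a
    refine Prod.ext rfl ?_
    funext x j
    simp only [h, past, leftEnv, removeCookies, toState, glue]
    rw [dif_pos (by exact x.2)]
  have hind' : IndepFun (fun a : AugState => rightEnv (toState a).1)
      (fun a => ((toState a).2, leftEnv (toState a).1)) ν := by
    refine (hind.comp measurable_id hh).congr hν.rightEnv_toState.symm ?_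
    exact Eventually.of_forall hp
  have hm1 : Measurable fun p : State => rightEnv p.1 := measurable_rightEnv.comp measurable_fst
  have hm2 : Measurable fun p : State => (p.2, leftEnv p.1) :=
    measurable_snd.prodMk (measurable_leftEnv.comp measurable_fst)
  rw [indepFun_iff_measure_inter_preimage_eq_mul] at hind' ⊢
  intro S T hS hT
  rw [Measure.map_apply measurable_toState ((hm1 hS).inter (hm2 hT)),
    Measure.map_apply measurable_toState (hm1 hS), Measure.map_apply measurable_toState (hm2 hT)]
  exact hind' S T hS hT

end

end

end ExcitedWalk

/-! ### The stationary law as the image of the invariant law of the augmented chain -/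

theorem corollary4p3 (η : Measure ExcitedWalk.Env) [IsProbabilityMeasure η]
    (M : ℕ) (hM : 1 ≤ M) (μ : ProbabilityMeasure ℤ)
    (hμ_fin : ExcitedWalk.HasFiniteMean μ) (hμ_zero : ExcitedWalk.mean μ = 0)
    (hμ_ne : (μ : Measure ℤ) ≠ Measure.dirac 0)
    (hη : ∀ᵐ ω ∂η, ω ∈ ExcitedWalk.OmegaPlus M μ)
    (hμ_bdd : ∃ B : ℕ, (μ : Measure ℤ) (Set.Icc (-(B : ℤ)) (B : ℤ)) = 1)
    (hμ_span : AddSubgroup.closure {z : ℤ | (μ : Measure ℤ) {z} ≠ 0} = ⊤)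
    (h_moment : ∫⁻ ω, ∑ j ∈ Finset.range M,
      ∫⁻ z : ℤ, (z.natAbs : ℝ≥0∞) ∂(ω 0 j : Measure ℤ) ∂η < ∞)
    (h_indep : iIndepFun (fun (x : ℤ) (ω : ExcitedWalk.Env) => ω x) η)
    (h_ident : ∀ x : ℤ, IdentDistrib (fun ω : ExcitedWalk.Env => ω x)
      (fun ω : ExcitedWalk.Env => ω 0) η η) :
    ∃ π : Measure ExcitedWalk.State, IsProbabilityMeasure π ∧
      (∀ᵐ p ∂π, p ∈ ExcitedWalk.Psi) ∧
      ExcitedWalk.IsStationaryLaw π ∧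
      π.map (fun p => ExcitedWalk.rightEnv p.1) = η.map ExcitedWalk.rightEnv ∧
      IndepFun (fun p : ExcitedWalk.State => ExcitedWalk.rightEnv p.1)
        (fun p : ExcitedWalk.State => (p.2, ExcitedWalk.leftEnv p.1)) π ∧
      (∀ᵐ p ∂π, p.1 ∈ ExcitedWalk.OmegaPlus M μ) ∧
      ∀ y : ℤ, Integrable (fun p : ExcitedWalk.State => ExcitedWalk.dbar M p.1 y) π ∧
        ∫ p, ExcitedWalk.dbar M p.1 y ∂π ≤ ExcitedWalk.delta η := by
  open ExcitedWalk in
  obtain ⟨B, hB⟩ := hμ_bdd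
  have hB₀ : ∀ᵐ z ∂(μ : Measure ℤ), z ∈ Set.Icc (-(B : ℤ)) (B : ℤ) :=
    (mem_ae_iff_prob_eq_one .of_discrete).2 hB
  have hB' : ∀ᵐ z ∂(μ : Measure ℤ), z ≤ (B : ℤ) := hB₀.mono fun z hz => (Set.mem_Icc.1 hz).2
  have htail := tailSum_zero_ne_top h_moment
  have htop := ae_limsupTop hη htail h_ident hμ_fin hμ_zero hμ_ne hB'
  obtain ⟨ν, hν, hinv⟩ := exists_invariant_crossKernel hη htail h_indep h_ident hB'
    (htop.mono fun ω hω l x => (hω l x).mono fun X hX => hX.exists_le 1)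
  have hω := hν.ae_fst hη
  have htop' := hν.ae_fst htop
  have := hν.prob
  refine ⟨ν.map toState, Measure.isProbabilityMeasure_map measurable_toState.aemeasurable, ?_,
    isStationaryLaw_map_toState hinv hω htop', hν.map_rightEnv_toState, hν.indepFun_toState, ?_,
    integrable_dbar_map_toState hμ_zero hη h_moment h_ident hν⟩
  · exact (ae_map_iff measurable_toState.aemeasurable measurableSet_psi).2
      (htop'.mono fun a ha => ha a.2.1 a.2.2)
  · exact (ae_map_iff measurable_toState.aemeasurable
      (measurable_fst (measurableSet_omegaPlus M μ))).2
      (hω.mono fun a ha => removeCookies_mem_omegaPlus hμ_fin hμ_zero ha _)
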